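/- Let $r,s\ge 0$, let $\mathbb R^{r,s}$ be $\mathbb R^{r+s}$ with $\langle x,y\rangle_{r,s}=\sum_{k\le r}x_ky_k-\sum_{k>r}x_ky_k$, and let $B=\{z_1,\dots,z_{r+s}\}$ be an orthonormal basis with $\langle z_i,z_i\rangle_{r,s}=1$ for $i\le r$ and $=-1$ for $i>r$. Let $\mathrm{Cl}_{r,s}$ be the Clifford algebra with relations $x^2=-\langle x,x\rangle_{r,s}\mathbf 1$. Let $V$ be a minimal admissible $\mathrm{Cl}_{r,s}$-module: a nonzero real module, with action $J$, carrying a non-degenerate symmetric bilinear form $\langle\cdot,\cdot\rangle_V$ for which every $J_z$, $z\in\mathbb R^{r,s}$, is skew-symmetric, and of the least dimension among nonzero modules with such a form. Let $\mathfrak n=V\oplus\mathbb R^{r,s}$ be the pseudo $H$-type Lie algebra, whose only non-zero brackets are those $[u,v]\in\mathbb R^{r,s}$, $u,v\in V$, given by $\langle z,[u,v]\rangle_{r,s}=\langle J_zu,v\rangle_V$ for all $z\in\mathbb R^{r,s}$. Let $\mathbb A$ be the group of nonsingular linear maps $A$ of $V$ such that $A\oplus\mathrm{Id}$ is an automorphism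 of $\mathfrak n$. Let $G(B)\subset\mathrm{Cl}_{r,s}$ be the group generated by $-\mathbf 1$ and $B$. Let $\mathbb S^M_{r,s}$ be the set of subgroups $\mathcal S\subset G(B)$ with $-\mathbf 1\notin\mathcal S$, with $p^2=\mathbf 1$ and $p\in \mathrm{Pin}(r,0)\times\mathrm{Spin}(0,s)$ for all $p\in\mathcal S$, and of maximal order $\#\mathcal S=2^{r+s}/\dim V$. Put $\widehat{\mathcal S}=\mathcal S\cup(-\mathcal S)$. A signed re-ordering is a map $C\in \mathrm O(r,s)$ with $C(z_i)\in\{\pm z_1,\dots,\pm z_{r+s}\}$ for all $i$. Groups $\mathcal S_1,\mathcal S_2\in\mathbb S^M_{r,s}$ are equivalent if the extension to $\mathrm{Cl}_{r,s}$ of some signed re-ordering maps $\widehat{\mathcal S_1}$ onto $\widehat{\mathcal S_2}$. For $\mathcal S\in\mathbb S_{r,s}^M$ let $\mathcal L(\mathcal S)=\mathrm{span}_{\mathbb Z}\mathfrak B\oplus\mathrm{span}_{\mathbb Z}B$, a Lie algebra over $\mathbb Z$ in $\mathfrak n$, where $\mathfrak B$ is any orthonormal basis of $V$ (vectors of square $\pm1$)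 such that each $J_{z_i}$ permutes $\mathfrak B$ up to signs and such that $\mathfrak B\subset\{J_\sigma v:\sigma\in G(B)\}$ for some $v$ with $\langle v,v\rangle_V=\pm1$ whose isotropy group $\mathcal S_v=\{\sigma\in G(B): J_\sigma v=v\}$ satisfies $\widehat{\mathcal S_v}=\widehat{\mathcal S}$. **Theorem.** Assume that the group $\mathbb A$ consists of orthogonal maps, that is, $\langle Au,Av\rangle_V=\langle u,v\rangle_V$ for all $A\in\mathbb A$ and $u,v\in V$. Let $\mathcal S_1,\mathcal S_2\in\mathbb S^M_{r,s}$, and let $\mathcal L(\mathcal S_1),\mathcal L(\mathcal S_2)$ be given by any choices of bases as above. 1. $\mathcal S_1$ and $\mathcal S_2$ are equivalent if and only if $\mathcal L(\mathcal S_1)$ and $\mathcal L(\mathcal S_2)$ are isomorphic under a map $A\oplus C$, where $A$ is a nonsingular linear map of $V$ and $C$ is a signed re-ordering. 2. If moreover $s=0$, or $(r,s)$ is one of the following pairs ($1\le s\le 3$, $r\le 7$; $s=4$, $r\le 4$; $5\le s\le 7$, $r\le 3$; $(r,s)=(0,8)$), then $\mathcal S_1$ and $\mathcal S_2$ are equivalent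 if and only if $\mathcal L(\mathcal S_1)$ and $\mathcal L(\mathcal S_2)$ are isomorphic as Lie algebras over $\mathbb Z$. -/

import Mathlib

noncomputable section

namespace PseudoH

/-! ### The space `ℝ^{r,s}` and its Clifford algebra -/

/-- The vector space underlying `ℝ^{r,s}`. -/
abbrev RS (r s : ℕ) : Type := Fin r ⊕ Fin s → ℝ

/-- The signs of the standard basis: `1` for the first `r` vectors, `-1` for the last `s`. -/
def sgn (r s : ℕ) : Fin r ⊕ Fin s → ℝ := Sum.elim (fun _ => 1) (fun _ => -1)

/-- The scalar product `⟨x, y⟩_{r,s} = ∑_{k ≤ r} x_k y_k - ∑_{k > r} x_k y_k`. -/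
def scal {r s : ℕ} (x y : RS r s) : ℝ := ∑ i, sgn r s i * (x i * y i)

/-- The quadratic form `x ↦ -⟨x, x⟩_{r,s}`. -/
def negQ (r s : ℕ) : QuadraticForm ℝ (RS r s) :=
  QuadraticMap.weightedSumSquares ℝ (fun i => -sgn r s i)

theorem negQ_apply {r s : ℕ} (x : RS r s) : negQ r s x = -scal x x := by
  simp [negQ, scal, QuadraticMap.weightedSumSquares_apply]

/-- The Clifford algebra `Cl_{r,s}`, with the relations `x * x = -⟨x, x⟩_{r,s}`. -/
abbrev Cl (r s : ℕ) : Type := CliffordAlgebra (negQ r s)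

/-- The inclusion `ℝ^{r,s} → Cl_{r,s}`. -/
abbrev gen {r s : ℕ} : RS r s →ₗ[ℝ] Cl r s := CliffordAlgebra.ι (negQ r s)

/-- `B` is an orthonormal basis of `ℝ^{r,s}`, its first `r` vectors being positive and its last
`s` vectors negative. -/
def IsOrthonormalBasis {r s : ℕ} (B : Module.Basis (Fin r ⊕ Fin s) ℝ (RS r s)) : Prop :=
  ∀ i j, scal (B i) (B j) = if i = j then sgn r s i else 0

/-! ### Admissible modules -/

section Admissible

variable {r s : ℕ} {V : Type*} [AddCommGroup V] [Module ℝ V]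

/-- `V`, with the Clifford action `J` and the form `b`, is an admissible `Cl_{r,s}`-module. -/
structure IsAdmissible (J : Cl r s →ₐ[ℝ] Module.End ℝ V) (b : LinearMap.BilinForm ℝ V) :
    Prop where
  nondegenerate : b.Nondegenerate
  symm : ∀ u v, b u v = b v u
  skew : ∀ (z : RS r s) (u v : V), b (J (gen z) u) v + b u (J (gen z) v) = 0

/-- `V` is an admissible module of the least dimension among the nonzero ones. -/
structure IsMinimalAdmissible (J : Cl r s →ₐ[ℝ] Module.End ℝ V) (b : LinearMap.BilinForm ℝ V) :
    Prop where
  admissible : IsAdmissible J b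
  pos : 0 < Module.finrank ℝ V
  minimal : ∀ m : ℕ, 0 < m →
    (∃ (J' : Cl r s →ₐ[ℝ] Module.End ℝ (Fin m → ℝ)) (b' : LinearMap.BilinForm ℝ (Fin m → ℝ)),
      IsAdmissible J' b') →
    Module.finrank ℝ V ≤ m

/-! ### The pseudo `H`-type Lie algebra `V ⊕ ℝ^{r,s}` -/

/-- The `ℝ^{r,s}`-valued bracket on `V`; see `scal_bracketV`. -/
def bracketV (J : Cl r s →ₐ[ℝ] Module.End ℝ V) (b : LinearMap.BilinForm ℝ V) (u v : V) : RS r s :=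
  fun i => sgn r s i * b (J (gen (Pi.single i 1)) u) v

theorem sgn_mul_self (i : Fin r ⊕ Fin s) : sgn r s i * sgn r s i = 1 := by
  cases i <;> simp [sgn]

/-- The defining property `⟨J_z u, v⟩_V = ⟨z, [u, v]⟩_{r,s}` of the bracket. -/
theorem scal_bracketV (J : Cl r s →ₐ[ℝ] Module.End ℝ V) (b : LinearMap.BilinForm ℝ V)
    (z : RS r s) (u v : V) : scal z (bracketV J b u v) = b (J (gen z) u) v := by
  have hz : z = ∑ i, z i • (Pi.single i (1 : ℝ) : RS r s) := by
    ext j; simp [Finset.sum_apply, Pi.single_apply]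
  conv_rhs => rw [hz]
  simp only [map_sum, map_smul, LinearMap.sum_apply, LinearMap.smul_apply, smul_eq_mul, scal,
    bracketV]
  refine Finset.sum_congr rfl fun i _ => ?_
  linear_combination (z i * b (J (gen (Pi.single i 1)) u) v) * sgn_mul_self i

theorem bracketV_add_left (J : Cl r s →ₐ[ℝ] Module.End ℝ V) (b : LinearMap.BilinForm ℝ V)
    (u u' v : V) : bracketV J b (u + u') v = bracketV J b u v + bracketV J b u' v := by
  ext i; simp [bracketV, mul_add]

theorem bracketV_add_right (J : Cl r s →ₐ[ℝ] Module.End ℝ V) (b : LinearMap.BilinForm ℝ V)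
    (u v v' : V) : bracketV J b u (v + v') = bracketV J b u v + bracketV J b u v' := by
  ext i; simp [bracketV, mul_add]

theorem bracketV_smul_right (J : Cl r s →ₐ[ℝ] Module.End ℝ V) (b : LinearMap.BilinForm ℝ V)
    (t : ℝ) (u v : V) : bracketV J b u (t • v) = t • bracketV J b u v := by
  ext i; simp [bracketV, mul_left_comm]

theorem bracketV_self {J : Cl r s →ₐ[ℝ] Module.End ℝ V} {b : LinearMap.BilinForm ℝ V}
    (h : IsAdmissible J b) (u : V) : bracketV J b u u = 0 := by
  ext i
  have h1 := h.skew (Pi.single i 1) u u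
  rw [h.symm u] at h1
  have h2 : b (J (gen (Pi.single i 1)) u) u = 0 := by linarith
  simp [bracketV, h2]

/-- The underlying space `V ⊕ ℝ^{r,s}` of the pseudo `H`-type Lie algebra `𝔫_{r,s}(V)`. -/
def LieN {J : Cl r s →ₐ[ℝ] Module.End ℝ V} {b : LinearMap.BilinForm ℝ V}
    (_h : IsAdmissible J b) : Type _ := V × RS r s

variable {J : Cl r s →ₐ[ℝ] Module.End ℝ V} {b : LinearMap.BilinForm ℝ V}
  (h : IsAdmissible J b)

instance : AddCommGroup (LieN h) := inferInstanceAs (AddCommGroup (V × RS r s))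

instance : Module ℝ (LieN h) := inferInstanceAs (Module ℝ (V × RS r s))

/-- The component of an element of `𝔫_{r,s}(V)` in `V`. -/
def LieN.fst (x : LieN h) : V := Prod.fst x

/-- The component of an element of `𝔫_{r,s}(V)` in `ℝ^{r,s}`. -/
def LieN.snd (x : LieN h) : RS r s := Prod.snd x

/-- The element `(v, z)` of `𝔫_{r,s}(V)`. -/
def LieN.mk (v : V) (z : RS r s) : LieN h := (v, z)

instance : Bracket (LieN h) (LieN h) where
  bracket x y := LieN.mk h 0 (bracketV J b (LieN.fst h x) (LieN.fst h y))

theorem LieN.lie_def (x y : LieN h) :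
    ⁅x, y⁆ = LieN.mk h 0 (bracketV J b (LieN.fst h x) (LieN.fst h y)) := rfl

theorem bracketV_zero_left (v : V) : bracketV J b 0 v = 0 := by
  ext i; simp [bracketV]

theorem bracketV_zero_right (v : V) : bracketV J b v 0 = 0 := by
  ext i; simp [bracketV]

instance : LieRing (LieN h) where
  add_lie _ _ _ := Prod.ext (add_zero 0).symm (bracketV_add_left J b _ _ _)
  lie_add _ _ _ := Prod.ext (add_zero 0).symm (bracketV_add_right J b _ _ _)
  lie_self _ := Prod.ext rfl (bracketV_self h _)
  leibniz_lie x y z := by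
    have h1 : ∀ x y z : LieN h, ⁅x, ⁅y, z⁆⁆ = 0 := fun x y z =>
      Prod.ext rfl (bracketV_zero_right _)
    have h2 : ∀ x y z : LieN h, ⁅⁅x, y⁆, z⁆ = 0 := fun x y z =>
      Prod.ext rfl (bracketV_zero_left _)
    rw [h1, h2, h1, add_zero]

instance : LieAlgebra ℝ (LieN h) where
  lie_smul t _ _ := Prod.ext (smul_zero t).symm (bracketV_smul_right J b t _ _)

/-- The group `𝔸` of those nonsingular linear maps `A` of `V` for which `A ⊕ Id` is an
automorphism of the Lie algebra `𝔫_{r,s}(V)`. -/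
def groupA : Set (V ≃ₗ[ℝ] V) :=
  {A | ∃ φ : LieN h ≃ₗ⁅ℝ⁆ LieN h, ∀ v z, φ (LieN.mk h v z) = LieN.mk h (A v) z}

end Admissible

/-! ### The groups `G(B)` and `𝒮` -/

section Groups

variable {r s : ℕ} (B : Module.Basis (Fin r ⊕ Fin s) ℝ (RS r s))

/-- The group `G(B)` generated by `-1` and the basis vectors, inside the units of `Cl_{r,s}`. -/
def G : Subgroup (Cl r s)ˣ :=
  Subgroup.closure {u | (u : Cl r s) = -1 ∨ ∃ i, (u : Cl r s) = gen (B i)}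

/-- The subgroup `Pin(r,0) × Spin(0,s)` of the units of `Cl_{r,s}`: it is generated by the unit
vectors of the span of the positive basis vectors, and by the products of two unit vectors of the
span of the negative ones. -/
def pinSpin : Subgroup (Cl r s)ˣ :=
  Subgroup.closure
    ({u | ∃ x ∈ Submodule.span ℝ (Set.range fun i => B (Sum.inl i)),
        scal x x = 1 ∧ (u : Cl r s) = gen x} ∪
     {u | ∃ x ∈ Submodule.span ℝ (Set.range fun j => B (Sum.inr j)),
        ∃ y ∈ Submodule.span ℝ (Set.range fun j => B (Sum.inr j)),
        scal x x = -1 ∧ scal y y = -1 ∧ (u : Cl r s) = gen x * gen y})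

/-- `S` is a group of positive involutions in `G(B)`. -/
structure IsPositiveInvolutionGroup (S : Subgroup (Cl r s)ˣ) : Prop where
  le_G : S ≤ G B
  neg_one_notMem : -1 ∉ S
  mem_pinSpin : ∀ p ∈ S, p ∈ pinSpin B
  sq_eq_one : ∀ p ∈ S, p * p = 1

/-- `S` is a group of positive involutions that is maximal with respect to the minimal admissible
module `V`: its order satisfies `#S * (2 dim V) = 2 ^ (r + s + 1) = #G(B)`. -/
structure IsMaximalGroup (V : Type*) [AddCommGroup V] [Module ℝ V] (S : Subgroup (Cl r s)ˣ) :
    Prop extends IsPositiveInvolutionGroup B S where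
  card_eq : Nat.card S * (2 * Module.finrank ℝ V) = 2 ^ (r + s + 1)

/-- The extended group `Ŝ = S ∪ -S`. -/
def hat (S : Subgroup (Cl r s)ˣ) : Set (Cl r s)ˣ := {u | u ∈ S ∨ -u ∈ S}

/-- The orthogonal transformation `C ∈ O(r,s)` is a signed re-ordering of `B`. -/
def IsReordering (C : (negQ r s).IsometryEquiv (negQ r s)) : Prop :=
  ∀ i, ∃ j, C (B i) = B j ∨ C (B i) = -B j

/-- The extension of `C ∈ O(r,s)` to the units of `Cl_{r,s}`. -/
def extend (C : (negQ r s).IsometryEquiv (negQ r s)) : (Cl r s)ˣ →* (Cl r s)ˣ :=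
  Units.map (CliffordAlgebra.map C.toIsometry : Cl r s →* Cl r s)

/-- Equivalence of groups: some signed re-ordering of `B` carries `Ŝ₁` onto `Ŝ₂`. -/
def Equivalent (S₁ S₂ : Subgroup (Cl r s)ˣ) : Prop :=
  ∃ C : (negQ r s).IsometryEquiv (negQ r s), IsReordering B C ∧ extend C '' hat S₁ = hat S₂

end Groups

/-! ### Invariant bases and invariant integral structures -/

section Integral

variable {r s : ℕ} (B : Module.Basis (Fin r ⊕ Fin s) ℝ (RS r s))
  {V : Type*} [AddCommGroup V] [Module ℝ V]
  {J : Cl r s →ₐ[ℝ] Module.End ℝ V} {b : LinearMap.BilinForm ℝ V}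

/-- `e` is an invariant basis of `V`: orthonormal, and permuted up to signs by the `J_z`,
`z ∈ B`. -/
structure IsInvariantBasis (J : Cl r s →ₐ[ℝ] Module.End ℝ V) (b : LinearMap.BilinForm ℝ V)
    {κ : Type*} (e : Module.Basis κ ℝ V) : Prop where
  orthogonal : ∀ i j, i ≠ j → b (e i) (e j) = 0
  unit : ∀ i, b (e i) (e i) = 1 ∨ b (e i) (e i) = -1
  invariant : ∀ k i, ∃ j, J (gen (B k)) (e i) = e j ∨ J (gen (B k)) (e i) = -e j

/-- The isotropy group of `v` in `G(B)`. -/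
def isotropy (J : Cl r s →ₐ[ℝ] Module.End ℝ V) (v : V) : Subgroup (Cl r s)ˣ where
  carrier := {u | u ∈ G B ∧ J (u : Cl r s) v = v}
  mul_mem' := by
    rintro x y ⟨hx, hx'⟩ ⟨hy, hy'⟩
    exact ⟨mul_mem hx hy, by simp [hx', hy']⟩
  one_mem' := ⟨one_mem _, by simp⟩
  inv_mem' := by
    rintro x ⟨hx, hx'⟩
    refine ⟨inv_mem hx, ?_⟩
    conv_lhs => rw [← hx', ← Module.End.mul_apply, ← map_mul, Units.inv_mul]
    simp

/-- `e` is an invariant basis given by the group `S`: it is invariant and consists of elements of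
the orbit `G(B).v` of a unit vector `v` whose isotropy group is `S` up to signs of its elements. -/
structure IsBasisOf (J : Cl r s →ₐ[ℝ] Module.End ℝ V) (b : LinearMap.BilinForm ℝ V)
    (S : Subgroup (Cl r s)ˣ) {κ : Type*} (e : Module.Basis κ ℝ V) : Prop
    extends IsInvariantBasis B J b e where
  exists_vector : ∃ v : V, (b v v = 1 ∨ b v v = -1) ∧ hat (isotropy B J v) = hat S ∧
    ∀ i, ∃ σ ∈ G B, e i = J (σ : Cl r s) v

theorem scal_sum_left {ι : Type*} (t : Finset ι) (c : ι → ℝ) (f : ι → RS r s) (y : RS r s) :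
    scal (∑ k ∈ t, c k • f k) y = ∑ k ∈ t, c k * scal (f k) y := by
  simp only [scal, Finset.sum_apply, Pi.smul_apply, smul_eq_mul, Finset.mul_sum, Finset.sum_mul]
  rw [Finset.sum_comm]
  exact Finset.sum_congr rfl fun _ _ => Finset.sum_congr rfl fun _ _ => by ring

theorem scal_comm (x y : RS r s) : scal x y = scal y x := by
  simp [scal, mul_comm]

theorem eq_sum_scal {B : Module.Basis (Fin r ⊕ Fin s) ℝ (RS r s)} (hB : IsOrthonormalBasis B)
    (x : RS r s) : x = ∑ k, (sgn r s k * scal (B k) x) • B k := by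
  have h1 : ∀ k, sgn r s k * scal (B k) x = B.repr x k := by
    intro k
    have h2 : scal (B k) x = sgn r s k * B.repr x k := by
      rw [scal_comm]
      conv_lhs => rw [← B.sum_repr x]
      rw [scal_sum_left, Finset.sum_eq_single k]
      · rw [hB]; simp [mul_comm]
      · intro j _ hj; rw [hB]; simp [hj]
      · simp
    rw [h2, ← mul_assoc, sgn_mul_self, one_mul]
  simp_rw [h1]
  exact (B.sum_repr x).symm

theorem bracketV_mem_span {B : Module.Basis (Fin r ⊕ Fin s) ℝ (RS r s)}
    (hB : IsOrthonormalBasis B) {κ : Type*} {e : Module.Basis κ ℝ V}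
    (he : IsInvariantBasis B J b e) {x y : V}
    (hx : x ∈ AddSubgroup.closure (Set.range e)) (hy : y ∈ AddSubgroup.closure (Set.range e)) :
    bracketV J b x y ∈ AddSubgroup.closure (Set.range B) := by
  have hneg : ∀ u v : V, bracketV J b u (-v) = -bracketV J b u v := fun u v => by
    have := bracketV_smul_right J b (-1) u v
    simpa using this
  have hnegl : ∀ u v : V, bracketV J b (-u) v = -bracketV J b u v := fun u v => by
    have h0 := bracketV_add_left J b u (-u) v
    rw [add_neg_cancel, bracketV_zero_left] at h0
    exact (neg_eq_of_add_eq_zero_right h0.symm).symm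
  induction hx using AddSubgroup.closure_induction with
  | zero => rw [bracketV_zero_left]; exact zero_mem _
  | add x x' _ _ h1 h2 => rw [bracketV_add_left]; exact add_mem h1 h2
  | neg x _ h1 => rw [hnegl]; exact neg_mem h1
  | mem x hx =>
    obtain ⟨i, rfl⟩ := hx
    induction hy using AddSubgroup.closure_induction with
    | zero => rw [bracketV_zero_right]; exact zero_mem _
    | add y y' _ _ h1 h2 => rw [bracketV_add_right]; exact add_mem h1 h2
    | neg y _ h1 => rw [hneg]; exact neg_mem h1
    | mem y hy =>
      obtain ⟨j, rfl⟩ := hy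
      rw [eq_sum_scal hB (bracketV J b (e i) (e j))]
      refine sum_mem fun k _ => ?_
      have hm : B k ∈ AddSubgroup.closure (Set.range B) :=
        AddSubgroup.subset_closure ⟨k, rfl⟩
      have hint : ∃ n : ℤ, b (J (gen (B k)) (e i)) (e j) = n := by
        obtain ⟨l, hl⟩ := he.invariant k i
        have h3 : ∃ n : ℤ, b (e l) (e j) = n := by
          by_cases hlj : l = j
          · subst hlj
            rcases he.unit l with h4 | h4
            · exact ⟨1, by simp [h4]⟩
            · exact ⟨-1, by simp [h4]⟩
          · exact ⟨0, by simp [he.orthogonal l j hlj]⟩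
        obtain ⟨n, hn⟩ := h3
        rcases hl with hl | hl
        · exact ⟨n, by rw [hl, hn]⟩
        · exact ⟨-n, by rw [hl]; simp [hn]⟩
      have hsg : ∃ n : ℤ, sgn r s k = n := by
        cases k
        · exact ⟨1, by simp [sgn]⟩
        · exact ⟨-1, by simp [sgn]⟩
      obtain ⟨n, hn⟩ := hint
      obtain ⟨m, hm'⟩ := hsg
      rw [scal_bracketV, hn, hm', ← Int.cast_mul, Int.cast_smul_eq_zsmul]
      exact zsmul_mem hm _

/-- The invariant integral structure `span_ℤ {e} ⊕ span_ℤ {B}` of `𝔫_{r,s}(V)` given by the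
invariant basis `e`, as a Lie algebra over `ℤ`. -/
def integralStructure {B : Module.Basis (Fin r ⊕ Fin s) ℝ (RS r s)} (hB : IsOrthonormalBasis B)
    (h : IsAdmissible J b) {κ : Type*} {e : Module.Basis κ ℝ V} (he : IsInvariantBasis B J b e) :
    LieSubalgebra ℤ (LieN h) where
  carrier := {x | LieN.fst h x ∈ AddSubgroup.closure (Set.range e) ∧
    LieN.snd h x ∈ AddSubgroup.closure (Set.range B)}
  add_mem' hx hy := ⟨add_mem hx.1 hy.1, add_mem hx.2 hy.2⟩
  zero_mem' := ⟨zero_mem _, zero_mem _⟩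
  smul_mem' n _ hx := ⟨zsmul_mem hx.1 n, zsmul_mem hx.2 n⟩
  lie_mem' hx hy := ⟨zero_mem _, bracketV_mem_span hB he hx.1 hy.1⟩

/-- Two integral structures are isomorphic as Lie algebras over `ℤ`. -/
def Isomorphic {h : IsAdmissible J b} (L₁ L₂ : LieSubalgebra ℤ (LieN h)) : Prop :=
  Nonempty (L₁ ≃ₗ⁅ℤ⁆ L₂)

/-- Two integral structures are isomorphic under a map `A ⊕ C`, where `A` is a nonsingular linear
map of `V` and `C ∈ O(r,s)` is a signed re-ordering of `B`. -/
def IsomorphicByReordering {h : IsAdmissible J b} (L₁ L₂ : LieSubalgebra ℤ (LieN h)) : Prop :=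
  ∃ (Φ : L₁ ≃ₗ⁅ℤ⁆ L₂) (A : V ≃ₗ[ℝ] V) (C : (negQ r s).IsometryEquiv (negQ r s)),
    IsReordering B C ∧
    ∀ x : L₁, (Φ x : LieN h) = LieN.mk h (A (LieN.fst h x)) (C (LieN.snd h x))

end Integral

/-- The pairs `(r,s)` for which the group `𝔸` is tabulated. -/
def InTable (r s : ℕ) : Prop :=
  (s = 0 ∧ 1 ≤ r ∧ r ≤ 8) ∨ (1 ≤ s ∧ s ≤ 3 ∧ r ≤ 7) ∨ (s = 4 ∧ r ≤ 4) ∨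
    (5 ≤ s ∧ s ≤ 7 ∧ r ≤ 3) ∨ (s = 8 ∧ r = 0)

end PseudoH

end

/-!
An element of `G(B)` is, up to sign, a monomial in the basis vectors, so it is described by a binary
word; two elements commute up to the sign given by the form `beta` on words, and the square of an
element depends on its weight. A group `S` of positive involutions becomes a binary code `codeOf`,
and `S ∪ -S` is recovered from the code.

*Re-orderings.* Let `v` be a vector whose orbit contains the basis of `V`. A signed re-ordering `C`
that carries the isotropy group of `v₁` to that of `v₂` is implemented by the linear map
`σ v₁ ↦ C(σ) v₂` (`exists_orbit_map`); after the signs of `C` are adjusted by a functional on the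
code, this map preserves the lattices and the brackets (`exists_intertwine_of_equivalent`).
Conversely let `A ⊕ C` be an isomorphism of the integral structures. Then `Aᵗ A` belongs to `𝔸`, so
it is orthogonal and self-adjoint, hence an involution, and by minimality of `V` it is `1` or `-1`
(`selfAdjoint_involution_eq`, `exists_signed_intertwine`). So `A` intertwines `σ` with `± C(σ)`, and
the extended isotropy groups correspond because they consist of the elements acting trivially on
the lattice modulo `2` (`mem_hat_isotropy_iff`).

*Isomorphisms over `ℤ`, case `s = 0`.* An isomorphism induces maps `A` of `V` and `C` of the center.
The adjoint `D` of `C` satisfies `Aᵗ J_z A = J_{D z}`, and determinants show that `D` is conformal.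
The conformal factors of `D` and of its inverse are integers, so `D` is orthogonal and integral in a
definite space: it is a signed re-ordering (`equivalent_of_isomorphic_definite`).

*Isomorphisms over `ℤ`, case `s > 0`.* Here all groups are equivalent. A word `w` with
`beta u w = ∑ u` on the code and `ctwo w = 0` gives an operator `K` that is self-adjoint,
anticommutes with the Clifford action and satisfies `K² = ±1`; then `p + q K`, for suitable `p` and
`q`, is an element of `𝔸` that is not orthogonal (`IsOrbitBasis.ctwo_eq_one`). So there is no such
word. Summing `(-1)^(ctwo w)` over all words in two ways turns this into strong restrictions on the
length `r + s ≤ 10` and on the order of the code (`code_restrictions`): only the lengths `3`, `5`,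
`6` and `7` survive. Minimality of `V` makes the code maximal (`mem_codeOf_of_beta_eq_zero`). In each
of the surviving cases two codes of the same order are matched by a linear isomorphism that
preserves the numbers of positive and of negative basis vectors in all words, and such an
isomorphism is induced by a permutation of the basis, by the extension theorem of MacWilliams
(`exists_perm_of_wt_eq`, `exists_perm_of_isMaximalCode`).
-/

namespace PseudoH

open CliffordAlgebra

/-! ### Signs and binary words -/

/-- The sign `(-1)^a`, for `a : ZMod 2`, applied to `x`. -/
def signed {M : Type*} [Neg M] (a : ZMod 2) (x : M) : M := if a = 0 then x else -x

section Signed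

variable {M : Type*}

theorem zmod_two_cases (a : ZMod 2) : a = 0 ∨ a = 1 := by
  revert a; decide

@[simp] theorem signed_zero [Neg M] (x : M) : signed 0 x = x := if_pos rfl

@[simp] theorem signed_one [Neg M] (x : M) : signed 1 x = -x := if_neg (by decide)

theorem signed_add [InvolutiveNeg M] (a b : ZMod 2) (x : M) :
    signed (a + b) x = signed a (signed b x) := by
  rcases zmod_two_cases a with rfl | rfl <;> rcases zmod_two_cases b with rfl | rfl <;>
    simp [show (1 : ZMod 2) + 1 = 0 from rfl]

theorem signed_comm [InvolutiveNeg M] (a b : ZMod 2) (x : M) :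
    signed a (signed b x) = signed b (signed a x) := by
  rw [← signed_add, ← signed_add, add_comm]

@[simp] theorem signed_signed [InvolutiveNeg M] (a : ZMod 2) (x : M) :
    signed a (signed a x) = x := by
  rw [← signed_add, CharTwo.add_self_eq_zero, signed_zero]

theorem signed_neg [InvolutiveNeg M] (a : ZMod 2) (x : M) : signed a (-x) = -signed a x := by
  rcases zmod_two_cases a with rfl | rfl <;> simp

theorem mul_signed [Mul M] [HasDistribNeg M] (a : ZMod 2) (x y : M) :
    x * signed a y = signed a (x * y) := by
  rcases zmod_two_cases a with rfl | rfl <;> simp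

theorem signed_mul [Mul M] [HasDistribNeg M] (a : ZMod 2) (x y : M) :
    signed a x * y = signed a (x * y) := by
  rcases zmod_two_cases a with rfl | rfl <;> simp

theorem signed_left_inj [InvolutiveNeg M] {x : M} (hx : x ≠ -x) {a b : ZMod 2} :
    signed a x = signed b x ↔ a = b := by
  refine ⟨fun h => ?_, fun h => by rw [h]⟩
  rcases zmod_two_cases a with rfl | rfl <;> rcases zmod_two_cases b with rfl | rfl <;>
    simp_all

theorem map_signed {F N : Type*} [AddGroup M] [AddGroup N] [FunLike F M N]
    [AddMonoidHomClass F M N] (f : F) (a : ZMod 2) (x : M) : f (signed a x) = signed a (f x) := by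
  rcases zmod_two_cases a with rfl | rfl <;> simp

theorem units_val_signed {R : Type*} [Ring R] (a : ZMod 2) (x : Rˣ) :
    ((signed a x : Rˣ) : R) = signed a (x : R) := by
  rcases zmod_two_cases a with rfl | rfl <;> simp

theorem signed_eq_or [Neg M] (a : ZMod 2) (x : M) : signed a x = x ∨ signed a x = -x := by
  rcases zmod_two_cases a with rfl | rfl <;> simp

theorem eq_or_neg_iff_signed [Neg M] {x y : M} : (x = y ∨ x = -y) ↔ ∃ a, x = signed a y := by
  constructor
  · rintro (h | h)
    · exact ⟨0, by simpa⟩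
    · exact ⟨1, by simpa⟩
  · rintro ⟨a, rfl⟩
    exact signed_eq_or a y

end Signed

section Words

variable {ι : Type*} [Fintype ι]

/-- The weight of a binary word. -/
def wt (w : ι → ZMod 2) : ℕ := ∑ i, (w i).val

/-- The parity of `binom(wt w, 2)`. -/
def ctwo (w : ι → ZMod 2) : ZMod 2 := ((wt w).choose 2 : ℕ)

/-- The bilinear form `(∑ w) (∑ w') + ∑ w w'` on words: it tells whether two monomials of the
Clifford algebra commute. -/
def beta (w w' : ι → ZMod 2) : ZMod 2 := (∑ i, w i) * (∑ i, w' i) + ∑ i, w i * w' i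

theorem wt_cast (w : ι → ZMod 2) : (wt w : ZMod 2) = ∑ i, w i := by
  simp [wt]

theorem beta_add_left (w w' u : ι → ZMod 2) : beta (w + w') u = beta w u + beta w' u := by
  simp only [beta, Pi.add_apply, Finset.sum_add_distrib, add_mul]; ring

theorem beta_add_right (w w' u : ι → ZMod 2) : beta u (w + w') = beta u w + beta u w' := by
  simp only [beta, Pi.add_apply, Finset.sum_add_distrib, mul_add]; ring

theorem beta_comm (w w' : ι → ZMod 2) : beta w w' = beta w' w := by
  simp only [beta, mul_comm]

@[simp] theorem beta_zero_left (u : ι → ZMod 2) : beta 0 u = 0 := by simp [beta]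

@[simp] theorem beta_zero_right (u : ι → ZMod 2) : beta u 0 = 0 := by simp [beta]

theorem beta_single_left [DecidableEq ι] (i : ι) (u : ι → ZMod 2) :
    beta (Pi.single i 1) u = (∑ j, u j) + u i := by
  simp [beta, Pi.single_apply]

theorem wt_add (w w' : ι → ZMod 2) : wt (w + w') + 2 * wt (w * w') = wt w + wt w' := by
  simp only [wt, Finset.mul_sum, ← Finset.sum_add_distrib]
  refine Finset.sum_congr rfl fun i _ => ?_
  have : ∀ a b : ZMod 2, (a + b).val + 2 * (a * b).val = a.val + b.val := by decide
  exact this _ _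

theorem choose_two_add (a b : ℕ) : (a + b).choose 2 = a.choose 2 + b.choose 2 + a * b := by
  induction b with
  | zero => simp
  | succ b ih =>
    rw [← add_assoc, Nat.choose_succ_succ' (a + b), Nat.choose_succ_succ' b, ih]
    simp; ring

theorem ctwo_add (w w' : ι → ZMod 2) : ctwo (w + w') = ctwo w + ctwo w' + beta w w' := by
  have h1 : (((wt (w + w') + 2 * wt (w * w')).choose 2 : ℕ) : ZMod 2) =
      (((wt w + wt w').choose 2 : ℕ) : ZMod 2) := by rw [wt_add]
  have h2 : ∀ c : ℕ, (((2 * c).choose 2 : ℕ) : ZMod 2) = c := by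
    intro c
    rw [two_mul, choose_two_add]
    push_cast
    rw [CharTwo.add_self_eq_zero, zero_add]
    rcases zmod_two_cases (c : ZMod 2) with h | h <;> simp [h]
  rw [choose_two_add, choose_two_add] at h1
  push_cast [h2] at h1
  have h3 : (wt (w * w') : ZMod 2) = ∑ i, w i * w' i := by simp [wt_cast]
  have h4 : (2 : ZMod 2) = 0 := rfl
  simp only [h3, wt_cast, h4] at h1
  simp only [ctwo, beta]
  have h5 : (∑ i, w i * w' i) + (∑ i, w i * w' i) = 0 := CharTwo.add_self_eq_zero _
  linear_combination h1 - h5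

theorem wt_single [DecidableEq ι] (i : ι) : wt (Pi.single i (1 : ZMod 2)) = 1 := by
  rw [wt, Finset.sum_eq_single i]
  · simp [ZMod.val_one]
  · intro j _ hj; simp [hj]
  · simp

@[simp] theorem ctwo_zero : ctwo (0 : ι → ZMod 2) = 0 := by simp [ctwo, wt]

theorem ctwo_single [DecidableEq ι] (i : ι) : ctwo (Pi.single i (1 : ZMod 2)) = 0 := by
  simp [ctwo, wt_single]

variable {r s : ℕ}

/-- The parity of the part of a word on the positive basis vectors. -/
def posPar (w : Fin r ⊕ Fin s → ZMod 2) : ZMod 2 := ∑ i, w (Sum.inl i)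

/-- The parity of the part of a word on the negative basis vectors. -/
def negPar (w : Fin r ⊕ Fin s → ZMod 2) : ZMod 2 := ∑ j, w (Sum.inr j)

theorem sum_eq_posPar_add_negPar (w : Fin r ⊕ Fin s → ZMod 2) :
    ∑ i, w i = posPar w + negPar w := by
  simp [posPar, negPar, Fintype.sum_sum_type]

theorem posPar_add (w w' : Fin r ⊕ Fin s → ZMod 2) :
    posPar (w + w') = posPar w + posPar w' := by
  simp [posPar, Finset.sum_add_distrib]

theorem negPar_add (w w' : Fin r ⊕ Fin s → ZMod 2) :
    negPar (w + w') = negPar w + negPar w' := by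
  simp [negPar, Finset.sum_add_distrib]

@[simp] theorem posPar_zero : posPar (0 : Fin r ⊕ Fin s → ZMod 2) = 0 := by simp [posPar]

@[simp] theorem negPar_zero : negPar (0 : Fin r ⊕ Fin s → ZMod 2) = 0 := by simp [negPar]

end Words

/-! ### Signed re-orderings -/

section Isometries

variable {r s : ℕ}

/-- The scalar product of `ℝ^{r,s}` as a bilinear form. -/
noncomputable def scalForm (r s : ℕ) : LinearMap.BilinForm ℝ (RS r s) :=
  LinearMap.mk₂ ℝ scal
    (fun x y z => by simp [scal, add_mul, mul_add, Finset.sum_add_distrib])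
    (fun c x y => by
      simp only [scal, Pi.smul_apply, smul_eq_mul, Finset.mul_sum]
      exact Finset.sum_congr rfl fun _ _ => by ring)
    (fun x y z => by simp [scal, mul_add, Finset.sum_add_distrib])
    (fun c x y => by
      simp only [scal, Pi.smul_apply, smul_eq_mul, Finset.mul_sum]
      exact Finset.sum_congr rfl fun _ _ => by ring)

@[simp] theorem scalForm_apply (x y : RS r s) : scalForm r s x y = scal x y := rfl

theorem scal_signed_left (a : ZMod 2) (x y : RS r s) :
    scal (signed a x) y = signed a (scal x y) := by
  rcases zmod_two_cases a with rfl | rfl <;> simp [scal]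

theorem scal_signed_right (a : ZMod 2) (x y : RS r s) :
    scal x (signed a y) = signed a (scal x y) := by
  rcases zmod_two_cases a with rfl | rfl <;> simp [scal]

theorem scal_map_of_basis (B : Module.Basis (Fin r ⊕ Fin s) ℝ (RS r s))
    (f : RS r s →ₗ[ℝ] RS r s) (h : ∀ i j, scal (f (B i)) (f (B j)) = scal (B i) (B j))
    (x y : RS r s) : scal (f x) (f y) = scal x y := by
  have h1 : (scalForm r s).compl₁₂ f f = scalForm r s :=
    LinearMap.BilinForm.ext_basis B fun i j => h i j
  exact LinearMap.congr_fun₂ h1 x y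

/-- A linear automorphism preserving the scalar product, as an isometry for `negQ`. -/
noncomputable def isometryOfScal (f : RS r s ≃ₗ[ℝ] RS r s)
    (h : ∀ x y, scal (f x) (f y) = scal x y) : (negQ r s).IsometryEquiv (negQ r s) where
  toLinearEquiv := f
  map_app' x := by
    show negQ r s (f x) = negQ r s x
    rw [negQ_apply, negQ_apply, h]

@[simp] theorem isometryOfScal_apply (f : RS r s ≃ₗ[ℝ] RS r s)
    (h : ∀ x y, scal (f x) (f y) = scal x y) (x : RS r s) : isometryOfScal f h x = f x := rfl

theorem scal_add_self (u v : RS r s) :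
    scal (u + v) (u + v) = scal u u + 2 * scal u v + scal v v := by
  have h : ∀ u v w : RS r s, scal (u + v) w = scal u w + scal v w := fun u v w => by
    simp [scal, add_mul, mul_add, Finset.sum_add_distrib]
  rw [h, scal_comm u, scal_comm v, h, h, scal_comm v u]; ring

theorem scal_isometry (C : (negQ r s).IsometryEquiv (negQ r s)) (x y : RS r s) :
    scal (C x) (C y) = scal x y := by
  have h : ∀ x, scal (C x) (C x) = scal x x := fun x => by
    have := C.map_app x
    rw [negQ_apply, negQ_apply] at this
    linarith
  have h1 := h (x + y)
  rw [map_add, scal_add_self, scal_add_self, h, h] at h1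
  linarith

variable {B : Module.Basis (Fin r ⊕ Fin s) ℝ (RS r s)} (hB : IsOrthonormalBasis B)

/-- The isometry `B i ↦ (-1)^(x i) B (π i)`. -/
noncomputable def signedPerm (π : Equiv.Perm (Fin r ⊕ Fin s)) (hπ : ∀ i, sgn r s (π i) = sgn r s i)
    (x : Fin r ⊕ Fin s → ZMod 2) : (negQ r s).IsometryEquiv (negQ r s) :=
  isometryOfScal
    (B.equiv (B.unitsSMul fun i => signed (x (π.symm i)) 1) π)
    (scal_map_of_basis B (B.equiv (B.unitsSMul fun i => signed (x (π.symm i)) 1) π).toLinearMap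
      (by
        have h : ∀ i, ((signed (x i) 1 : ℝˣ) : ℝ) • B (π i) = signed (x i) (B (π i)) := fun i => by
          rcases zmod_two_cases (x i) with h | h <;> simp [h]
        intro i j
        simp only [LinearEquiv.coe_coe, Module.Basis.equiv_apply, Module.Basis.unitsSMul_apply,
          Equiv.symm_apply_apply, Units.smul_def, h, scal_signed_left, scal_signed_right]
        rw [hB, hB]
        by_cases hij : i = j
        · subst hij; simp [hπ]
        · simp [hij, signed]))

@[simp] theorem signedPerm_apply (π : Equiv.Perm (Fin r ⊕ Fin s))
    (hπ : ∀ i, sgn r s (π i) = sgn r s i) (x : Fin r ⊕ Fin s → ZMod 2) (i : Fin r ⊕ Fin s) :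
    signedPerm hB π hπ x (B i) = signed (x i) (B (π i)) := by
  simp only [signedPerm, isometryOfScal_apply, Module.Basis.equiv_apply,
    Module.Basis.unitsSMul_apply, Equiv.symm_apply_apply, Units.smul_def]
  rcases zmod_two_cases (x i) with h | h <;> simp [h]

/-- The sign change `B i ↦ (-1)^(x i) B i`. -/
noncomputable abbrev flip (x : Fin r ⊕ Fin s → ZMod 2) : (negQ r s).IsometryEquiv (negQ r s) :=
  signedPerm hB (Equiv.refl _) (fun _ => rfl) x

theorem isReordering_signedPerm (π : Equiv.Perm (Fin r ⊕ Fin s))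
    (hπ : ∀ i, sgn r s (π i) = sgn r s i) (x : Fin r ⊕ Fin s → ZMod 2) :
    IsReordering B (signedPerm hB π hπ x) := fun i =>
  ⟨π i, by rw [signedPerm_apply]; exact signed_eq_or _ _⟩

theorem isReordering_iff {C : (negQ r s).IsometryEquiv (negQ r s)} :
    IsReordering B C ↔ ∀ i, ∃ j a, C (B i) = signed a (B j) := by
  simp only [IsReordering, eq_or_neg_iff_signed]

theorem IsReordering.trans {C D : (negQ r s).IsometryEquiv (negQ r s)}
    (hC : IsReordering B C) (hD : IsReordering B D) : IsReordering B (C.trans D) := by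
  rw [isReordering_iff] at *
  intro i
  obtain ⟨j, a, hj⟩ := hC i
  obtain ⟨k, c, hk⟩ := hD j
  refine ⟨k, a + c, ?_⟩
  show D (C (B i)) = _
  rw [hj, map_signed D, hk, ← signed_add]

end Isometries

/-! ### The group `G(B)` and its words -/

section GroupG

variable {r s : ℕ} {B : Module.Basis (Fin r ⊕ Fin s) ℝ (RS r s)}

theorem gen_mul_self (hB : IsOrthonormalBasis B) (i : Fin r ⊕ Fin s) :
    gen (B i) * gen (B i) = algebraMap ℝ (Cl r s) (-sgn r s i) := by
  rw [ι_sq_scalar, negQ_apply, hB, if_pos rfl]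

theorem gen_mul_gen (hB : IsOrthonormalBasis B) {i j : Fin r ⊕ Fin s} (hij : i ≠ j) :
    gen (B i) * gen (B j) = -(gen (B j) * gen (B i)) := by
  apply ι_mul_ι_comm_of_isOrtho
  rw [QuadraticMap.isOrtho_def]
  simp only [negQ_apply]
  rw [scal_add_self, hB i j, if_neg hij]; ring

/-- The basis vector `B i` as a unit of the Clifford algebra. -/
noncomputable def zU (hB : IsOrthonormalBasis B) (i : Fin r ⊕ Fin s) : (Cl r s)ˣ where
  val := gen (B i)
  inv := (-sgn r s i) • gen (B i)
  val_inv := by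
    rw [mul_smul_comm, gen_mul_self hB, Algebra.smul_def, ← map_mul, neg_mul_neg, sgn_mul_self,
      map_one]
  inv_val := by
    rw [smul_mul_assoc, gen_mul_self hB, Algebra.smul_def, ← map_mul, neg_mul_neg, sgn_mul_self,
      map_one]

@[simp] theorem zU_val (hB : IsOrthonormalBasis B) (i : Fin r ⊕ Fin s) :
    (zU hB i : Cl r s) = gen (B i) := rfl

theorem zU_mul_self (hB : IsOrthonormalBasis B) (i : Fin r ⊕ Fin s) :
    zU hB i * zU hB i = signed (posPar (Pi.single i 1)) 1 := by
  apply Units.ext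
  rw [units_val_signed, Units.val_mul, zU_val, gen_mul_self hB]
  cases i with
  | inl i => simp [sgn, posPar, Pi.single_apply]
  | inr j => simp [sgn, posPar]

theorem zU_mul_zU (hB : IsOrthonormalBasis B) (i j : Fin r ⊕ Fin s) :
    zU hB i * zU hB j = signed (beta (Pi.single i 1) (Pi.single j 1)) (zU hB j * zU hB i) := by
  rw [beta_single_left]
  by_cases hij : i = j
  · subst hij; simp [show (1 : ZMod 2) + 1 = 0 from rfl]
  · rw [Pi.single_eq_of_ne hij]
    apply Units.ext
    simp [gen_mul_gen hB hij]

theorem neg_one_mem_G : (-1 : (Cl r s)ˣ) ∈ G B :=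
  Subgroup.subset_closure (Or.inl (by simp))

theorem zU_mem_G (hB : IsOrthonormalBasis B) (i : Fin r ⊕ Fin s) : zU hB i ∈ G B :=
  Subgroup.subset_closure (Or.inr ⟨i, rfl⟩)

theorem neg_mem_G {u : (Cl r s)ˣ} (hu : u ∈ G B) : -u ∈ G B := by
  rw [← neg_one_mul]; exact mul_mem neg_one_mem_G hu

theorem signed_mem_G {u : (Cl r s)ˣ} (hu : u ∈ G B) (a : ZMod 2) : signed a u ∈ G B := by
  rcases signed_eq_or a u with h | h <;> rw [h]
  exacts [hu, neg_mem_G hu]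

/-- Induction along the words of elements of `G(B)`. -/
theorem G_induction (hB : IsOrthonormalBasis B) {p : (Cl r s)ˣ → Prop} (one : p 1)
    (neg : ∀ σ ∈ G B, p σ → p (-σ)) (mul : ∀ i, ∀ σ ∈ G B, p σ → p (zU hB i * σ)) :
    ∀ σ ∈ G B, p σ := by
  intro σ hσ
  have hz : ∀ (u : (Cl r s)ˣ) i, (u : Cl r s) = gen (B i) → u = zU hB i := fun u i h =>
    Units.ext h
  refine Subgroup.closure_induction_left (p := fun x _ => p x) one ?_ ?_ hσ
  · rintro x (hx | ⟨i, hx⟩) y hy hp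
    · obtain rfl : x = -1 := Units.ext (by simpa using hx)
      rw [neg_one_mul]; exact neg y hy hp
    · rw [hz x i hx]; exact mul i y hy hp
  · rintro x (hx | ⟨i, hx⟩) y hy hp
    · obtain rfl : x = -1 := Units.ext (by simpa using hx)
      rw [show (-1 : (Cl r s)ˣ)⁻¹ = -1 from by
        rw [inv_eq_iff_mul_eq_one, neg_mul_neg, one_mul], neg_one_mul]
      exact neg y hy hp
    · rw [hz x i hx]
      have h1 : (zU hB i)⁻¹ = signed (posPar (Pi.single i 1)) (zU hB i) := by
        rw [inv_eq_iff_mul_eq_one, mul_signed, zU_mul_self, signed_signed]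
      rw [h1, signed_mul]
      rcases signed_eq_or (posPar (Pi.single i 1)) (zU hB i * y) with h | h <;> rw [h]
      · exact mul i y hy hp
      · exact neg _ (mul_mem (zU_mem_G hB i) hy) (mul i y hy hp)

theorem ne_neg_self (u : (Cl r s)ˣ) : u ≠ -u := by
  intro h
  have h1 : (u : Cl r s) = -u := by
    conv_lhs => rw [h]
    simp
  have h2 : (2 : ℝ) • (u : Cl r s) = 0 := by
    rw [two_smul]; nth_rewrite 1 [h1]; simp
  exact u.ne_zero ((smul_eq_zero.mp h2).resolve_left two_ne_zero)

theorem extend_val (C : (negQ r s).IsometryEquiv (negQ r s)) (u : (Cl r s)ˣ) :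
    (extend C u : Cl r s) = CliffordAlgebra.map C.toIsometry (u : Cl r s) := rfl

theorem extend_neg (C : (negQ r s).IsometryEquiv (negQ r s)) (u : (Cl r s)ˣ) :
    extend C (-u) = -extend C u := by
  apply Units.ext
  simp [extend_val]

theorem extend_signed (C : (negQ r s).IsometryEquiv (negQ r s)) (a : ZMod 2) (u : (Cl r s)ˣ) :
    extend C (signed a u) = signed a (extend C u) := by
  rcases zmod_two_cases a with rfl | rfl <;> simp [extend_neg]

theorem extend_zU (hB : IsOrthonormalBasis B) {C : (negQ r s).IsometryEquiv (negQ r s)}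
    {i j : Fin r ⊕ Fin s} {a : ZMod 2} (h : C (B i) = signed a (B j)) :
    extend C (zU hB i) = signed a (zU hB j) := by
  apply Units.ext
  rw [extend_val, zU_val, units_val_signed, zU_val, map_apply_ι]
  show gen (C (B i)) = _
  rw [h, map_signed gen]

theorem extend_trans (C D : (negQ r s).IsometryEquiv (negQ r s)) (u : (Cl r s)ˣ) :
    extend (C.trans D) u = extend D (extend C u) := by
  apply Units.ext
  rw [extend_val, extend_val, extend_val, ← AlgHom.comp_apply, map_comp_map]
  rfl

theorem extend_mem_G (hB : IsOrthonormalBasis B) {C : (negQ r s).IsometryEquiv (negQ r s)}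
    (hC : IsReordering B C) : ∀ σ ∈ G B, extend C σ ∈ G B := by
  rw [isReordering_iff] at hC
  refine G_induction hB (by simp) (fun σ _ h => ?_) (fun i σ _ h => ?_)
  · rw [extend_neg]; exact neg_mem_G h
  · obtain ⟨j, a, hj⟩ := hC i
    rw [map_mul, extend_zU hB hj]
    exact mul_mem (signed_mem_G (zU_mem_G hB j) a) h

/-! ### The word of an element of `G(B)` -/

open Classical in
/-- The word of an element of `G(B)`: the basis vector `B i` occurs in `u` an odd number of times
if and only if the automorphism of the Clifford algebra that changes the sign of `B i` does not
fix `u`. -/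
noncomputable def word (hB : IsOrthonormalBasis B) (u : (Cl r s)ˣ) : Fin r ⊕ Fin s → ZMod 2 :=
  fun i => if extend (flip hB (Pi.single i 1)) u = u then 0 else 1

theorem extend_flip_zU (hB : IsOrthonormalBasis B) (x : Fin r ⊕ Fin s → ZMod 2)
    (j : Fin r ⊕ Fin s) :
    extend (flip hB x) (zU hB j) = signed (x j) (zU hB j) :=
  extend_zU hB (signedPerm_apply hB _ _ x j)

theorem extend_flip_single (hB : IsOrthonormalBasis B) (i : Fin r ⊕ Fin s) {σ : (Cl r s)ˣ}
    (hσ : σ ∈ G B) :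
    extend (flip hB (Pi.single i 1)) σ = signed (word hB σ i) σ := by
  have h : ∀ σ ∈ G B, ∃ a, extend (flip hB (Pi.single i 1)) σ = signed a σ := by
    refine G_induction hB ⟨0, by simp⟩ ?_ ?_
    · rintro σ _ ⟨a, h⟩; exact ⟨a, by rw [extend_neg, h, signed_neg]⟩
    · rintro j σ _ ⟨a, h⟩
      exact ⟨_, by rw [map_mul, extend_flip_zU, h, mul_signed, signed_mul, ← signed_add]⟩
  obtain ⟨a, ha⟩ := h σ hσ
  rw [ha]
  rcases zmod_two_cases a with rfl | rfl
  · rw [signed_zero] at ha; simp [word, ha]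
  · rw [signed_one] at ha; simp [word, ha, (ne_neg_self σ).symm]

theorem word_eq_iff (hB : IsOrthonormalBasis B) {σ : (Cl r s)ˣ} (hσ : σ ∈ G B)
    {w : Fin r ⊕ Fin s → ZMod 2}
    (h : ∀ i, extend (flip hB (Pi.single i 1)) σ = signed (w i) σ) : word hB σ = w := by
  funext i
  have := h i
  rwa [extend_flip_single hB i hσ, signed_left_inj (ne_neg_self σ)] at this

theorem word_mul (hB : IsOrthonormalBasis B) {σ τ : (Cl r s)ˣ} (hσ : σ ∈ G B) (hτ : τ ∈ G B) :
    word hB (σ * τ) = word hB σ + word hB τ :=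
  word_eq_iff hB (mul_mem hσ hτ) fun i => by
    rw [map_mul, extend_flip_single hB i hσ, extend_flip_single hB i hτ, signed_mul, mul_signed,
      ← signed_add]
    rfl

@[simp] theorem word_one (hB : IsOrthonormalBasis B) : word hB 1 = 0 :=
  word_eq_iff hB (one_mem _) fun i => by simp

theorem word_neg (hB : IsOrthonormalBasis B) {σ : (Cl r s)ˣ} (hσ : σ ∈ G B) :
    word hB (-σ) = word hB σ :=
  word_eq_iff hB (neg_mem_G hσ) fun i => by
    rw [extend_neg, extend_flip_single hB i hσ, signed_neg]

theorem word_signed (hB : IsOrthonormalBasis B) {σ : (Cl r s)ˣ} (hσ : σ ∈ G B) (a : ZMod 2) :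
    word hB (signed a σ) = word hB σ := by
  rcases zmod_two_cases a with rfl | rfl <;> simp [word_neg hB hσ]

theorem word_zU (hB : IsOrthonormalBasis B) (i : Fin r ⊕ Fin s) :
    word hB (zU hB i) = Pi.single i 1 :=
  word_eq_iff hB (zU_mem_G hB i) fun j => by
    rw [extend_flip_zU]
    simp only [Pi.single_apply, eq_comm]

theorem word_inv (hB : IsOrthonormalBasis B) {σ : (Cl r s)ˣ} (hσ : σ ∈ G B) :
    word hB σ⁻¹ = word hB σ := by
  have h := word_mul hB hσ (inv_mem hσ)
  rw [mul_inv_cancel, word_one] at h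
  funext i
  have h1 : (0 : ZMod 2) = _ := congrFun h i
  exact (CharTwo.add_eq_zero.mp h1.symm).symm

theorem extend_flip (hB : IsOrthonormalBasis B) (x : Fin r ⊕ Fin s → ZMod 2) :
    ∀ σ ∈ G B, extend (flip hB x) σ = signed (∑ i, x i * word hB σ i) σ := by
  refine G_induction hB (by simp) ?_ ?_
  · intro σ hσ h
    rw [extend_neg, h, word_neg hB hσ, signed_neg]
  · intro j σ hσ h
    rw [map_mul, extend_flip_zU, h, word_mul hB (zU_mem_G hB j) hσ, word_zU]
    simp only [Pi.add_apply, mul_add, Finset.sum_add_distrib, signed_add, mul_signed, signed_mul]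
    simp only [Pi.single_apply, mul_ite, mul_one, mul_zero, Finset.sum_ite_eq', Finset.mem_univ,
      if_true]
    exact signed_comm _ _ _

theorem exists_word_eq (hB : IsOrthonormalBasis B) (w : Fin r ⊕ Fin s → ZMod 2) :
    ∃ σ ∈ G B, word hB σ = w := by
  have h : ∀ t : Finset (Fin r ⊕ Fin s), ∃ σ ∈ G B,
      word hB σ = fun i => if i ∈ t then w i else 0 := by
    intro t
    induction t using Finset.induction_on with
    | empty => exact ⟨1, one_mem _, by rw [word_one]; simp; rfl⟩
    | insert j t hj ih =>
      obtain ⟨σ, hσ, h⟩ := ih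
      rcases zmod_two_cases (w j) with h0 | h0
      · refine ⟨σ, hσ, ?_⟩
        rw [h]; funext i
        by_cases hij : i = j
        · subst hij; simp [hj, h0]
        · simp [hij]
      · refine ⟨zU hB j * σ, mul_mem (zU_mem_G hB j) hσ, ?_⟩
        rw [word_mul hB (zU_mem_G hB j) hσ, word_zU, h]; funext i
        by_cases hij : i = j
        · subst hij; simp [hj, h0]
        · simp [hij]
  obtain ⟨σ, hσ, h⟩ := h Finset.univ
  exact ⟨σ, hσ, by rw [h]; simp⟩

/-- Two elements of `G(B)` commute up to the sign given by the form `beta` on their words. -/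
theorem mul_comm_signed (hB : IsOrthonormalBasis B) {σ τ : (Cl r s)ˣ} (hσ : σ ∈ G B)
    (hτ : τ ∈ G B) : σ * τ = signed (beta (word hB σ) (word hB τ)) (τ * σ) := by
  have h1 : ∀ i, ∀ τ ∈ G B, zU hB i * τ = signed (beta (word hB (zU hB i)) (word hB τ))
      (τ * zU hB i) := by
    intro i
    refine G_induction hB (by simp) ?_ ?_
    · intro τ hτ h
      rw [mul_neg, h, word_neg hB hτ, neg_mul, signed_neg]
    · intro j τ hτ h
      rw [← mul_assoc, zU_mul_zU, signed_mul, mul_assoc, h, mul_signed, ← signed_add, ← mul_assoc,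
        word_mul hB (zU_mem_G hB j) hτ, beta_add_right, word_zU, word_zU]
  suffices h : ∀ σ ∈ G B, ∀ τ ∈ G B, σ * τ = signed (beta (word hB σ) (word hB τ)) (τ * σ) from
    h σ hσ τ hτ
  refine G_induction hB (by simp) ?_ ?_
  · intro σ hσ h τ hτ
    rw [neg_mul, h τ hτ, word_neg hB hσ, mul_neg, signed_neg]
  · intro j σ hσ h τ hτ
    rw [mul_assoc, h τ hτ, mul_signed, ← mul_assoc, h1 j τ hτ, signed_mul, ← signed_add, mul_assoc,
      word_mul hB (zU_mem_G hB j) hσ, beta_add_left, add_comm]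

theorem mul_self_eq_signed (hB : IsOrthonormalBasis B) :
    ∀ σ ∈ G B, σ * σ = signed (ctwo (word hB σ) + posPar (word hB σ)) 1 := by
  refine G_induction hB (by simp) ?_ ?_
  · intro σ hσ h
    rw [neg_mul_neg, h, word_neg hB hσ]
  · intro j σ hσ h
    have h1 : zU hB j * σ * (zU hB j * σ) =
        signed (beta (word hB σ) (word hB (zU hB j))) (zU hB j * zU hB j * (σ * σ)) := by
      rw [mul_assoc, ← mul_assoc σ, mul_comm_signed hB hσ (zU_mem_G hB j), signed_mul, mul_signed]
      simp only [mul_assoc]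
    rw [h1, h, zU_mul_self, signed_mul, one_mul, ← signed_add, ← signed_add,
      word_mul hB (zU_mem_G hB j) hσ, ctwo_add, posPar_add, word_zU, ctwo_single, beta_comm]
    congr 1; ring

/-- The monomial in the basis vectors listed in `l` that has the word `w`. -/
noncomputable def monomial (hB : IsOrthonormalBasis B) (l : List (Fin r ⊕ Fin s))
    (w : Fin r ⊕ Fin s → ZMod 2) : (Cl r s)ˣ :=
  (l.map fun i => if w i = 0 then 1 else zU hB i).prod

theorem monomial_cons (hB : IsOrthonormalBasis B) (i : Fin r ⊕ Fin s)
    (l : List (Fin r ⊕ Fin s)) (w : Fin r ⊕ Fin s → ZMod 2) :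
    monomial hB (i :: l) w = (if w i = 0 then 1 else zU hB i) * monomial hB l w := by
  simp [monomial]

theorem ite_zU_mem_G (hB : IsOrthonormalBasis B) (a : ZMod 2) (i : Fin r ⊕ Fin s) :
    (if a = 0 then 1 else zU hB i) ∈ G B := by
  split_ifs
  exacts [one_mem _, zU_mem_G hB i]

theorem monomial_mem_G (hB : IsOrthonormalBasis B) (l : List (Fin r ⊕ Fin s))
    (w : Fin r ⊕ Fin s → ZMod 2) : monomial hB l w ∈ G B := by
  refine Subgroup.list_prod_mem _ fun x hx => ?_
  obtain ⟨i, -, rfl⟩ := List.mem_map.mp hx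
  exact ite_zU_mem_G hB _ i

theorem monomial_mul (hB : IsOrthonormalBasis B) (l : List (Fin r ⊕ Fin s))
    (w w' : Fin r ⊕ Fin s → ZMod 2) :
    ∃ a, monomial hB l w * monomial hB l w' = signed a (monomial hB l (w + w')) := by
  induction l with
  | nil => exact ⟨0, by simp [monomial]⟩
  | cons i l ih =>
    obtain ⟨a, ha⟩ := ih
    have h1 : ∀ x y : ZMod 2, ∃ c, (if x = 0 then 1 else zU hB i) * (if y = 0 then 1 else zU hB i) =
        signed c (if x + y = 0 then 1 else zU hB i) := by
      intro x y
      rcases zmod_two_cases x with rfl | rfl <;> rcases zmod_two_cases y with rfl | rfl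
      · exact ⟨0, by simp⟩
      · exact ⟨0, by simp⟩
      · exact ⟨0, by simp⟩
      · exact ⟨_, by simpa [show (1 : ZMod 2) + 1 = 0 from rfl] using zU_mul_self hB i⟩
    obtain ⟨c, hc⟩ := h1 (w i) (w' i)
    obtain ⟨d, hd⟩ : ∃ d, monomial hB l w * (if w' i = 0 then 1 else zU hB i) =
        signed d ((if w' i = 0 then 1 else zU hB i) * monomial hB l w) :=
      ⟨_, mul_comm_signed hB (monomial_mem_G hB l w) (ite_zU_mem_G hB (w' i) i)⟩
    refine ⟨d + (a + c), ?_⟩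
    rw [monomial_cons hB i l w, monomial_cons hB i l w', mul_assoc, ← mul_assoc (monomial hB l w),
      hd, signed_mul, mul_signed, mul_assoc, ha, mul_signed, mul_signed, ← mul_assoc, hc,
      signed_mul, signed_add, signed_add, monomial_cons]
    rfl

theorem monomial_single (hB : IsOrthonormalBasis B) (i : Fin r ⊕ Fin s)
    (l : List (Fin r ⊕ Fin s)) (hl : l.Nodup) :
    (i ∈ l → monomial hB l (Pi.single i 1) = zU hB i) ∧
      (i ∉ l → monomial hB l (Pi.single i 1) = 1) := by
  induction l with
  | nil => simp [monomial]
  | cons j l ih =>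
    rw [List.nodup_cons] at hl
    rw [monomial_cons]
    by_cases hij : i = j
    · subst hij; simp [(ih hl.2).2 hl.1]
    · simpa [hij, Ne.symm hij] using ih hl.2

theorem exists_eq_signed_monomial (hB : IsOrthonormalBasis B) :
    ∀ σ ∈ G B, ∃ a, σ = signed a (monomial hB Finset.univ.toList (word hB σ)) := by
  refine G_induction hB ⟨0, by simp [monomial]⟩ ?_ ?_
  · rintro σ hσ ⟨a, h⟩
    refine ⟨a + 1, ?_⟩
    rw [word_neg hB hσ, signed_add, signed_one, signed_neg, ← h]
  · rintro i σ hσ ⟨a, h⟩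
    obtain ⟨c, hc⟩ := monomial_mul hB Finset.univ.toList (Pi.single i 1) (word hB σ)
    rw [(monomial_single hB i _ (Finset.nodup_toList _)).1 (by simp)] at hc
    refine ⟨a + c, ?_⟩
    rw [word_mul hB (zU_mem_G hB i) hσ, word_zU, signed_add, ← hc, ← mul_signed, ← h]

/-- An element of `G(B)` is determined by its word up to sign. -/
theorem eq_signed_one_of_word_eq_zero (hB : IsOrthonormalBasis B) {σ : (Cl r s)ˣ} (hσ : σ ∈ G B)
    (h : word hB σ = 0) : ∃ a, σ = signed a 1 := by
  obtain ⟨a, ha⟩ := exists_eq_signed_monomial hB σ hσ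
  exact ⟨a, by rw [ha, h]; simp [monomial]⟩

theorem eq_signed_of_word_eq (hB : IsOrthonormalBasis B) {σ τ : (Cl r s)ˣ} (hσ : σ ∈ G B)
    (hτ : τ ∈ G B) (h : word hB σ = word hB τ) : ∃ a, σ = signed a τ := by
  have h1 : word hB (σ * τ⁻¹) = 0 := by
    rw [word_mul hB hσ (inv_mem hτ), word_inv hB hτ, h]
    funext i; exact CharTwo.add_self_eq_zero _
  obtain ⟨a, ha⟩ := eq_signed_one_of_word_eq_zero hB (mul_mem hσ (inv_mem hτ)) h1
  exact ⟨a, by rw [← inv_mul_cancel_right σ τ, ha, signed_mul, one_mul]⟩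

end GroupG

/-! ### The action of `G(B)` on an admissible module -/

section Action

variable {r s : ℕ} {B : Module.Basis (Fin r ⊕ Fin s) ℝ (RS r s)}
  {V : Type*} [AddCommGroup V] [Module ℝ V]
  {J : Cl r s →ₐ[ℝ] Module.End ℝ V} {b : LinearMap.BilinForm ℝ V}

theorem act_mul (σ τ : (Cl r s)ˣ) (x : V) :
    J ((σ * τ : (Cl r s)ˣ) : Cl r s) x = J (σ : Cl r s) (J (τ : Cl r s) x) := by simp

theorem act_signed (a : ZMod 2) (σ : (Cl r s)ˣ) (x : V) :
    J ((signed a σ : (Cl r s)ˣ) : Cl r s) x = signed a (J (σ : Cl r s) x) := by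
  rcases zmod_two_cases a with rfl | rfl <;> simp

theorem act_inv_act (σ : (Cl r s)ˣ) (x : V) :
    J ((σ⁻¹ : (Cl r s)ˣ) : Cl r s) (J (σ : Cl r s) x) = x := by
  rw [← act_mul]; simp

theorem act_act_inv (σ : (Cl r s)ˣ) (x : V) :
    J (σ : Cl r s) (J ((σ⁻¹ : (Cl r s)ˣ) : Cl r s) x) = x := by
  rw [← act_mul]; simp

theorem form_signed_left (a : ZMod 2) (x y : V) : b (signed a x) y = signed a (b x y) := by
  rcases zmod_two_cases a with rfl | rfl <;> simp

theorem form_signed_right (a : ZMod 2) (x y : V) : b x (signed a y) = signed a (b x y) :=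
  map_signed (b x) a y

theorem form_act_zU (hB : IsOrthonormalBasis B) (h : IsAdmissible J b) (i : Fin r ⊕ Fin s)
    (x y : V) : b (J (gen (B i)) x) (J (gen (B i)) y) =
      signed (negPar (Pi.single i 1)) (b x y) := by
  have h1 := h.skew (B i) x (J (gen (B i)) y)
  rw [← Module.End.mul_apply, ← map_mul, gen_mul_self hB, AlgHom.commutes] at h1
  simp only [Module.algebraMap_end_apply, map_smul, smul_eq_mul] at h1
  cases i with
  | inl i => simp [sgn, negPar] at h1 ⊢; linarith
  | inr j => simp [sgn, negPar, Pi.single_apply] at h1 ⊢; linarith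

theorem form_act (hB : IsOrthonormalBasis B) (h : IsAdmissible J b) :
    ∀ σ ∈ G B, ∀ x y, b (J (σ : Cl r s) x) (J (σ : Cl r s) y) =
      signed (negPar (word hB σ)) (b x y) := by
  refine G_induction hB (by simp) ?_ ?_
  · intro σ hσ ih x y
    rw [word_neg hB hσ, ← ih]; simp
  · intro i σ hσ ih x y
    rw [act_mul, act_mul, zU_val, form_act_zU hB h, ih, word_mul hB (zU_mem_G hB i) hσ, word_zU,
      negPar_add, signed_add]

theorem act_linear_ext {W : Type*} [AddCommGroup W] [Module ℝ W]
    {f g : RS r s →ₗ[ℝ] W} (h : ∀ i, f (B i) = g (B i)) (z : RS r s) : f z = g z := by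
  rw [B.ext h]

/-- A linear automorphism of `V` that preserves all the forms `b (J_z u) v` belongs to `𝔸`. -/
theorem mem_groupA (h : IsAdmissible J b) (A : V ≃ₗ[ℝ] V)
    (hA : ∀ i u v, b (J (gen (B i)) (A u)) (A v) = b (J (gen (B i)) u) v) : A ∈ groupA h := by
  have h1 : ∀ z u v, b (J (gen z) (A u)) (A v) = b (J (gen z) u) v := by
    intro z u v
    let F (u v : V) : RS r s →ₗ[ℝ] ℝ :=
      (b.flip v).comp (((LinearMap.applyₗ u).comp J.toLinearMap).comp gen)
    exact act_linear_ext (f := F (A u) (A v)) (g := F u v) (fun i => hA i u v) z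
  have h2 : ∀ u v, bracketV J b (A u) (A v) = bracketV J b u v := by
    intro u v; funext i; simp only [bracketV, h1]
  let ψ : LieN h ≃ₗ[ℝ] LieN h := LinearEquiv.prodCongr A (LinearEquiv.refl ℝ (RS r s))
  refine ⟨{ ψ with map_lie' := ?_ }, fun v z => rfl⟩
  intro x y
  exact Prod.ext (map_zero A) (h2 _ _).symm

/-- A self-adjoint involution of a minimal admissible module that commutes with the Clifford
action is `1` or `-1`: its fixed space is an admissible submodule. -/
theorem selfAdjoint_involution_eq [FiniteDimensional ℝ V] (hV : IsMinimalAdmissible J b)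
    (P : V →ₗ[ℝ] V) (hP : ∀ x, P (P x) = x) (hadj : ∀ x y, b (P x) y = b x (P y))
    (hJ : ∀ z x, P (J (gen z) x) = J (gen z) (P x)) : (∀ x, P x = x) ∨ (∀ x, P x = -x) := by
  let U : Submodule ℝ V := LinearMap.ker (P - LinearMap.id)
  have hU : ∀ x, x ∈ U ↔ P x = x := fun x => by simp [U, sub_eq_zero]
  have hfix : ∀ x, x + P x ∈ U := fun x => by rw [hU, map_add, hP, add_comm]
  rcases Nat.eq_zero_or_pos (Module.finrank ℝ U) with h0 | h0
  · right
    intro x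
    have h1 := hfix x
    rw [Submodule.finrank_eq_zero.mp h0, Submodule.mem_bot] at h1
    exact eq_neg_of_add_eq_zero_right h1
  · left
    let φ : U ≃ₗ[ℝ] (Fin (Module.finrank ℝ U) → ℝ) := (Module.finBasis ℝ U).equivFun
    have hinv : ∀ z, ∀ x ∈ U, J (gen z) x ∈ U := fun z x hx => by
      rw [hU] at hx ⊢; rw [hJ, hx]
    let f : RS r s →ₗ[ℝ] Module.End ℝ (Fin (Module.finrank ℝ U) → ℝ) :=
      { toFun := fun z => φ.toLinearMap ∘ₗ ((J (gen z)).restrict (hinv z)) ∘ₗ φ.symm.toLinearMap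
        map_add' := fun z z' => by
          apply LinearMap.ext; intro u
          rw [LinearMap.add_apply]
          simp only [LinearMap.comp_apply, LinearEquiv.coe_coe, ← map_add φ]
          congr 1; apply Subtype.ext
          simp
        map_smul' := fun c z => by
          apply LinearMap.ext; intro u
          rw [LinearMap.smul_apply]
          simp only [LinearMap.comp_apply, LinearEquiv.coe_coe, RingHom.id_apply, ← map_smul φ]
          congr 1; apply Subtype.ext
          simp }
    have hf : ∀ z u, f z u = φ ⟨J (gen z) (φ.symm u), hinv z _ (φ.symm u).2⟩ := fun z u => rfl
    have hff : ∀ z, f z * f z = algebraMap ℝ _ (negQ r s z) := by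
      intro z
      apply LinearMap.ext
      intro u
      rw [Module.End.mul_apply, hf, hf, Module.algebraMap_end_apply]
      apply φ.symm.injective
      apply Subtype.ext
      simp only [LinearEquiv.symm_apply_apply, map_smul, Submodule.coe_smul]
      rw [← Module.End.mul_apply, ← map_mul, ι_sq_scalar, AlgHom.commutes,
        Module.algebraMap_end_apply]
    let J' := CliffordAlgebra.lift (negQ r s) ⟨f, hff⟩
    have hJ' : ∀ z, J' (gen z) = f z := fun z => CliffordAlgebra.lift_ι_apply _ _ _
    let ρ : (Fin (Module.finrank ℝ U) → ℝ) →ₗ[ℝ] V := U.subtype ∘ₗ φ.symm.toLinearMap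
    have hρ : ∀ u, ρ u = (φ.symm u : V) := fun u => rfl
    have hnd : (b.compl₁₂ ρ ρ).Nondegenerate := by
      have hb : ∀ x ∈ U, (∀ y ∈ U, b x y = 0) → x = 0 := by
        intro x hx h
        refine hV.admissible.nondegenerate.1 x fun y => ?_
        have h1 := h _ (hfix y)
        rw [map_add, ← hadj, (hU x).mp hx] at h1
        linarith
      have hl : (b.compl₁₂ ρ ρ).SeparatingLeft := by
        intro u hu
        have h1 := hb (ρ u) (φ.symm u).2 fun y hy => by
          have := hu (φ ⟨y, hy⟩)
          simpa [hρ] using this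
        apply φ.symm.injective
        apply Subtype.ext
        rw [map_zero]; exact h1
      refine ⟨hl, fun u hu => hl u fun y => ?_⟩
      have := hu y
      simp only [LinearMap.compl₁₂_apply] at this ⊢
      rw [hV.admissible.symm, this]
    have hadm : IsAdmissible J' (b.compl₁₂ ρ ρ) := by
      refine ⟨hnd, fun u v => hV.admissible.symm _ _, fun z u v => ?_⟩
      have h1 : ∀ u, ρ (J' (gen z) u) = J (gen z) (ρ u) := fun u => by
        rw [hJ', hf, hρ, LinearEquiv.symm_apply_apply]; rfl
      simp only [LinearMap.compl₁₂_apply, h1]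
      exact hV.admissible.skew z _ _
    have hle := hV.minimal _ h0 ⟨J', _, hadm⟩
    have htop : U = ⊤ := Submodule.eq_top_of_finrank_eq (le_antisymm (Submodule.finrank_le U) hle)
    intro x
    rw [← hU, htop]; trivial

end Action

/-! ### Orbits of `G(B)` and twisted intertwiners -/

section Orbit

variable {r s : ℕ} {B : Module.Basis (Fin r ⊕ Fin s) ℝ (RS r s)}
  {V : Type*} [AddCommGroup V] [Module ℝ V]
  {J : Cl r s →ₐ[ℝ] Module.End ℝ V} {b : LinearMap.BilinForm ℝ V}

/-- The invariant basis `e` lies in the orbit of the unit vector `v` under `G(B)`. -/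
structure IsOrbitBasis (B : Module.Basis (Fin r ⊕ Fin s) ℝ (RS r s))
    (J : Cl r s →ₐ[ℝ] Module.End ℝ V) (b : LinearMap.BilinForm ℝ V)
    {κ : Type*} (e : Module.Basis κ ℝ V) (v : V) : Prop extends IsInvariantBasis B J b e where
  unit_vector : b v v = 1 ∨ b v v = -1
  exists_eq : ∀ i, ∃ σ ∈ G B, e i = J (σ : Cl r s) v

variable {κ : Type*} {e : Module.Basis κ ℝ V} {v : V}

theorem IsInvariantBasis.act_eq (he : IsInvariantBasis B J b e) (hB : IsOrthonormalBasis B) :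
    ∀ σ ∈ G B, ∀ i, ∃ j a, J (σ : Cl r s) (e i) = signed a (e j) := by
  refine G_induction hB (fun i => ⟨i, 0, by simp⟩) ?_ ?_
  · intro σ _ ih i
    obtain ⟨j, a, h⟩ := ih i
    exact ⟨j, a + 1, by simp [h, signed_add, signed_neg]⟩
  · intro k σ _ ih i
    obtain ⟨j, a, h⟩ := ih i
    obtain ⟨l, hl⟩ := he.invariant k j
    obtain ⟨c, hc⟩ := eq_or_neg_iff_signed.mp hl
    exact ⟨l, a + c, by rw [act_mul, h, map_signed, zU_val, hc, signed_add]⟩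

namespace IsOrbitBasis

theorem form_self_ne_zero (he : IsOrbitBasis B J b e v) : b v v ≠ 0 := by
  rcases he.unit_vector with h | h <;> simp [h]

theorem vector_ne_zero (he : IsOrbitBasis B J b e v) : v ≠ 0 := fun h =>
  he.form_self_ne_zero (by simp [h])

theorem act_vector_eq (he : IsOrbitBasis B J b e v) (hB : IsOrthonormalBasis B) :
    ∀ σ ∈ G B, ∃ j a, J (σ : Cl r s) v = signed a (e j) := by
  intro σ hσ
  have : Nonempty κ := by
    by_contra hn
    rw [not_nonempty_iff] at hn
    exact he.vector_ne_zero (e.ext_elem fun i => (hn.false i).elim)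
  obtain ⟨i⟩ := this
  obtain ⟨τ, hτ, h⟩ := he.exists_eq i
  obtain ⟨j, a, hj⟩ := he.act_eq hB (σ * τ⁻¹) (mul_mem hσ (inv_mem hτ)) i
  exact ⟨j, a, by rw [← hj, h, ← act_mul, inv_mul_cancel_right]⟩

theorem index_eq_of_eq_signed (e : Module.Basis κ ℝ V) {i j : κ} (a : ZMod 2)
    (h : e i = signed a (e j)) : i = j ∧ a = 0 := by
  have h1 := congrArg (fun x => e.repr x i) h
  have h2 : (1 : ℝ) = signed a (e.repr (e j) i) := by
    rw [map_signed e.repr] at h1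
    rcases zmod_two_cases a with rfl | rfl <;> simpa using h1
  by_cases hij : j = i
  · subst hij
    refine ⟨rfl, ?_⟩
    rcases zmod_two_cases a with rfl | rfl
    · rfl
    · norm_num at h2
  · rw [e.repr_self, Finsupp.single_eq_of_ne' hij] at h2
    rcases zmod_two_cases a with rfl | rfl <;> simp at h2

/-- Two vectors of the orbit agree up to sign or are orthogonal. -/
theorem eq_signed_or_form_eq_zero (he : IsOrbitBasis B J b e v) (hB : IsOrthonormalBasis B)
    {σ : (Cl r s)ˣ} (hσ : σ ∈ G B) :
    (∃ a, J (σ : Cl r s) v = signed a v) ∨ b v (J (σ : Cl r s) v) = 0 := by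
  obtain ⟨i, a, hi⟩ := he.act_vector_eq hB 1 (one_mem _)
  obtain ⟨j, c, hj⟩ := he.act_vector_eq hB σ hσ
  rw [Units.val_one, map_one, Module.End.one_apply] at hi
  by_cases hij : i = j
  · left
    subst hij
    have h1 : e i = signed a v := by
      conv_rhs => rw [hi]
      rw [signed_signed]
    exact ⟨c + a, by rw [hj, h1, signed_add]⟩
  · right
    rw [hj]; nth_rewrite 1 [hi]
    rw [form_signed_left, form_signed_right, he.orthogonal i j hij]
    simp [signed]

/-- A linear map is determined by its values on the orbit. -/
theorem ext_act (he : IsOrbitBasis B J b e v) {W : Type*} [AddCommGroup W] [Module ℝ W]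
    {f g : V →ₗ[ℝ] W} (h : ∀ σ ∈ G B, f (J (σ : Cl r s) v) = g (J (σ : Cl r s) v)) : f = g :=
  e.ext fun i => by
    obtain ⟨σ, hσ, hi⟩ := he.exists_eq i
    rw [hi, h σ hσ]

/-- A signed re-ordering under which the isotropy group of `v` fixes `v₂` is implemented by a
linear map taking the orbit of `v` to that of `v₂`. -/
theorem exists_orbit_map (he : IsOrbitBasis B J b e v) (hB : IsOrthonormalBasis B)
    {C : (negQ r s).IsometryEquiv (negQ r s)} {v₂ : V}
    (h₂ : ∀ σ ∈ isotropy B J v, J (extend C σ : Cl r s) v₂ = v₂) :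
    ∃ A : V →ₗ[ℝ] V, ∀ σ ∈ G B, A (J (σ : Cl r s) v) = J (extend C σ : Cl r s) v₂ := by
  choose τ hτ hτe using he.exists_eq
  refine ⟨e.constr ℝ fun i => J (extend C (τ i) : Cl r s) v₂, fun σ hσ => ?_⟩
  obtain ⟨i, a, hi⟩ := he.act_vector_eq hB σ hσ
  rw [hi, map_signed, Module.Basis.constr_basis]
  have hmem : signed a ((τ i)⁻¹ * σ) ∈ isotropy B J v := by
    refine ⟨signed_mem_G (mul_mem (inv_mem (hτ i)) hσ) a, ?_⟩
    rw [act_signed, act_mul, hi, hτe i, map_signed, signed_signed, act_inv_act]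
  have h3 := h₂ _ hmem
  rw [extend_signed, act_signed, map_mul, act_mul, map_inv] at h3
  rw [← map_signed (J (extend C (τ i) : Cl r s))]
  have h4 : signed a v₂ = J ((extend C (τ i))⁻¹ : (Cl r s)ˣ) (J (extend C σ : Cl r s) v₂) := by
    nth_rewrite 1 [← h3]; rw [signed_signed]
  rw [h4, act_act_inv]

theorem orbit_map_act (he : IsOrbitBasis B J b e v)
    {C : (negQ r s).IsometryEquiv (negQ r s)} {v₂ : V} {A : V →ₗ[ℝ] V}
    (hA : ∀ σ ∈ G B, A (J (σ : Cl r s) v) = J (extend C σ : Cl r s) v₂) {τ : (Cl r s)ˣ}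
    (hτ : τ ∈ G B) (x : V) : A (J (τ : Cl r s) x) = J (extend C τ : Cl r s) (A x) := by
  have : A ∘ₗ J (τ : Cl r s) = J (extend C τ : Cl r s) ∘ₗ A := by
    refine he.ext_act fun σ hσ => ?_
    rw [LinearMap.comp_apply, LinearMap.comp_apply, ← act_mul, hA _ (mul_mem hτ hσ), hA _ hσ,
      map_mul, act_mul]
  exact LinearMap.congr_fun this x

/-- If `g ∈ G(B)` commutes with the isotropy group of `v`, up to the sign `(-1)^(ε |σ|)`, then
`σ v ↦ (-1)^(ε |σ|) σ g v` is a well-defined linear map; it commutes or anticommutes with the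
Clifford action, according to `ε`, and is self-adjoint when the signs allow it. -/
theorem exists_twist (he : IsOrbitBasis B J b e v) (hB : IsOrthonormalBasis B)
    (h : IsAdmissible J b) {g : (Cl r s)ˣ} (hg : g ∈ G B) (ε : ZMod 2)
    (hcomm : ∀ σ ∈ isotropy B J v, beta (word hB σ) (word hB g) = ε * ∑ i, word hB σ i)
    (hadj : negPar (word hB g) = ε * (∑ i, word hB g i) + ctwo (word hB g) +
      posPar (word hB g)) :
    ∃ R : V →ₗ[ℝ] V, R v = J (g : Cl r s) v ∧ (∀ x y, b (R x) y = b x (R y)) ∧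
      (∀ i x, R (J (gen (B i)) x) = signed ε (J (gen (B i)) (R x))) ∧
      ∀ x, R (R x) = signed (negPar (word hB g)) x := by
  have hext : ∀ σ ∈ G B, extend (flip hB fun _ => ε) σ = signed (ε * ∑ i, word hB σ i) σ := by
    intro σ hσ
    rw [extend_flip hB _ σ hσ, Finset.mul_sum]
  obtain ⟨R, hR⟩ := he.exists_orbit_map hB (C := flip hB fun _ => ε) (v₂ := J (g : Cl r s) v) <| by
    intro σ hσ
    rw [hext σ hσ.1, act_signed, ← act_mul, mul_comm_signed hB hσ.1 hg, act_signed, hcomm σ hσ,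
      signed_signed, act_mul, hσ.2]
  have hR1 : R v = J (g : Cl r s) v := by simpa using hR 1 (one_mem _)
  have hRJ : ∀ i x, R (J (gen (B i)) x) = signed ε (J (gen (B i)) (R x)) := by
    intro i x
    have := he.orbit_map_act hR (zU_mem_G hB i) x
    rwa [hext _ (zU_mem_G hB i), act_signed, word_zU, Finset.sum_pi_single', if_pos (by simp),
      mul_one] at this
  have hR' : ∀ σ ∈ G B, R (J (σ : Cl r s) v) =
      signed (ε * ∑ i, word hB σ i) (J ((σ * g : (Cl r s)ˣ) : Cl r s) v) := by
    intro σ hσ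
    rw [hR σ hσ, hext σ hσ, act_signed, act_mul]
  have hsum : ∀ σ ∈ G B, ∀ τ ∈ G B, ∑ i, word hB (σ * τ) i =
      (∑ i, word hB σ i) + ∑ i, word hB τ i := by
    intro σ hσ τ hτ
    simp [word_mul hB hσ hτ, Finset.sum_add_distrib]
  have hgg := mul_self_eq_signed hB g hg
  refine ⟨R, hR1, ?_, hRJ, ?_⟩
  · have h1 : ∀ σ ∈ G B, ∀ y, b (R (J (σ : Cl r s) v)) y = b (J (σ : Cl r s) v) (R y) := by
      refine G_induction hB ?_ ?_ ?_
      · -- the vector `v` itself, tested against the vectors of the orbit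
        suffices hh : b (R v) = (b v) ∘ₗ R from fun y => by
          simpa using LinearMap.congr_fun hh y
        refine he.ext_act fun τ hτ => ?_
        rw [LinearMap.comp_apply, hR1, hR' τ hτ, form_signed_right]
        rcases he.eq_signed_or_form_eq_zero hB (mul_mem hτ hg) with ⟨a, ha⟩ | h0
        · have hs : signed a (τ * g) ∈ isotropy B J v :=
            ⟨signed_mem_G (mul_mem hτ hg) a, by rw [act_signed, ha, signed_signed]⟩
          have hc := hcomm _ hs
          rw [word_signed hB (mul_mem hτ hg), hsum τ hτ g hg] at hc
          have h2 : J (τ : Cl r s) v = signed (a + beta (word hB (τ * g)) (word hB g) +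
              (ctwo (word hB g) + posPar (word hB g))) (J (g : Cl r s) v) := by
            have h3 : τ = signed (ctwo (word hB g) + posPar (word hB g)) (τ * g * g) := by
              rw [mul_assoc, hgg, mul_signed, mul_one, signed_signed]
            nth_rewrite 1 [h3]
            rw [mul_comm_signed hB (mul_mem hτ hg) hg, act_signed, act_signed, act_mul, ha,
              map_signed, ← signed_add, ← signed_add]
            congr 1; ring
          rw [h2, form_signed_right, form_act hB h g hg, ha, form_signed_right, ← signed_add,
            ← signed_add, hc, hadj]
          congr 1
          generalize ctwo (word hB g) = x1
          generalize posPar (word hB g) = x2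
          generalize (∑ i, word hB g i) = x3
          generalize (∑ i, word hB τ i) = x4
          clear * -
          revert a ε x1 x2 x3 x4
          decide
        · rw [h0]
          have h4 : J (τ : Cl r s) v = J (g : Cl r s) (J ((g⁻¹ * τ : (Cl r s)ˣ) : Cl r s) v) := by
            rw [← act_mul, mul_inv_cancel_left]
          rw [h4, form_act hB h g hg]
          rcases he.eq_signed_or_form_eq_zero hB (mul_mem (inv_mem hg) hτ) with ⟨c, hc⟩ | h5
          · exfalso
            rw [hc, map_signed] at h4
            have h6 : J ((τ * g : (Cl r s)ˣ) : Cl r s) v =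
                signed (beta (word hB τ) (word hB g) + c +
                  (ctwo (word hB g) + posPar (word hB g))) v := by
              rw [mul_comm_signed hB hτ hg, act_signed, act_mul, h4, map_signed, ← act_mul, hgg,
                act_signed, ← signed_add, ← signed_add]
              simp
            rw [h6, form_signed_right] at h0
            refine he.form_self_ne_zero ?_
            rcases signed_eq_or (beta (word hB τ) (word hB g) + c +
                  (ctwo (word hB g) + posPar (word hB g))) (b v v) with h7 | h7 <;>
              rw [h7] at h0
            · exact h0
            · exact neg_eq_zero.mp h0
          · rw [h5]; simp [signed]
      · intro σ _ ih y
        simpa using ih y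
      · intro i σ _ ih y
        have h8 : ∀ x y, b (J (gen (B i)) x) y = -b x (J (gen (B i)) y) := fun x y => by
          have := h.skew (B i) x y
          linarith
        rw [act_mul, zU_val, hRJ, form_signed_left, h8, ih, hRJ, form_signed_right, h8,
          signed_neg, signed_signed]
    intro x y
    have : b.flip y ∘ₗ R = (b.flip (R y)) := he.ext_act fun σ hσ => by
      simpa using h1 σ hσ y
    simpa using LinearMap.congr_fun this x
  · intro x
    have : R ∘ₗ R = signed (negPar (word hB g)) LinearMap.id := by
      refine he.ext_act fun σ hσ => ?_
      rw [LinearMap.comp_apply, hR' σ hσ, map_signed, hR' _ (mul_mem hσ hg), mul_assoc, hgg,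
        mul_signed, mul_one, act_signed, ← signed_add, ← signed_add, hsum σ hσ g hg, hadj]
      have h9 : ∀ (a : ZMod 2) (f : V →ₗ[ℝ] V) x, (signed a f) x = signed a (f x) := by
        intro a f x
        rcases zmod_two_cases a with rfl | rfl <;> simp
      rw [h9, LinearMap.id_apply]
      congr 1
      generalize ctwo (word hB g) = x1
      generalize posPar (word hB g) = x2
      generalize (∑ i, word hB g i) = x3
      generalize (∑ i, word hB σ i) = x4
      clear * -
      revert ε x1 x2 x3 x4
      decide
    have h9 := LinearMap.congr_fun this x
    rcases zmod_two_cases (negPar (word hB g)) with h0 | h0 <;> rw [h0] at h9 ⊢ <;> simpa using h9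

end IsOrbitBasis

end Orbit

/-! ### The binary code of a group of positive involutions -/

section Code

variable {r s : ℕ} {B : Module.Basis (Fin r ⊕ Fin s) ℝ (RS r s)}

/-- The words of the elements of `S` in `G(B)`, a binary code. -/
noncomputable def codeOf (hB : IsOrthonormalBasis B) (S : Subgroup (Cl r s)ˣ) :
    AddSubgroup (Fin r ⊕ Fin s → ZMod 2) where
  carrier := {w | ∃ σ ∈ S, σ ∈ G B ∧ word hB σ = w}
  zero_mem' := ⟨1, one_mem _, one_mem _, word_one hB⟩
  add_mem' := by
    rintro _ _ ⟨σ, hσ, hσ', rfl⟩ ⟨τ, hτ, hτ', rfl⟩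
    exact ⟨σ * τ, mul_mem hσ hτ, mul_mem hσ' hτ', word_mul hB hσ' hτ'⟩
  neg_mem' := by
    rintro _ ⟨σ, hσ, hσ', rfl⟩
    refine ⟨σ, hσ, hσ', ?_⟩
    funext i; exact (ZMod.neg_eq_self_mod_two _).symm

theorem mem_hat_iff {S : Subgroup (Cl r s)ˣ} {u : (Cl r s)ˣ} :
    u ∈ hat S ↔ ∃ a, signed a u ∈ S := by
  constructor
  · rintro (h | h)
    · exact ⟨0, by simpa⟩
    · exact ⟨1, by simpa⟩
  · rintro ⟨a, h⟩
    rcases zmod_two_cases a with rfl | rfl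
    · exact Or.inl (by simpa using h)
    · exact Or.inr (by simpa using h)

theorem word_mem_codeOf_iff (hB : IsOrthonormalBasis B) {S : Subgroup (Cl r s)ˣ} {σ : (Cl r s)ˣ}
    (hσ : σ ∈ G B) : word hB σ ∈ codeOf hB S ↔ σ ∈ hat S := by
  rw [mem_hat_iff]
  constructor
  · rintro ⟨τ, hτ, hτ', h⟩
    obtain ⟨a, rfl⟩ := eq_signed_of_word_eq hB hτ' hσ h
    exact ⟨a, hτ⟩
  · rintro ⟨a, h⟩
    exact ⟨_, h, signed_mem_G hσ a, word_signed hB hσ a⟩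

theorem hat_subset_G {S : Subgroup (Cl r s)ˣ} (hS : S ≤ G B) {σ : (Cl r s)ˣ} (hσ : σ ∈ hat S) :
    σ ∈ G B := by
  obtain ⟨a, h⟩ := mem_hat_iff.mp hσ
  have := signed_mem_G (hS h) a
  rwa [signed_signed] at this

theorem codeOf_congr (hB : IsOrthonormalBasis B) {S T : Subgroup (Cl r s)ˣ} (h : hat S = hat T) :
    codeOf hB S = codeOf hB T := by
  ext w
  obtain ⟨σ, hσ, rfl⟩ := exists_word_eq hB w
  rw [word_mem_codeOf_iff hB hσ, word_mem_codeOf_iff hB hσ, h]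

/-- The elements of `Pin(r,0) × Spin(0,s)` contain an even number of negative vectors. -/
theorem negPar_eq_zero_of_mem_pinSpin (hB : IsOrthonormalBasis B) {σ : (Cl r s)ˣ} (hσ : σ ∈ G B)
    (h : σ ∈ pinSpin B) : negPar (word hB σ) = 0 := by
  let x : Fin r ⊕ Fin s → ZMod 2 := Sum.elim 0 1
  have hpos : ∀ y ∈ Submodule.span ℝ (Set.range fun i => B (Sum.inl i)), flip hB x y = y := by
    intro y hy
    induction hy using Submodule.span_induction with
    | mem y hy => obtain ⟨i, rfl⟩ := hy; exact (signedPerm_apply hB _ _ x _).trans (by simp [x])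
    | zero => exact map_zero _
    | add y z _ _ h1 h2 => rw [map_add, h1, h2]
    | smul c y _ h1 => rw [map_smul, h1]
  have hneg : ∀ y ∈ Submodule.span ℝ (Set.range fun j => B (Sum.inr j)), flip hB x y = -y := by
    intro y hy
    induction hy using Submodule.span_induction with
    | mem y hy => obtain ⟨i, rfl⟩ := hy; exact (signedPerm_apply hB _ _ x _).trans (by simp [x])
    | zero => simp
    | add y z _ _ h1 h2 => rw [map_add, h1, h2]; abel
    | smul c y _ h1 => rw [map_smul, h1, smul_neg]
  have hfix : ∀ u ∈ pinSpin B, extend (flip hB x) u = u := by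
    intro u hu
    refine Subgroup.closure_induction (p := fun u _ => extend (flip hB x) u = u)
      ?_ (by simp) (fun u v _ _ h1 h2 => by rw [map_mul, h1, h2])
      (fun u _ h1 => by rw [map_inv, h1]) hu
    rintro u (⟨y, hy, -, hu⟩ | ⟨y, hy, z, hz, -, -, hu⟩)
    · apply Units.ext
      rw [extend_val, hu, map_apply_ι]
      exact congrArg gen (hpos y hy)
    · apply Units.ext
      rw [extend_val, hu, map_mul, map_apply_ι, map_apply_ι]
      have h1 := hneg y hy
      have h2 := hneg z hz
      show gen (flip hB x y) * gen (flip hB x z) = _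
      rw [h1, h2, map_neg, map_neg, neg_mul_neg]
  have h1 := hfix σ h
  rw [extend_flip hB x σ hσ] at h1
  have h2 : signed (∑ i, x i * word hB σ i) σ = signed 0 σ := by rw [h1, signed_zero]
  rw [signed_left_inj (ne_neg_self σ)] at h2
  simpa [x, negPar, Fintype.sum_sum_type] using h2

theorem eq_of_signed_mem {S : Subgroup (Cl r s)ˣ} (hS : -1 ∉ S) {σ : (Cl r s)ˣ} {a c : ZMod 2}
    (ha : signed a σ ∈ S) (hc : signed c σ ∈ S) : a = c := by
  by_contra hac
  apply hS
  have h1 : c = a + 1 := by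
    clear ha hc
    revert a c; decide
  have h2 := mul_mem (inv_mem ha) hc
  rw [h1, signed_add, signed_one, signed_neg, mul_neg, inv_mul_cancel] at h2
  exact h2

theorem even_negPar_of_mem_codeOf (hB : IsOrthonormalBasis B) {S : Subgroup (Cl r s)ˣ}
    (hS : IsPositiveInvolutionGroup B S) {w : Fin r ⊕ Fin s → ZMod 2} (hw : w ∈ codeOf hB S) :
    negPar w = 0 := by
  obtain ⟨σ, hσ, hσ', rfl⟩ := hw
  exact negPar_eq_zero_of_mem_pinSpin hB hσ' (hS.mem_pinSpin σ hσ)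

theorem ctwo_of_mem_codeOf (hB : IsOrthonormalBasis B) {S : Subgroup (Cl r s)ˣ}
    (hS : IsPositiveInvolutionGroup B S) {w : Fin r ⊕ Fin s → ZMod 2} (hw : w ∈ codeOf hB S) :
    ctwo w = ∑ i, w i := by
  have h1 := even_negPar_of_mem_codeOf hB hS hw
  obtain ⟨σ, hσ, hσ', rfl⟩ := hw
  have h2 := hS.sq_eq_one σ hσ
  rw [mul_self_eq_signed hB σ hσ', ← signed_zero (1 : (Cl r s)ˣ), ← signed_add,
    signed_left_inj (ne_neg_self 1), add_zero] at h2
  rw [sum_eq_posPar_add_negPar, h1, add_zero]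
  exact CharTwo.add_eq_zero.mp h2

theorem card_codeOf (hB : IsOrthonormalBasis B) {S : Subgroup (Cl r s)ˣ}
    (hS : IsPositiveInvolutionGroup B S) : Nat.card (codeOf hB S) = Nat.card S := by
  symm
  refine Nat.card_congr (Equiv.ofBijective
    (fun σ : S => (⟨word hB σ, σ, σ.2, hS.le_G σ.2, rfl⟩ : codeOf hB S)) ⟨?_, ?_⟩)
  · rintro ⟨σ, hσ⟩ ⟨τ, hτ⟩ h
    obtain ⟨a, ha⟩ := eq_signed_of_word_eq hB (hS.le_G hσ) (hS.le_G hτ) (congrArg Subtype.val h)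
    apply Subtype.ext
    show σ = τ
    have h0 := eq_of_signed_mem hS.neg_one_notMem (σ := τ) (a := a) (c := 0) (ha ▸ hσ)
      (by simpa using hτ)
    rw [ha, h0, signed_zero]
  · rintro ⟨w, σ, hσ, hσ', rfl⟩
    exact ⟨⟨σ, hσ⟩, rfl⟩

end Code

section CodeModule

variable {r s : ℕ} {B : Module.Basis (Fin r ⊕ Fin s) ℝ (RS r s)}
  {V : Type*} [AddCommGroup V] [Module ℝ V]
  {J : Cl r s →ₐ[ℝ] Module.End ℝ V} {b : LinearMap.BilinForm ℝ V}
  {κ : Type*} {e : Module.Basis κ ℝ V} {v : V}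

theorem mem_hat_isotropy {σ : (Cl r s)ˣ} :
    σ ∈ hat (isotropy B J v) ↔ σ ∈ G B ∧ ∃ a, J (σ : Cl r s) v = signed a v := by
  rw [mem_hat_iff]
  constructor
  · rintro ⟨a, h1, h2⟩
    have h3 := signed_mem_G h1 a
    rw [signed_signed] at h3
    rw [act_signed] at h2
    refine ⟨h3, a, ?_⟩
    nth_rewrite 2 [← h2]
    rw [signed_signed]
  · rintro ⟨h1, a, h2⟩
    exact ⟨a, signed_mem_G h1 a, by rw [act_signed, h2, signed_signed]⟩

/-- Minimality of the module makes the code maximal: a word that could be added to the code while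
keeping its properties belongs to it. -/
theorem IsOrbitBasis.mem_codeOf_of_beta_eq_zero [FiniteDimensional ℝ V]
    (he : IsOrbitBasis B J b e v) (hB : IsOrthonormalBasis B) (hV : IsMinimalAdmissible J b)
    {w : Fin r ⊕ Fin s → ZMod 2} (h1 : ∀ u ∈ codeOf hB (isotropy B J v), beta u w = 0)
    (h2 : negPar w = 0) (h3 : ctwo w = ∑ i, w i) : w ∈ codeOf hB (isotropy B J v) := by
  obtain ⟨g, hg, rfl⟩ := exists_word_eq hB w
  obtain ⟨R, hR, hadj, hJ, hRR⟩ := he.exists_twist hB hV.admissible hg 0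
    (fun σ hσ => by rw [h1 _ ⟨σ, hσ, hσ.1, rfl⟩, zero_mul])
    (by rw [h2, h3, sum_eq_posPar_add_negPar, h2, zero_mul, add_zero, zero_add,
      CharTwo.add_self_eq_zero])
  rw [h2] at hRR
  have hJ' : ∀ z x, R (J (gen z) x) = J (gen z) (R x) := fun z x =>
    act_linear_ext (B := B)
      (f := R ∘ₗ ((LinearMap.applyₗ x).comp J.toLinearMap).comp gen)
      (g := ((LinearMap.applyₗ (R x)).comp J.toLinearMap).comp gen)
      (fun i => by simpa using hJ i x) z
  rw [word_mem_codeOf_iff hB hg, mem_hat_isotropy]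
  refine ⟨hg, ?_⟩
  rw [← hR]
  rcases selfAdjoint_involution_eq hV R (by simpa using hRR) hadj hJ' with h | h
  · exact ⟨0, by simp [h]⟩
  · exact ⟨1, by simp [h]⟩

/-- If `𝔸` consists of orthogonal maps, then no operator of `exists_twist` is self-adjoint and
anticommutes with the Clifford action: from such an operator `K`, with `K² = ±1`, one gets the
non-orthogonal elements `p + q K` of `𝔸`, where `p² ∓ q² = 1`. -/
theorem IsOrbitBasis.ctwo_eq_one (he : IsOrbitBasis B J b e v) (hB : IsOrthonormalBasis B)
    (h : IsAdmissible J b) (hA : ∀ A ∈ groupA h, ∀ x y, b (A x) (A y) = b x y)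
    {w : Fin r ⊕ Fin s → ZMod 2}
    (h1 : ∀ u ∈ codeOf hB (isotropy B J v), beta u w = ∑ i, u i) : ctwo w = 1 := by
  obtain ⟨g, hg, rfl⟩ := exists_word_eq hB w
  by_contra hne
  have h0 : ctwo (word hB g) = 0 := (zmod_two_cases _).resolve_right hne
  obtain ⟨K, hK, hadj, hJ, hKK⟩ := he.exists_twist hB h hg 1
    (fun σ hσ => by rw [h1 _ ⟨σ, hσ, hσ.1, rfl⟩, one_mul])
    (by
      rw [h0, one_mul, sum_eq_posPar_add_negPar]
      generalize negPar (word hB g) = x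
      generalize posPar (word hB g) = y
      revert x y; decide)
  obtain ⟨p, q, hq, hpq⟩ : ∃ p q : ℝ, q ≠ 0 ∧ p * p - signed (negPar (word hB g)) (q * q) = 1 := by
    -- a point of a hyperbola or of a circle, according to the sign of `K²`
    rcases zmod_two_cases (negPar (word hB g)) with h2 | h2 <;> rw [h2]
    · exact ⟨5 / 4, 3 / 4, by norm_num, by norm_num⟩
    · exact ⟨3 / 5, 4 / 5, by norm_num, by norm_num⟩
  have hsg : ∀ (a : ZMod 2) (c : ℝ) (x : V), c • signed a x = signed a c • x := by
    intro a c x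
    rcases zmod_two_cases a with rfl | rfl <;> simp
  have hinv : ∀ (p q : ℝ), p * p - signed (negPar (word hB g)) (q * q) = 1 → ∀ x,
      p • (p • x - q • K x) + q • K (p • x - q • K x) = x := by
    intro p q hpq x
    simp only [map_sub, map_smul, hKK, smul_sub, smul_smul, hsg]
    rw [mul_comm q p, mul_signed]
    have : (p * p) • x - (p * q) • K x +
        ((p * q) • K x - (signed (negPar (word hB g)) (q * q)) • x) =
      (p * p - signed (negPar (word hB g)) (q * q)) • x := by rw [sub_smul]; abel
    rw [this, hpq, one_smul]
  let A : V ≃ₗ[ℝ] V := LinearEquiv.ofLinearMap (p • LinearMap.id + q • K) (p • LinearMap.id - q • K)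
    (LinearMap.ext fun x => by simpa using hinv p q hpq x)
    (LinearMap.ext fun x => by
      have := hinv p (-q) (by rwa [neg_mul_neg]) x
      simp only [neg_smul, sub_neg_eq_add, ← sub_eq_add_neg] at this
      simpa using this)
  have hAx : ∀ x, A x = p • x + q • K x := fun x => rfl
  have hAadj : ∀ x y, b (A x) y = b x (A y) := fun x y => by
    simp [hAx, hadj]
  have hAJ : ∀ i x, A (J (gen (B i)) (A x)) = J (gen (B i)) x := by
    intro i x
    have h5 : A (J (gen (B i)) (A x)) = J (gen (B i)) (p • (p • x + q • K x) -
        q • K (p • x + q • K x)) := by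
      rw [hAx, hAx, hJ, signed_one, map_sub, map_smul (J _) p, map_smul (J _) q, smul_neg,
        ← sub_eq_add_neg]
    rw [h5]
    congr 1
    have := hinv p (-q) (by rwa [neg_mul_neg]) x
    simpa only [neg_smul, sub_neg_eq_add, ← sub_eq_add_neg] using this
  have hmem : A ∈ groupA h := mem_groupA (B := B) h A fun i u x => by
    rw [← hAadj, hAJ]
  -- `A` is self-adjoint and orthogonal, hence an involution
  have hAA : ∀ x, A (A x) = x := by
    intro x
    rw [← sub_eq_zero]
    refine h.nondegenerate.1 _ fun y => ?_
    rw [map_sub, LinearMap.sub_apply, hAadj, hA A hmem, sub_self]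
  have hKv : K v = 0 := by
    have h6 : A v = p • v - q • K v := by
      have h7 := hAA (p • v - q • K v)
      have h8 : A (p • v - q • K v) = v := hinv p q hpq v
      rwa [h8] at h7
    rw [hAx, sub_eq_add_neg, add_right_inj, eq_neg_iff_add_eq_zero, ← two_smul ℝ, smul_smul] at h6
    exact (smul_eq_zero.mp h6).resolve_left (mul_ne_zero two_ne_zero hq)
  have h9 := hKK v
  rw [hKv, map_zero] at h9
  have := he.vector_ne_zero
  rcases signed_eq_or (negPar (word hB g)) v with h10 | h10 <;> rw [h10] at h9
  · exact this h9.symm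
  · exact this (neg_eq_zero.mp h9.symm)

end CodeModule

/-! ### Gauss sums of binary codes -/

section Gauss

variable {ι : Type*} [Fintype ι]

open Classical in
/-- Orthogonality of characters with values `±1`. -/
theorem sum_signed_addHom {A : Type*} [AddCommGroup A] [Fintype A] (C : AddSubgroup A)
    (χ : A → ZMod 2) (hχ : ∀ u v, χ (u + v) = χ u + χ v) :
    ∑ u ∈ Finset.univ.filter (· ∈ C), signed (χ u) (1 : ℤ) =
      if ∀ u ∈ C, χ u = 0 then (Nat.card C : ℤ) else 0 := by
  split_ifs with h
  · rw [Finset.sum_congr rfl (g := fun _ => (1 : ℤ))]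
    · simp [Nat.card_eq_fintype_card, Fintype.card_subtype]
    · intro u hu
      rw [h u (by simpa using hu), signed_zero]
  · push Not at h
    obtain ⟨u₀, hu₀, h₀⟩ := h
    have h1 : χ u₀ = 1 := (zmod_two_cases _).resolve_left h₀
    have h2 : ∑ u ∈ Finset.univ.filter (· ∈ C), signed (χ u) (1 : ℤ) =
        ∑ u ∈ Finset.univ.filter (· ∈ C), -signed (χ u) (1 : ℤ) := by
      refine Finset.sum_bij' (fun u _ => u + u₀) (fun u _ => u - u₀) ?_ ?_ ?_ ?_ ?_
      · intro u hu; simp at hu ⊢; exact add_mem hu hu₀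
      · intro u hu; simp at hu ⊢; exact sub_mem hu hu₀
      · intro u _; simp
      · intro u _; simp
      · intro u _; simp [hχ, h1, signed_add, signed_neg]
    rw [Finset.sum_neg_distrib] at h2
    linarith

open Classical in
/-- Averaging the Gauss sum over the translates by the words of the code `C` leaves only the words
`w` with `beta u w = ∑ u` on `C`, each of which contributes `-1`. -/
theorem gaussSum_eq_neg_card (C : AddSubgroup (ι → ZMod 2)) (hC : ∀ w ∈ C, ctwo w = ∑ i, w i)
    (hT : ∀ w, (∀ u ∈ C, beta u w = ∑ i, u i) → ctwo w = 1) :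
    ∑ w : ι → ZMod 2, signed (ctwo w) (1 : ℤ) =
      -(Finset.univ.filter fun w => ∀ u ∈ C, beta u w = ∑ i, u i).card := by
  have hpos : (Nat.card C : ℤ) ≠ 0 := by
    exact_mod_cast Nat.card_pos.ne'
  have hmul : ∀ (a c : ZMod 2), signed (a + c) (1 : ℤ) = signed a 1 * signed c 1 := by
    intro a c; rw [signed_add, signed_mul, one_mul]
  have h1 : ∀ w : ι → ZMod 2, ∑ u ∈ Finset.univ.filter (· ∈ C), signed (ctwo (w + u)) (1 : ℤ) =
      if ∀ u ∈ C, beta u w = ∑ i, u i then -(Nat.card C : ℤ) else 0 := by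
    intro w
    have h2 := sum_signed_addHom C (fun u => (∑ i, u i) + beta u w) (fun u v => by
      simp only [Pi.add_apply, Finset.sum_add_distrib, beta_add_left]; ring)
    have h3 : ∀ u ∈ Finset.univ.filter (· ∈ C), signed (ctwo (w + u)) (1 : ℤ) =
        signed (ctwo w) 1 * signed ((∑ i, u i) + beta u w) 1 := by
      intro u hu
      rw [← hmul, ctwo_add, hC u (by simpa using hu), beta_comm w u, add_assoc]
    rw [Finset.sum_congr rfl h3, ← Finset.mul_sum, h2]
    have h4 : (∀ u ∈ C, (∑ i, u i) + beta u w = 0) ↔ ∀ u ∈ C, beta u w = ∑ i, u i := by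
      refine forall₂_congr fun u _ => ?_
      rw [CharTwo.add_eq_zero, eq_comm]
    simp only [h4]
    split_ifs with h5
    · rw [hT w h5, signed_one, neg_one_mul]
    · simp
  have h2 : ∑ w : ι → ZMod 2, ∑ u ∈ Finset.univ.filter (· ∈ C), signed (ctwo (w + u)) (1 : ℤ) =
      Nat.card C * ∑ w : ι → ZMod 2, signed (ctwo w) (1 : ℤ) := by
    rw [Finset.sum_comm]
    have h3 : ∀ u ∈ Finset.univ.filter (· ∈ C), ∑ w, signed (ctwo (w + u)) (1 : ℤ) =
        ∑ w : ι → ZMod 2, signed (ctwo w) (1 : ℤ) := fun u _ =>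
      Equiv.sum_comp (Equiv.addRight u) fun w => signed (ctwo w) (1 : ℤ)
    rw [Finset.sum_congr rfl h3, Finset.sum_const, nsmul_eq_mul]
    simp [Nat.card_eq_fintype_card, Fintype.card_subtype]
  simp only [h1, ← Finset.sum_filter, Finset.sum_const, nsmul_eq_mul] at h2
  apply mul_left_cancel₀ hpos
  rw [← h2]; ring

open Classical in
/-- The number of words `w` with `beta u w = ∑ u` on the code `C`, in terms of the intersection of
`C` with the radical of `beta`. -/
theorem card_mul_card_dual (C : AddSubgroup (ι → ZMod 2)) :
    (Nat.card C : ℤ) * (Finset.univ.filter fun w => ∀ u ∈ C, beta u w = ∑ i, u i).card =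
      2 ^ Fintype.card ι * ∑ u ∈ Finset.univ.filter (fun u => u ∈ C ∧ ∀ w, beta u w = 0),
        signed (∑ i, u i) (1 : ℤ) := by
  have hmul : ∀ (a c : ZMod 2), signed (a + c) (1 : ℤ) = signed a 1 * signed c 1 := by
    intro a c; rw [signed_add, signed_mul, one_mul]
  have h1 : ∑ w : ι → ZMod 2, ∑ u ∈ Finset.univ.filter (· ∈ C),
      signed ((∑ i, u i) + beta u w) (1 : ℤ) =
      (Nat.card C : ℤ) * (Finset.univ.filter fun w => ∀ u ∈ C, beta u w = ∑ i, u i).card := by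
    have h2 : ∀ w : ι → ZMod 2, _ := fun w =>
      sum_signed_addHom C (fun u => (∑ i, u i) + beta u w) (fun u v => by
      simp only [Pi.add_apply, Finset.sum_add_distrib, beta_add_left]; ring)
    have h4 : ∀ w, (∀ u ∈ C, (∑ i, u i) + beta u w = 0) ↔ ∀ u ∈ C, beta u w = ∑ i, u i := by
      intro w
      refine forall₂_congr fun u _ => ?_
      rw [CharTwo.add_eq_zero, eq_comm]
    simp only [h2, h4, ← Finset.sum_filter, Finset.sum_const, nsmul_eq_mul]
    ring
  rw [← h1, Finset.sum_comm]
  have h5 : ∀ u : ι → ZMod 2, ∑ w, signed ((∑ i, u i) + beta u w) (1 : ℤ) =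
      if ∀ w, beta u w = 0 then 2 ^ Fintype.card ι * signed (∑ i, u i) (1 : ℤ) else 0 := by
    intro u
    have h6 := sum_signed_addHom (⊤ : AddSubgroup (ι → ZMod 2)) (fun w => beta u w)
      (fun w w' => beta_add_right w w' u)
    simp only [AddSubgroup.mem_top, Finset.filter_true, true_implies] at h6
    simp only [hmul, ← Finset.mul_sum, h6]
    split_ifs
    · simp [mul_comm]
    · simp
  simp only [h5, ← Finset.sum_filter, Finset.filter_filter]
  rw [Finset.mul_sum]

open Classical in
/-- The Gauss sum, with the words sorted by weight. -/
theorem gaussSum_eq_sum_choose :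
    ∑ w : ι → ZMod 2, signed (ctwo w) (1 : ℤ) =
      ∑ k ∈ Finset.range (Fintype.card ι + 1),
        (Fintype.card ι).choose k • signed ((k.choose 2 : ℕ) : ZMod 2) (1 : ℤ) := by
  have h := Finset.sum_powerset_apply_card (x := (Finset.univ : Finset ι))
    (fun k => signed ((k.choose 2 : ℕ) : ZMod 2) (1 : ℤ))
  rw [Finset.card_univ] at h
  rw [← h, Finset.powerset_univ]
  refine Finset.sum_bij' (fun w _ => Finset.univ.filter fun i => w i = 1)
    (fun t _ i => if i ∈ t then 1 else 0) (by simp) (by simp) ?_ ?_ ?_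
  · intro w _
    funext i
    rcases zmod_two_cases (w i) with h | h <;> simp [h]
  · intro t _
    ext i; simp
  · intro w _
    have : wt w = (Finset.univ.filter fun i => w i = 1).card := by
      rw [wt, Finset.card_filter]
      refine Finset.sum_congr rfl fun i _ => ?_
      rcases zmod_two_cases (w i) with h | h <;> simp [h, ZMod.val_one]
    rw [ctwo, this]

/-- The radical of `beta`: it is spanned by the word `1` if the length is odd, and zero if the
length is even. -/
theorem beta_eq_zero_iff (u : ι → ZMod 2) :
    (∀ w, beta u w = 0) ↔ u = 0 ∨ (u = 1 ∧ (Fintype.card ι : ZMod 2) = 1) := by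
  classical
  constructor
  · intro h
    have h1 : ∀ i, u i = ∑ j, u j := fun i => by
      have := h (Pi.single i 1)
      rw [beta_comm, beta_single_left] at this
      exact (CharTwo.add_eq_zero.mp this).symm
    rcases zmod_two_cases (∑ j, u j) with h0 | h0
    · left; funext i; rw [h1, h0]; rfl
    · right
      have h2 : u = 1 := by funext i; rw [h1, h0]; rfl
      refine ⟨h2, ?_⟩
      rw [h2] at h0
      simpa using h0
  · rintro (rfl | ⟨rfl, h⟩) w
    · simp
    · simp [beta, h, CharTwo.add_self_eq_zero]

/-- The numerical restrictions on a code of length at most ten that carries no word `w` with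
`beta u w = ∑ u` on the code and `ctwo w = 0`. -/
theorem code_restrictions (C : AddSubgroup (ι → ZMod 2)) (hn : Fintype.card ι ≤ 10)
    (hC : ∀ w ∈ C, ctwo w = ∑ i, w i)
    (hT : ∀ w, (∀ u ∈ C, beta u w = ∑ i, u i) → ctwo w = 1) :
    (Fintype.card ι = 3 ∧ 1 ∈ C) ∨ (Fintype.card ι = 5 ∧ Nat.card C = 4) ∨
      (Fintype.card ι = 6 ∧ Nat.card C = 8) ∨ (Fintype.card ι = 7 ∧ 1 ∈ C) := by
  classical
  have h1 := gaussSum_eq_neg_card C hC hT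
  have h2 := card_mul_card_dual C
  rw [gaussSum_eq_sum_choose] at h1
  set t := (Finset.univ.filter fun w => ∀ u ∈ C, beta u w = ∑ i, u i).card with ht
  have h3 : (Fintype.card ι : ZMod 2) = 0 ∨ 1 ∉ C →
      (Nat.card C : ℤ) * t = 2 ^ Fintype.card ι := by
    intro h
    have : (Finset.univ.filter (fun u => u ∈ C ∧ ∀ w, beta u w = 0)) = {0} := by
      ext u
      simp only [Finset.mem_filter, Finset.mem_univ, true_and, beta_eq_zero_iff,
        Finset.mem_singleton]
      constructor
      · rintro ⟨hu, rfl | ⟨rfl, h'⟩⟩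
        · rfl
        · rcases h with h | h
          · rw [h] at h'; exact absurd h' (by decide)
          · exact absurd hu h
      · rintro rfl; exact ⟨zero_mem _, Or.inl rfl⟩
    rw [this] at h2
    simpa using h2
  have hk : ∀ k : ℕ, ∀ v : ℤ, Fintype.card ι = k →
      (∑ j ∈ Finset.range (k + 1), k.choose j • signed ((j.choose 2 : ℕ) : ZMod 2) (1 : ℤ)) = v →
      v = -t := by
    intro k v hk hv
    rw [← hv, ← h1, hk]
  have hone : ∀ k : ℕ, Fintype.card ι = k → (k : ZMod 2) = 0 → ((k.choose 2 : ℕ) : ZMod 2) = 0 →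
      False := by
    intro k hk h0 h2
    have h4 := hT 1 fun u _ => by simp [beta, hk, h0]
    have h5 : wt (1 : ι → ZMod 2) = k := by simp [wt, ZMod.val_one, hk]
    rw [ctwo, h5, h2] at h4
    exact absurd h4 (by decide)
  -- the Gauss sums of length up to ten; it must be the negative of the number `t`
  generalize hn' : Fintype.card ι = n at *
  interval_cases n
  · have := hk 0 1 rfl (by decide); omega
  · have := hk 1 2 rfl (by decide); omega
  · have := hk 2 2 rfl (by decide); omega
  · by_cases h5 : (1 : ι → ZMod 2) ∈ C
    · exact Or.inl ⟨rfl, h5⟩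
    · have := hk 3 0 rfl (by decide)
      have h6 := h3 (Or.inr h5)
      rw [show (t : ℤ) = 0 by omega] at h6
      norm_num at h6
  · exact (hone 4 rfl (by decide) (by decide)).elim
  · have := hk 5 (-8) rfl (by decide)
    have h5 : (1 : ι → ZMod 2) ∉ C := fun h5 => by
      have := hC 1 h5
      simp [ctwo, wt, ZMod.val_one, hn'] at this
      exact absurd this (by decide)
    have h6 := h3 (Or.inr h5)
    rw [show (t : ℤ) = 8 by omega] at h6
    exact Or.inr (Or.inl ⟨rfl, by omega⟩)
  · have := hk 6 (-8) rfl (by decide)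
    have h6 := h3 (Or.inl (by decide))
    rw [show (t : ℤ) = 8 by omega] at h6
    exact Or.inr (Or.inr (Or.inl ⟨rfl, by omega⟩))
  · by_cases h5 : (1 : ι → ZMod 2) ∈ C
    · exact Or.inr (Or.inr (Or.inr ⟨rfl, h5⟩))
    · have := hk 7 0 rfl (by decide)
      have h6 := h3 (Or.inr h5)
      rw [show (t : ℤ) = 0 by omega] at h6
      norm_num at h6
  · have := hk 8 16 rfl (by decide); omega
  · have := hk 9 32 rfl (by decide); omega
  · have := hk 10 32 rfl (by decide); omega

end Gauss

/-! ### Equivalences of groups from lattice isomorphisms -/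

section Lattice

variable {r s : ℕ} {B : Module.Basis (Fin r ⊕ Fin s) ℝ (RS r s)}
  {V : Type*} [AddCommGroup V] [Module ℝ V]
  {J : Cl r s →ₐ[ℝ] Module.End ℝ V} {b : LinearMap.BilinForm ℝ V}
  {κ : Type*} {e : Module.Basis κ ℝ V} {v : V}

theorem exists_int_repr {ι' M : Type*} [AddCommGroup M] [Module ℝ M] (f : Module.Basis ι' ℝ M)
    {x : M} (hx : x ∈ AddSubgroup.closure (Set.range f)) (i : ι') : ∃ n : ℤ, f.repr x i = n := by
  classical
  induction hx using AddSubgroup.closure_induction with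
  | mem x hx =>
    obtain ⟨j, rfl⟩ := hx
    by_cases h : j = i
    · exact ⟨1, by simp [h]⟩
    · exact ⟨0, by simp [h]⟩
  | zero => exact ⟨0, by simp⟩
  | add x y _ _ h1 h2 =>
    obtain ⟨m, hm⟩ := h1
    obtain ⟨n, hn⟩ := h2
    exact ⟨m + n, by simp [hm, hn]⟩
  | neg x _ h1 =>
    obtain ⟨m, hm⟩ := h1
    exact ⟨-m, by simp [hm]⟩

theorem signed_mem {M : Type*} [AddGroup M] {S : AddSubgroup M} {x : M} (hx : x ∈ S)
    (a : ZMod 2) : signed a x ∈ S := by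
  rcases signed_eq_or a x with h | h <;> rw [h]
  exacts [hx, neg_mem hx]

/-- The extended isotropy group consists of the elements of `G(B)` that act trivially on the
lattice spanned by the basis, modulo twice that lattice. -/
theorem IsOrbitBasis.mem_hat_isotropy_iff (he : IsOrbitBasis B J b e v)
    (hB : IsOrthonormalBasis B) {σ : (Cl r s)ˣ} (hσ : σ ∈ G B) :
    σ ∈ hat (isotropy B J v) ↔ ∀ x ∈ AddSubgroup.closure (Set.range e),
      ∃ y ∈ AddSubgroup.closure (Set.range e), J (σ : Cl r s) x = x + (y + y) := by
  rw [mem_hat_isotropy]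
  constructor
  · rintro ⟨-, a, ha⟩ x hx
    induction hx using AddSubgroup.closure_induction with
    | mem x hx =>
      obtain ⟨i, rfl⟩ := hx
      have hi := AddSubgroup.subset_closure (Set.mem_range_self i) (G := V) (k := Set.range e)
      obtain ⟨τ, hτ, h⟩ := he.exists_eq i
      have h1 : ∃ c, J (σ : Cl r s) (e i) = signed c (e i) :=
        ⟨_, by rw [h, ← act_mul, mul_comm_signed hB hσ hτ, act_signed, act_mul, ha, map_signed,
          ← signed_add]⟩
      obtain ⟨c, hc⟩ := h1
      rw [hc]
      rcases zmod_two_cases c with rfl | rfl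
      · exact ⟨0, zero_mem _, by simp⟩
      · exact ⟨-e i, neg_mem hi, by simp⟩
    | zero => exact ⟨0, zero_mem _, by simp⟩
    | add x x' _ _ h1 h2 =>
      obtain ⟨y, hy, h1⟩ := h1
      obtain ⟨y', hy', h2⟩ := h2
      exact ⟨y + y', add_mem hy hy', by rw [map_add, h1, h2]; abel⟩
    | neg x _ h1 =>
      obtain ⟨y, hy, h1⟩ := h1
      exact ⟨-y, neg_mem hy, by rw [map_neg, h1]; abel⟩
  · intro h
    refine ⟨hσ, ?_⟩
    obtain ⟨i, a, hi⟩ := he.act_vector_eq hB 1 (one_mem _)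
    obtain ⟨j, c, hj⟩ := he.act_vector_eq hB σ hσ
    rw [Units.val_one, map_one, Module.End.one_apply] at hi
    by_cases hij : i = j
    · subst hij
      have h1 : e i = signed a v := by
        conv_rhs => rw [hi]
        rw [signed_signed]
      exact ⟨c + a, by rw [hj, h1, signed_add]⟩
    · exfalso
      obtain ⟨y, hy, h1⟩ := h v (by
        rw [hi]; exact signed_mem (AddSubgroup.subset_closure (Set.mem_range_self i)) a)
      obtain ⟨n, hn⟩ := exists_int_repr e hy j
      rw [hj, hi] at h1
      have h2 := congrArg (fun x => e.repr x j) h1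
      simp only [map_add, map_signed e.repr, Finsupp.add_apply, hn] at h2
      have h3 : ∀ (a : ZMod 2) (f : κ →₀ ℝ), (signed a f) j = signed a (f j) := by
        intro a f
        rcases zmod_two_cases a with rfl | rfl <;> simp
      rw [h3, h3, e.repr_self, e.repr_self, Finsupp.single_eq_same,
        Finsupp.single_eq_of_ne (Ne.symm hij)] at h2
      have h4 : signed a (0 : ℝ) = 0 := by simp [signed]
      rw [h4, zero_add] at h2
      rcases signed_eq_or c (1 : ℝ) with h5 | h5 <;> rw [h5] at h2 <;>
        · have h6 : (1 : ℤ) = n + n ∨ (-1 : ℤ) = n + n := by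
            first
            | exact Or.inl (by exact_mod_cast h2)
            | exact Or.inr (by exact_mod_cast h2)
          omega

theorem exists_orbitBasis {S : Subgroup (Cl r s)ˣ} (he : IsBasisOf B J b S e) :
    ∃ v, IsOrbitBasis B J b e v ∧ hat (isotropy B J v) = hat S := by
  obtain ⟨v, h1, h2, h3⟩ := he.exists_vector
  exact ⟨v, ⟨he.toIsInvariantBasis, h1, h3⟩, h2⟩

theorem extend_surjOn_G (hB : IsOrthonormalBasis B) {C : (negQ r s).IsometryEquiv (negQ r s)}
    (hC : IsReordering B C) : ∀ τ ∈ G B, ∃ σ ∈ G B, extend C σ = τ := by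
  rw [isReordering_iff] at hC
  choose π a hπ using hC
  have hinj : Function.Injective π := by
    intro i j hij
    have h1 : C (B i) = signed (a i + a j) (C (B j)) := by
      rw [hπ i, hπ j, hij, ← signed_add]
      congr 1
      rw [add_assoc, CharTwo.add_self_eq_zero, add_zero]
    rw [← map_signed C] at h1
    exact (IsOrbitBasis.index_eq_of_eq_signed B _ (C.injective h1)).1
  have hsurj := Finite.surjective_of_injective hinj
  refine G_induction hB ⟨1, one_mem _, map_one _⟩ ?_ ?_
  · rintro τ - ⟨σ, hσ, h⟩
    exact ⟨-σ, neg_mem_G hσ, by rw [extend_neg, h]⟩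
  · rintro j τ - ⟨σ, hσ, h⟩
    obtain ⟨i, rfl⟩ := hsurj j
    refine ⟨signed (a i) (zU hB i) * σ, mul_mem (signed_mem_G (zU_mem_G hB i) _) hσ, ?_⟩
    rw [map_mul, extend_signed, extend_zU hB (hπ i), signed_signed, h]

/-- A linear map `A` of `V` that is compatible with the brackets up to a signed re-ordering `C`
intertwines the Clifford action with its twist by `C`, up to a global sign: the map `Aᵗ A` belongs
to `𝔸`, hence it is an orthogonal self-adjoint involution, and so it is `1` or `-1`. -/
theorem exists_signed_intertwine [FiniteDimensional ℝ V] (hB : IsOrthonormalBasis B)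
    (hV : IsMinimalAdmissible J b)
    (hA : ∀ A ∈ groupA hV.admissible, ∀ u v, b (A u) (A v) = b u v)
    (A : V ≃ₗ[ℝ] V) (C : (negQ r s).IsometryEquiv (negQ r s))
    (hform : ∀ z u v, b (J (gen (C z)) (A u)) (A v) = b (J (gen z) u) v) :
    ∃ a, ∀ i x, J (gen (C (B i))) (A x) = signed a (A (J (gen (B i)) x)) := by
  have hnd := hV.admissible.nondegenerate
  have hsymm := hV.admissible.symm
  let A' : V →ₗ[ℝ] V := b.leftAdjointOfNondegenerate hnd A
  have hA' : ∀ x y, b (A' x) y = b x (A y) :=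
    LinearMap.BilinForm.isAdjointPairLeftAdjointOfNondegenerate b hnd A
  have hA'' : ∀ x y, b (A x) y = b x (A' y) := fun x y => by rw [hsymm, ← hA', hsymm]
  have heq : ∀ x y, (∀ u, b x u = b y u) → x = y := fun x y h => by
    rw [← sub_eq_zero]
    exact hnd.1 _ fun u => by rw [map_sub, LinearMap.sub_apply, h, sub_self]
  have h1 : ∀ z x, A' (J (gen (C z)) (A x)) = J (gen z) x := fun z x =>
    heq _ _ fun u => by rw [hA', hform]
  have hsq : ∀ z x, J (gen z) (J (gen z) x) = (-scal z z) • x := fun z x => by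
    rw [← Module.End.mul_apply, ← map_mul, ι_sq_scalar, negQ_apply, AlgHom.commutes,
      Module.algebraMap_end_apply]
  have h2 : ∀ i x, A (J (gen (B i)) (A' x)) = J (gen (C (B i))) x := by
    intro i x
    have hc : -scal (B i) (B i) ≠ 0 := by
      rw [hB, if_pos rfl]; intro h0
      have := sgn_mul_self (r := r) (s := s) i
      rw [neg_eq_zero.mp h0] at this; norm_num at this
    have h3 : ∀ y, A (J (gen (B i)) (A' (J (gen (C (B i))) y))) = (-scal (B i) (B i)) • y := by
      intro y
      obtain ⟨x, rfl⟩ := A.surjective y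
      rw [h1, hsq, map_smul]
    have h4 := h3 (J (gen (C (B i))) x)
    rw [hsq, scal_isometry, map_smul, map_smul, map_smul] at h4
    exact smul_right_injective V hc h4
  let P₀ : V →ₗ[ℝ] V := A' ∘ₗ A.toLinearMap
  have hP₀ : ∀ x, P₀ x = A' (A x) := fun x => rfl
  have hinj : Function.Injective P₀ := by
    rw [← LinearMap.ker_eq_bot, LinearMap.ker_eq_bot']
    intro x hx
    apply A.injective
    rw [map_zero]
    refine hnd.1 _ fun y => ?_
    obtain ⟨u, rfl⟩ := A.surjective y
    rw [← hA', ← hP₀, hx, map_zero, LinearMap.zero_apply]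
  let P : V ≃ₗ[ℝ] V := LinearEquiv.ofInjectiveEndo P₀ hinj
  have hP : ∀ x, P x = A' (A x) := fun x => rfl
  have hadj : ∀ x y, b (P x) y = b x (P y) := fun x y => by rw [hP, hP, hA', hA'']
  have hPJP : ∀ i x, P (J (gen (B i)) (P x)) = J (gen (B i)) x := fun i x => by
    rw [hP, hP, h2, h1]
  have hmem : P ∈ groupA hV.admissible := mem_groupA (B := B) _ P fun i u x => by
    rw [← hadj, hPJP]
  have hPP : ∀ x, P (P x) = x := fun x => heq _ _ fun u => by rw [hadj, hA P hmem]
  have hPJ : ∀ z x, P (J (gen z) x) = J (gen z) (P x) := fun z x =>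
    act_linear_ext (B := B)
      (f := P.toLinearMap ∘ₗ ((LinearMap.applyₗ x).comp J.toLinearMap).comp gen)
      (g := ((LinearMap.applyₗ (P x)).comp J.toLinearMap).comp gen)
      (fun i => by
        have := hPJP i (P x)
        rw [hPP] at this
        simpa using this) z
  have h5 : ∃ a, ∀ x, A' (A x) = signed a x := by
    rcases selfAdjoint_involution_eq hV P.toLinearMap hPP hadj hPJ with h | h
    · exact ⟨0, fun x => by rw [signed_zero]; exact h x⟩
    · exact ⟨1, fun x => by rw [signed_one]; exact h x⟩
  obtain ⟨a, ha⟩ := h5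
  refine ⟨a, fun i x => ?_⟩
  rw [← h2, ha, map_signed, map_signed]

/-- A linear map that identifies the lattices and is compatible with the brackets, up to a signed
re-ordering, shows that the groups are equivalent. -/
theorem equivalent_of_intertwine [FiniteDimensional ℝ V] (hB : IsOrthonormalBasis B)
    (hV : IsMinimalAdmissible J b)
    (hA : ∀ A ∈ groupA hV.admissible, ∀ u v, b (A u) (A v) = b u v)
    {S₁ S₂ : Subgroup (Cl r s)ˣ} (hS₁ : S₁ ≤ G B) (hS₂ : S₂ ≤ G B)
    {κ₁ κ₂ : Type*} {e₁ : Module.Basis κ₁ ℝ V} {e₂ : Module.Basis κ₂ ℝ V}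
    (he₁ : IsBasisOf B J b S₁ e₁) (he₂ : IsBasisOf B J b S₂ e₂)
    (A : V ≃ₗ[ℝ] V) (C : (negQ r s).IsometryEquiv (negQ r s)) (hC : IsReordering B C)
    (hlat : ∀ x, A x ∈ AddSubgroup.closure (Set.range e₂) ↔
      x ∈ AddSubgroup.closure (Set.range e₁))
    (hform : ∀ z u v, b (J (gen (C z)) (A u)) (A v) = b (J (gen z) u) v) :
    Equivalent B S₁ S₂ := by
  obtain ⟨a, ha⟩ := exists_signed_intertwine hB hV hA A C hform
  have hσ : ∀ σ ∈ G B, ∃ c, ∀ x, J (extend C σ : Cl r s) (A x) =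
      signed c (A (J (σ : Cl r s) x)) := by
    refine G_induction hB ⟨0, by simp⟩ ?_ ?_
    · rintro σ - ⟨c, hc⟩
      refine ⟨c, fun x => ?_⟩
      rw [extend_neg]
      simp [hc, signed_neg]
    · rintro i σ - ⟨c, hc⟩
      refine ⟨c + a, fun x => ?_⟩
      have h1 : (extend C (zU hB i) : Cl r s) = gen (C (B i)) := by
        rw [extend_val, zU_val, map_apply_ι]; rfl
      rw [map_mul, act_mul, hc, map_signed, h1, ha, act_mul, signed_add]
      rfl
  obtain ⟨v₁, h₁, hat₁⟩ := exists_orbitBasis he₁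
  obtain ⟨v₂, h₂, hat₂⟩ := exists_orbitBasis he₂
  have key : ∀ σ ∈ G B, σ ∈ hat S₁ ↔ extend C σ ∈ hat S₂ := by
    intro σ hσG
    rw [← hat₁, ← hat₂, h₁.mem_hat_isotropy_iff hB hσG,
      h₂.mem_hat_isotropy_iff hB (extend_mem_G hB hC σ hσG)]
    obtain ⟨c, hc⟩ := hσ σ hσG
    -- a sign is immaterial modulo twice the lattice
    have hsg : ∀ {M : Type _} [AddCommGroup M] (L : AddSubgroup M) (x y : M), x ∈ L →
        (∃ y' ∈ L, signed c y = x + (y' + y')) → ∃ y' ∈ L, y = x + (y' + y') := by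
      intro M _ L x y hx ⟨y', hy', h⟩
      rcases zmod_two_cases c with rfl | rfl
      · exact ⟨y', hy', by simpa using h⟩
      · refine ⟨-(x + y'), neg_mem (add_mem hx hy'), ?_⟩
        rw [signed_one] at h
        rw [← neg_neg y, h]; abel
    constructor
    · intro h x hx
      obtain ⟨x, rfl⟩ := A.surjective x
      obtain ⟨y, hy, h3⟩ := h x ((hlat x).mp hx)
      refine hsg _ _ _ hx ⟨A y, (hlat y).mpr hy, ?_⟩
      rw [hc, signed_signed, h3]; simp
    · intro h x hx
      obtain ⟨y, hy, h3⟩ := h (A x) ((hlat x).mpr hx)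
      obtain ⟨y, rfl⟩ := A.surjective y
      refine hsg _ _ _ hx ⟨y, (hlat y).mp hy, ?_⟩
      apply A.injective
      rw [map_signed A, ← hc, h3]; simp
  refine ⟨C, hC, ?_⟩
  ext τ
  constructor
  · rintro ⟨σ, hσ', rfl⟩
    exact (key σ (hat_subset_G hS₁ hσ')).mp hσ'
  · intro hτ
    obtain ⟨σ, hσG, rfl⟩ := extend_surjOn_G hB hC τ (hat_subset_G hS₂ hτ)
    exact ⟨σ, (key σ hσG).mpr hτ, rfl⟩

theorem form_eq_of_bracket_eq {κ' : Type*} (e' : Module.Basis κ' ℝ V) (A : V →ₗ[ℝ] V)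
    (C D : RS r s →ₗ[ℝ] RS r s) (hCD : ∀ z w, scal z (C w) = scal (D z) w)
    (h : ∀ i j, C (bracketV J b (e' i) (e' j)) = bracketV J b (A (e' i)) (A (e' j)))
    (z : RS r s) (u v : V) : b (J (gen z) (A u)) (A v) = b (J (gen (D z)) u) v := by
  have h1 : (b ∘ₗ J (gen z)).compl₁₂ A A = b ∘ₗ J (gen (D z)) := by
    refine LinearMap.BilinForm.ext_basis e' fun i j => ?_
    show b (J (gen z) (A (e' i))) (A (e' j)) = b (J (gen (D z)) (e' i)) (e' j)
    rw [← scal_bracketV, ← h, hCD, scal_bracketV]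
  exact LinearMap.congr_fun₂ h1 u v

theorem equivalent_of_isomorphicByReordering [FiniteDimensional ℝ V] (hB : IsOrthonormalBasis B)
    (hV : IsMinimalAdmissible J b)
    (hA : ∀ A ∈ groupA hV.admissible, ∀ u v, b (A u) (A v) = b u v)
    {S₁ S₂ : Subgroup (Cl r s)ˣ} (hS₁ : S₁ ≤ G B) (hS₂ : S₂ ≤ G B)
    {κ₁ κ₂ : Type*} {e₁ : Module.Basis κ₁ ℝ V} {e₂ : Module.Basis κ₂ ℝ V}
    (he₁ : IsBasisOf B J b S₁ e₁) (he₂ : IsBasisOf B J b S₂ e₂)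
    (h : IsomorphicByReordering B
        (integralStructure hB hV.admissible he₁.toIsInvariantBasis)
        (integralStructure hB hV.admissible he₂.toIsInvariantBasis)) :
    Equivalent B S₁ S₂ := by
  obtain ⟨Φ, A, C, hC, hΦ⟩ := h
  let C' : RS r s →ₗ[ℝ] RS r s := C.toLinearEquiv.toLinearMap
  refine equivalent_of_intertwine hB hV hA hS₁ hS₂ he₁ he₂ A C hC (fun x => ⟨fun hx => ?_,
    fun hx => ?_⟩) (fun z u v => ?_)
  · let y : integralStructure hB hV.admissible he₂.toIsInvariantBasis :=
      ⟨LieN.mk _ (A x) 0, hx, zero_mem _⟩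
    have h1 := hΦ (Φ.symm y)
    rw [LieEquiv.apply_symm_apply] at h1
    have h2 : A x = A (LieN.fst _ (Φ.symm y : LieN hV.admissible)) := congrArg Prod.fst h1
    rw [A.injective h2]
    exact (Φ.symm y).2.1
  · have h1 := hΦ ⟨LieN.mk _ x 0, hx, zero_mem _⟩
    have h2 := (Φ ⟨LieN.mk _ x 0, hx, zero_mem _⟩).2.1
    rw [h1] at h2
    exact h2
  · have h1 := form_eq_of_bracket_eq (J := J) (b := b) e₁ A.toLinearMap C'
      C.symm.toLinearEquiv.toLinearMap (fun z w => by
        show scal z (C w) = scal (C.symm z) w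
        rw [← scal_isometry C (C.symm z) w]
        congr 1
        exact (C.toLinearEquiv.apply_symm_apply z).symm) (fun i j => ?_) (C z) u v
    · have h5 : C.symm.toLinearEquiv.toLinearMap (C z) = z := C.toLinearEquiv.symm_apply_apply z
      rwa [h5] at h1
    · let x : ∀ i, integralStructure hB hV.admissible he₁.toIsInvariantBasis := fun i =>
        ⟨LieN.mk _ (e₁ i) 0, AddSubgroup.subset_closure ⟨i, rfl⟩, zero_mem _⟩
      have h2 := congrArg Subtype.val (Φ.map_lie (x i) (x j))
      rw [hΦ] at h2
      have h3 : ((⁅Φ (x i), Φ (x j)⁆ : integralStructure hB hV.admissible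
        he₂.toIsInvariantBasis) : LieN hV.admissible) =
          ⁅(Φ (x i) : LieN hV.admissible), (Φ (x j) : LieN hV.admissible)⁆ := rfl
      rw [h3, hΦ, hΦ] at h2
      exact congrArg Prod.snd h2

end Lattice

/-! ### Lattice isomorphisms from equivalences of groups -/

section Construct

variable {r s : ℕ} {B : Module.Basis (Fin r ⊕ Fin s) ℝ (RS r s)}
  {V : Type*} [AddCommGroup V] [Module ℝ V]
  {J : Cl r s →ₐ[ℝ] Module.End ℝ V} {b : LinearMap.BilinForm ℝ V}

/-- An additive function on a binary code is the restriction of `w ↦ ∑ x w` for some `x`. -/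
theorem exists_dual_extension {ι : Type*} [Fintype ι] (C : AddSubgroup (ι → ZMod 2))
    (χ : C →+ ZMod 2) : ∃ x : ι → ZMod 2, ∀ w : C, χ w = ∑ i, x i * (w : ι → ZMod 2) i := by
  classical
  let C' : Submodule (ZMod 2) (ι → ZMod 2) := AddSubgroup.toZModSubmodule 2 C
  obtain ⟨f, hf⟩ := LinearMap.exists_extend (p := C') (AddMonoidHom.toZModLinearMap 2
    (χ : C' →+ ZMod 2))
  refine ⟨fun i => f (Pi.single i 1), fun w => ?_⟩
  have h1 : χ w = f w := (LinearMap.congr_fun hf w).symm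
  rw [h1]
  conv_lhs => rw [← Finset.univ_sum_single (w : ι → ZMod 2), map_sum]
  refine Finset.sum_congr rfl fun i _ => ?_
  have : (Pi.single i ((w : ι → ZMod 2) i) : ι → ZMod 2) =
      ((w : ι → ZMod 2) i) • (Pi.single i 1) := by
    rw [← Pi.single_smul, smul_eq_mul, mul_one]
  rw [this, map_smul, smul_eq_mul, mul_comm]

/-- The signs of an equivalence of groups can be adjusted so that it takes one isotropy group
exactly onto another, not only up to signs. -/
theorem exists_reordering_isotropy (hB : IsOrthonormalBasis B) {v₁ v₂ : V}
    (hv₁ : v₁ ≠ 0) (hv₂ : v₂ ≠ 0)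
    {C : (negQ r s).IsometryEquiv (negQ r s)} (hC : IsReordering B C)
    (hhat : extend C '' hat (isotropy B J v₁) = hat (isotropy B J v₂)) :
    ∃ C' : (negQ r s).IsometryEquiv (negQ r s), IsReordering B C' ∧
      extend C' '' hat (isotropy B J v₁) = hat (isotropy B J v₂) ∧
      ∀ σ ∈ isotropy B J v₁, J (extend C' σ : Cl r s) v₂ = v₂ := by
  have hvv : ∀ {v : V}, v ≠ 0 → v ≠ -v := fun {v} hv h => hv (by
    rw [eq_neg_iff_add_eq_zero, ← two_smul ℝ] at h
    exact (smul_eq_zero.mp h).resolve_left two_ne_zero)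
  have h1 : ∀ w : codeOf hB (isotropy B J v₁), ∃ a, ∀ σ ∈ isotropy B J v₁, word hB σ = w →
      J (extend C σ : Cl r s) v₂ = signed a v₂ := by
    rintro ⟨w, σ, hσ, hσ', rfl⟩
    have h2 : extend C σ ∈ hat (isotropy B J v₂) := by
      rw [← hhat]; exact ⟨σ, Or.inl hσ, rfl⟩
    obtain ⟨-, a, ha⟩ := mem_hat_isotropy.mp h2
    refine ⟨a, fun τ hτ hw => ?_⟩
    obtain ⟨c, rfl⟩ := eq_signed_of_word_eq hB hτ.1 hσ' hw
    have h3 := hτ.2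
    rw [act_signed, hσ.2] at h3
    have h4 : c = 0 := by
      rcases zmod_two_cases c with rfl | rfl
      · rfl
      · rw [signed_one] at h3; exact absurd h3.symm (hvv hv₁)
    rw [h4, signed_zero, ha]
  choose χ hχ using h1
  have hadd : ∀ w w', χ (w + w') = χ w + χ w' := by
    rintro ⟨w, σ, hσ, hσ', rfl⟩ ⟨w', τ, hτ, hτ', rfl⟩
    rw [← signed_left_inj (hvv hv₂)]
    have hm := word_mul hB hσ' hτ'
    rw [← hχ _ (σ * τ) (mul_mem hσ hτ) hm, map_mul, act_mul,
      hχ ⟨word hB τ, τ, hτ, hτ', rfl⟩ τ hτ rfl, map_signed,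
      hχ ⟨word hB σ, σ, hσ, hσ', rfl⟩ σ hσ rfl, ← signed_add, add_comm]
  obtain ⟨x, hx⟩ := exists_dual_extension _ (AddMonoidHom.mk' χ hadd)
  have hext : ∀ σ ∈ G B, extend ((flip hB x).trans C) σ =
      signed (∑ i, x i * word hB σ i) (extend C σ) := fun σ hσ => by
    rw [extend_trans, extend_flip hB x σ hσ, extend_signed]
  refine ⟨(flip hB x).trans C, (isReordering_signedPerm hB _ _ x).trans hC, ?_, ?_⟩
  · rw [← hhat]
    have hs : ∀ σ a, σ ∈ hat (isotropy B J v₁) → signed a σ ∈ hat (isotropy B J v₁) := by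
      intro σ a h
      rw [mem_hat_iff] at h ⊢
      obtain ⟨c, hc⟩ := h
      refine ⟨c + a, ?_⟩
      rwa [signed_add, signed_signed]
    ext τ
    constructor
    · rintro ⟨σ, hσ, rfl⟩
      refine ⟨_, hs σ (∑ i, x i * word hB σ i) hσ, ?_⟩
      rw [hext σ (mem_hat_isotropy.mp hσ).1, extend_signed]
    · rintro ⟨σ, hσ, rfl⟩
      have hσG := (mem_hat_isotropy.mp hσ).1
      refine ⟨_, hs σ (∑ i, x i * word hB σ i) hσ, ?_⟩
      rw [extend_signed, hext σ hσG, signed_signed]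
  · intro σ hσ
    have h5 : χ ⟨word hB σ, σ, hσ, hσ.1, rfl⟩ = _ := hx ⟨word hB σ, σ, hσ, hσ.1, rfl⟩
    rw [hext σ hσ.1, act_signed, hχ ⟨word hB σ, σ, hσ, hσ.1, rfl⟩ σ hσ rfl, h5, signed_signed]

/-- The lattice spanned by an invariant basis is spanned by the orbit of the unit vector. -/
theorem IsOrbitBasis.act_mem_lattice {κ : Type*} {e : Module.Basis κ ℝ V} {v : V}
    (he : IsOrbitBasis B J b e v) (hB : IsOrthonormalBasis B) {σ : (Cl r s)ˣ} (hσ : σ ∈ G B) :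
    J (σ : Cl r s) v ∈ AddSubgroup.closure (Set.range e) := by
  obtain ⟨i, a, h⟩ := he.act_vector_eq hB σ hσ
  rw [h]
  exact signed_mem (AddSubgroup.subset_closure (Set.mem_range_self i)) a

/-- The map of the lattices underlying an isomorphism given by a signed re-ordering. -/
theorem exists_intertwine_of_equivalent [FiniteDimensional ℝ V] (hB : IsOrthonormalBasis B)
    (h : IsAdmissible J b) {κ₁ κ₂ : Type*} {e₁ : Module.Basis κ₁ ℝ V} {e₂ : Module.Basis κ₂ ℝ V}
    {v₁ v₂ : V} (h₁ : IsOrbitBasis B J b e₁ v₁) (h₂ : IsOrbitBasis B J b e₂ v₂)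
    {C : (negQ r s).IsometryEquiv (negQ r s)} (hC : IsReordering B C)
    (hhat : extend C '' hat (isotropy B J v₁) = hat (isotropy B J v₂)) :
    ∃ (A : V ≃ₗ[ℝ] V) (D : (negQ r s).IsometryEquiv (negQ r s)), IsReordering B D ∧
      (∀ x, A x ∈ AddSubgroup.closure (Set.range e₂) ↔
        x ∈ AddSubgroup.closure (Set.range e₁)) ∧
      ∀ z u v, b (J (gen (D z)) (A u)) (A v) = b (J (gen z) u) v := by
  obtain ⟨C, hC, hhat, hiso⟩ :=
    exists_reordering_isotropy hB h₁.vector_ne_zero h₂.vector_ne_zero hC hhat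
  obtain ⟨A, hA⟩ := h₁.exists_orbit_map hB hiso
  have hAG : ∀ τ ∈ G B, ∀ x, A (J (τ : Cl r s) x) = J (extend C τ : Cl r s) (A x) :=
    fun τ hτ x => h₁.orbit_map_act hA hτ x
  have hAz : ∀ i x, A (J (gen (B i)) x) = J (gen (C (B i))) (A x) := fun i x => by
    have := hAG _ (zU_mem_G hB i) x
    rwa [zU_val, extend_val, zU_val, map_apply_ι] at this
  have hAJ : ∀ z x, A (J (gen z) x) = J (gen (C z)) (A x) := fun z x =>
    act_linear_ext (B := B)
      (f := A ∘ₗ ((LinearMap.applyₗ x).comp J.toLinearMap).comp gen)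
      (g := (((LinearMap.applyₗ (A x)).comp J.toLinearMap).comp gen) ∘ₗ
        C.toLinearEquiv.toLinearMap)
      (fun i => by simpa using hAz i x) z
  obtain ⟨c, hc⟩ : ∃ c, b v₂ v₂ = signed c (b v₁ v₁) := by
    rcases h₁.unit_vector with h3 | h3 <;> rcases h₂.unit_vector with h4 | h4 <;> rw [h3, h4]
    · exact ⟨0, by simp⟩
    · exact ⟨1, by simp⟩
    · exact ⟨1, by simp⟩
    · exact ⟨0, by simp⟩
  have hA1 : A v₁ = v₂ := by simpa using hA 1 (one_mem _)
  have hskew : ∀ z x y, b (J (gen z) x) y = -b x (J (gen z) y) := fun z x y => by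
    have := h.skew z x y
    linarith
  -- `A` preserves the form up to a sign, since it does so on the orbit
  have hform : ∀ x y, b (A x) (A y) = signed c (b x y) := by
    have h5 : ∀ σ ∈ G B, ∀ y, b (A (J (σ : Cl r s) v₁)) (A y) =
        signed c (b (J (σ : Cl r s) v₁) y) := by
      refine G_induction hB ?_ ?_ ?_
      · have h6 : b v₂ ∘ₗ A = signed c (b v₁) := by
          refine h₁.ext_act fun τ hτ => ?_
          rw [LinearMap.comp_apply, hA τ hτ]
          have h7 : (signed c (b v₁)) (J (τ : Cl r s) v₁) =
              signed c (b v₁ (J (τ : Cl r s) v₁)) := by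
            rcases zmod_two_cases c with rfl | rfl <;> simp
          rw [h7]
          have hG := extend_mem_G hB hC τ hτ
          rcases h₁.eq_signed_or_form_eq_zero hB hτ with ⟨a, ha⟩ | h0
          · have h8 : signed a τ ∈ isotropy B J v₁ :=
              ⟨signed_mem_G hτ a, by rw [act_signed, ha, signed_signed]⟩
            have h9 := hiso _ h8
            rw [extend_signed, act_signed] at h9
            have h10 : J (extend C τ : Cl r s) v₂ = signed a v₂ := by
              conv_rhs => rw [← h9]
              rw [signed_signed]
            rw [h10, ha, form_signed_right, form_signed_right, hc, signed_comm]
          · rw [h0]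
            rcases h₂.eq_signed_or_form_eq_zero hB hG with ⟨a, ha⟩ | h0'
            · exfalso
              have h8 : extend C τ ∈ hat (isotropy B J v₂) := mem_hat_isotropy.mpr ⟨hG, a, ha⟩
              rw [← hhat] at h8
              obtain ⟨σ, hσ, hστ⟩ := h8
              obtain ⟨hσG, d, hd⟩ := mem_hat_isotropy.mp hσ
              have h9 : σ = τ := by
                have hinj : Function.Injective (CliffordAlgebra.map C.toIsometry) := by
                  refine Function.LeftInverse.injective
                    (g := CliffordAlgebra.map C.symm.toIsometry) fun u => ?_
                  rw [← AlgHom.comp_apply, map_comp_map]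
                  have : C.symm.toIsometry.comp C.toIsometry = QuadraticMap.Isometry.id _ := by
                    ext1 z; exact C.toLinearEquiv.symm_apply_apply z
                  rw [this, map_id]; rfl
                exact Units.ext (hinj (congrArg Units.val hστ))
              rw [h9] at hd
              rw [hd, form_signed_right] at h0
              have hne := h₁.form_self_ne_zero
              rcases signed_eq_or d (b v₁ v₁) with h10 | h10 <;> rw [h10] at h0
              · exact hne h0
              · exact hne (neg_eq_zero.mp h0)
            · rw [h0']; simp [signed]
        intro y
        have h7 := LinearMap.congr_fun h6 y
        have h8 : (signed c (b v₁)) y = signed c (b v₁ y) := by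
          rcases zmod_two_cases c with rfl | rfl <;> simp
        rw [h8] at h7
        simpa [hA1] using h7
      · intro σ _ ih y
        simpa [signed_neg] using ih y
      · intro i σ _ ih y
        rw [act_mul, zU_val, hAJ, hskew, hskew, ← hAJ, ih, signed_neg]
    intro x y
    have h6 : b.flip (A y) ∘ₗ A = signed c (b.flip y) := by
      refine h₁.ext_act fun σ hσ => ?_
      have h7 : (signed c (b.flip y)) (J (σ : Cl r s) v₁) =
          signed c (b (J (σ : Cl r s) v₁) y) := by
        rcases zmod_two_cases c with rfl | rfl <;> simp
      rw [h7]
      simpa using h5 σ hσ y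
    have h7 := LinearMap.congr_fun h6 x
    have h8 : (signed c (b.flip y)) x = signed c (b x y) := by
      rcases zmod_two_cases c with rfl | rfl <;> simp
    rw [h8] at h7
    simpa using h7
  have hinj : Function.Injective A := by
    rw [← LinearMap.ker_eq_bot, LinearMap.ker_eq_bot']
    intro x hx
    refine h.nondegenerate.1 x fun y => ?_
    have h5 := hform x y
    rw [hx, map_zero, LinearMap.zero_apply] at h5
    rw [← signed_signed c (b x y), ← h5]; simp [signed]
  let A' : V ≃ₗ[ℝ] V := LinearEquiv.ofInjectiveEndo A hinj
  have hA' : ∀ x, A' x = A x := fun x => rfl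
  have hmap : ∀ x ∈ AddSubgroup.closure (Set.range e₁),
      A x ∈ AddSubgroup.closure (Set.range e₂) := by
    intro x hx
    induction hx using AddSubgroup.closure_induction with
    | mem x hx =>
      obtain ⟨i, rfl⟩ := hx
      obtain ⟨σ, hσ, hi⟩ := h₁.exists_eq i
      rw [hi, hA σ hσ]
      exact h₂.act_mem_lattice hB (extend_mem_G hB hC σ hσ)
    | zero => rw [map_zero]; exact zero_mem _
    | add x y _ _ h1 h2 => rw [map_add]; exact add_mem h1 h2
    | neg x _ h1 => rw [map_neg]; exact neg_mem h1
  have hmap' : ∀ y ∈ AddSubgroup.closure (Set.range e₂),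
      ∃ x ∈ AddSubgroup.closure (Set.range e₁), A x = y := by
    intro y hy
    induction hy using AddSubgroup.closure_induction with
    | mem y hy =>
      obtain ⟨i, rfl⟩ := hy
      obtain ⟨τ, hτ, hi⟩ := h₂.exists_eq i
      obtain ⟨σ, hσ, rfl⟩ := extend_surjOn_G hB hC τ hτ
      exact ⟨_, h₁.act_mem_lattice hB hσ, by rw [hA σ hσ, hi]⟩
    | zero => exact ⟨0, zero_mem _, map_zero _⟩
    | add x y _ _ h1 h2 =>
      obtain ⟨x', hx', rfl⟩ := h1
      obtain ⟨y', hy', rfl⟩ := h2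
      exact ⟨x' + y', add_mem hx' hy', map_add _ _ _⟩
    | neg x _ h1 =>
      obtain ⟨x', hx', rfl⟩ := h1
      exact ⟨-x', neg_mem hx', map_neg _ _⟩
  -- the sign of `A` on the form is absorbed by the re-ordering
  refine ⟨A', C.trans (flip hB fun _ => c), hC.trans (isReordering_signedPerm hB _ _ _),
    fun x => ⟨fun hx => ?_, hmap x⟩, fun z x y => ?_⟩
  · obtain ⟨x', hx', h5⟩ := hmap' _ hx
    rwa [← hinj h5]
  · have h5 : ∀ z, flip hB (fun _ => c) z = signed c z := fun z => by
      have h6 : (flip hB fun _ => c).toLinearEquiv.toLinearMap =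
          (signed c LinearMap.id : RS r s →ₗ[ℝ] RS r s) := by
        refine B.ext fun i => ?_
        have h7 : (signed c LinearMap.id : RS r s →ₗ[ℝ] RS r s) (B i) = signed c (B i) := by
          rcases zmod_two_cases c with rfl | rfl <;> simp
        rw [h7]
        exact signedPerm_apply hB _ _ _ i
      have h7 := LinearMap.congr_fun h6 z
      have h8 : (signed c LinearMap.id : RS r s →ₗ[ℝ] RS r s) z = signed c z := by
        rcases zmod_two_cases c with rfl | rfl <;> simp
      rw [h8] at h7
      exact h7
    have h6 : (C.trans (flip hB fun _ => c)) z = signed c (C z) := h5 (C z)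
    have h7 : ∀ x, J (signed c (gen (C z))) x = signed c (J (gen (C z)) x) := fun x => by
      rcases zmod_two_cases c with rfl | rfl <;> simp
    rw [h6, map_signed gen, h7, form_signed_left, hA', hA', ← hAJ, hform, signed_signed]

theorem isomorphicByReordering_of_equivalent [FiniteDimensional ℝ V] (hB : IsOrthonormalBasis B)
    (hV : IsAdmissible J b) {S₁ S₂ : Subgroup (Cl r s)ˣ}
    {κ₁ κ₂ : Type*} {e₁ : Module.Basis κ₁ ℝ V} {e₂ : Module.Basis κ₂ ℝ V}
    (he₁ : IsBasisOf B J b S₁ e₁) (he₂ : IsBasisOf B J b S₂ e₂) (h : Equivalent B S₁ S₂) :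
    IsomorphicByReordering B (integralStructure hB hV he₁.toIsInvariantBasis)
      (integralStructure hB hV he₂.toIsInvariantBasis) := by
  obtain ⟨C₀, hC₀, hhat⟩ := h
  obtain ⟨v₁, h₁, hat₁⟩ := exists_orbitBasis he₁
  obtain ⟨v₂, h₂, hat₂⟩ := exists_orbitBasis he₂
  rw [← hat₁, ← hat₂] at hhat
  obtain ⟨A, C, hC, hlat, hform⟩ := exists_intertwine_of_equivalent hB hV h₁ h₂ hC₀ hhat
  have hscal : ∀ x y : RS r s, (∀ z, scal z x = scal z y) → x = y := by
    intro x y hxy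
    rw [eq_sum_scal hB x, eq_sum_scal hB y]
    exact Finset.sum_congr rfl fun k _ => by rw [hxy]
  have hbr : ∀ u v, C (bracketV J b u v) = bracketV J b (A u) (A v) := fun u v =>
    hscal _ _ fun z => by
      obtain ⟨z, rfl⟩ := C.toLinearEquiv.surjective z
      show scal (C z) _ = scal (C z) _
      rw [scal_isometry, scal_bracketV, scal_bracketV, hform]
  have hCmem : ∀ z, C z ∈ AddSubgroup.closure (Set.range B) ↔
      z ∈ AddSubgroup.closure (Set.range B) := by
    have hC' := hC
    rw [isReordering_iff] at hC'
    have hCm : ∀ z ∈ AddSubgroup.closure (Set.range B),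
        C z ∈ AddSubgroup.closure (Set.range B) := by
      intro z hz
      induction hz using AddSubgroup.closure_induction with
      | mem z hz =>
        obtain ⟨i, rfl⟩ := hz
        obtain ⟨j, a, hj⟩ := hC' i
        rw [hj]
        exact signed_mem (AddSubgroup.subset_closure (Set.mem_range_self j)) a
      | zero => rw [map_zero]; exact zero_mem _
      | add x y _ _ h1 h2 => rw [map_add]; exact add_mem h1 h2
      | neg x _ h1 => rw [map_neg]; exact neg_mem h1
    refine fun z => ⟨fun hz => ?_, hCm z⟩
    -- integrality of the coordinates of `z`, read off from those of `C z`
    rw [eq_sum_scal hB z]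
    refine sum_mem fun k _ => ?_
    obtain ⟨j, a, hj⟩ := hC' k
    obtain ⟨n, hn⟩ := exists_int_repr B hz j
    have h1 : scal (B k) z = signed a (scal (B j) (C z)) := by
      rw [← scal_isometry C, hj, scal_signed_left]
    have h2 : scal (B j) (C z) = sgn r s j * n := by
      rw [scal_comm]
      conv_lhs => rw [← B.sum_repr (C z)]
      rw [scal_sum_left, Finset.sum_eq_single j]
      · rw [hB, if_pos rfl, hn, mul_comm]
      · intro i _ hi; rw [hB, if_neg hi, mul_zero]
      · simp
    have hsg : ∀ k, ∃ n : ℤ, sgn r s k = n := by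
      rintro (k | k)
      · exact ⟨1, by simp [sgn]⟩
      · exact ⟨-1, by simp [sgn]⟩
    obtain ⟨m, hm⟩ := hsg k
    obtain ⟨l, hl⟩ := hsg j
    have h3 : ∃ t : ℤ, sgn r s k * scal (B k) z = t := by
      rw [h1, h2, hm, hl]
      rcases zmod_two_cases a with rfl | rfl
      · exact ⟨m * (l * n), by simp⟩
      · exact ⟨-(m * (l * n)), by simp⟩
    obtain ⟨t, ht⟩ := h3
    rw [ht, Int.cast_smul_eq_zsmul]
    exact zsmul_mem (AddSubgroup.subset_closure (Set.mem_range_self k)) t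
  let L₁ := integralStructure hB hV he₁.toIsInvariantBasis
  let L₂ := integralStructure hB hV he₂.toIsInvariantBasis
  let Ψ : (V × RS r s) ≃ₗ[ℝ] (V × RS r s) := LinearEquiv.prodCongr A C.toLinearEquiv
  let F : LieN hV → LieN hV := fun x => LieN.mk hV (A (LieN.fst hV x)) (C (LieN.snd hV x))
  have hF : ∀ x : LieN hV, F x ∈ L₂ ↔ x ∈ L₁ := fun x =>
    and_congr (hlat _) (hCmem _)
  have hFadd : ∀ x y, F (x + y) = F x + F y := fun x y => Ψ.map_add x y
  have hFsmul : ∀ (n : ℤ) x, F (n • x) = n • F x := fun n x => map_zsmul Ψ n x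
  have hFbij : Function.Bijective F := Ψ.bijective
  have hFlie : ∀ x y, F ⁅x, y⁆ = ⁅F x, F y⁆ := fun x y =>
    Prod.ext (map_zero A) (hbr _ _)
  let φ : L₁ →ₗ⁅ℤ⁆ L₂ :=
    { toFun := fun x => ⟨F x, (hF x).mpr x.2⟩
      map_add' := fun x y => Subtype.ext (hFadd x y)
      map_smul' := fun n x => Subtype.ext (hFsmul n x)
      map_lie' := fun {x y} => Subtype.ext (hFlie x y) }
  have hφ : Function.Bijective φ := by
    constructor
    · intro x y hxy
      exact Subtype.ext (hFbij.1 (congrArg Subtype.val hxy))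
    · rintro ⟨y, hy⟩
      obtain ⟨x, rfl⟩ := hFbij.2 y
      exact ⟨⟨x, (hF x).mp hy⟩, rfl⟩
  exact ⟨LieEquiv.ofBijective φ hφ, A, C, hC, fun x => rfl⟩

end Construct

/-! ### Isomorphisms over the integers in the definite case -/

section Definite

variable {r s : ℕ} {B : Module.Basis (Fin r ⊕ Fin s) ℝ (RS r s)}
  {V : Type*} [AddCommGroup V] [Module ℝ V]
  {J : Cl r s →ₐ[ℝ] Module.End ℝ V} {b : LinearMap.BilinForm ℝ V}

theorem act_gen_injective (hB : IsOrthonormalBasis B) (k : Fin r ⊕ Fin s) {x : V}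
    (hx : J (gen (B k)) x = 0) : x = 0 := by
  rw [← act_inv_act (J := J) (zU hB k) x, zU_val, hx, map_zero]

theorem eq_zero_of_bracketV_eq_zero (hB : IsOrthonormalBasis B) (h : IsAdmissible J b)
    (k : Fin r ⊕ Fin s) {κ : Type*} (e : Module.Basis κ ℝ V) {x : V}
    (hx : ∀ j, bracketV J b x (e j) = 0) : x = 0 := by
  apply act_gen_injective (J := J) hB k
  have h1 : b (J (gen (B k)) x) = 0 := e.ext fun j => by
    rw [← scal_bracketV, hx]
    simp [scal]
  exact h.nondegenerate.1 _ fun y => by rw [h1]; rfl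

theorem isIntegral_scal (hB : IsOrthonormalBasis B) {z : RS r s}
    (hz : z ∈ AddSubgroup.closure (Set.range B)) (j : Fin r ⊕ Fin s) :
    ∃ n : ℤ, scal (B j) z = n := by
  induction hz using AddSubgroup.closure_induction with
  | mem z hz =>
    obtain ⟨k, rfl⟩ := hz
    rw [hB]
    rcases j with j | j
    · split_ifs
      · exact ⟨1, by simp [sgn]⟩
      · exact ⟨0, by simp⟩
    · split_ifs
      · exact ⟨-1, by simp [sgn]⟩
      · exact ⟨0, by simp⟩
  | zero => exact ⟨0, by simp [scal]⟩
  | add x y _ _ h1 h2 =>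
    obtain ⟨m, hm⟩ := h1
    obtain ⟨n, hn⟩ := h2
    refine ⟨m + n, ?_⟩
    rw [← scalForm_apply, map_add, scalForm_apply, scalForm_apply, hm, hn]; simp
  | neg x _ h1 =>
    obtain ⟨m, hm⟩ := h1
    refine ⟨-m, ?_⟩
    rw [← scalForm_apply, map_neg, scalForm_apply, hm]; simp

/-- An isomorphism of invariant integral structures induces linear maps of `V` and of the
center. -/
theorem exists_linear_of_lieEquiv (hB : IsOrthonormalBasis B) (h : IsAdmissible J b)
    (k₀ : Fin r ⊕ Fin s) {κ₁ κ₂ : Type*} {e₁ : Module.Basis κ₁ ℝ V} {e₂ : Module.Basis κ₂ ℝ V}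
    (he₁ : IsInvariantBasis B J b e₁) (he₂ : IsInvariantBasis B J b e₂)
    (Φ : integralStructure hB h he₁ ≃ₗ⁅ℤ⁆ integralStructure hB h he₂) :
    ∃ (A : V →ₗ[ℝ] V) (C : RS r s →ₗ[ℝ] RS r s),
      (∀ x : integralStructure hB h he₁, LieN.fst h (Φ x) = A (LieN.fst h x)) ∧
      (∀ x : integralStructure hB h he₁, LieN.fst h x = 0 →
        LieN.snd h (Φ x) = C (LieN.snd h x)) := by
  have hlie₁ : ∀ x y : integralStructure hB h he₁,
      ((⁅x, y⁆ : integralStructure hB h he₁) : LieN h) =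
      ⁅(x : LieN h), (y : LieN h)⁆ := fun x y => rfl
  -- the elements with component zero in `V` are central, so their images are central
  have hcen : ∀ x : integralStructure hB h he₁, LieN.fst h x = 0 → LieN.fst h (Φ x) = 0 := by
    intro x hx
    refine eq_zero_of_bracketV_eq_zero hB h k₀ e₂ fun j => ?_
    let y : integralStructure hB h he₂ :=
      ⟨LieN.mk _ (e₂ j) 0, AddSubgroup.subset_closure ⟨j, rfl⟩, zero_mem _⟩
    have h1 := Φ.map_lie x (Φ.symm y)
    rw [LieEquiv.apply_symm_apply] at h1
    have h2 : ⁅x, Φ.symm y⁆ = 0 := by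
      apply Subtype.ext
      rw [hlie₁, LieN.lie_def, hx, bracketV_zero_left]; rfl
    rw [h2, map_zero] at h1
    have h3 := congrArg (fun z : integralStructure hB h he₂ => LieN.snd h z) h1
    exact h3.symm
  have hmul : ∀ u (hu : u ∈ AddSubgroup.closure (Set.range e₁)),
      LieN.fst h (Φ ⟨LieN.mk h u 0, hu, zero_mem _⟩) =
        e₁.constr ℝ (fun i => LieN.fst h
          (Φ ⟨LieN.mk h (e₁ i) 0, AddSubgroup.subset_closure ⟨i, rfl⟩, zero_mem _⟩)) u := by
    intro u hu
    induction hu using AddSubgroup.closure_induction with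
    | mem u hu => obtain ⟨i, rfl⟩ := hu; rw [Module.Basis.constr_basis]
    | zero => rw [map_zero]; exact hcen _ rfl
    | add u v hu hv h1 h2 =>
      rw [map_add, ← h1, ← h2]
      have : (⟨LieN.mk h (u + v) 0, add_mem hu hv, zero_mem _⟩ : integralStructure hB h he₁) =
          ⟨LieN.mk h u 0, hu, zero_mem _⟩ + ⟨LieN.mk h v 0, hv, zero_mem _⟩ :=
        Subtype.ext (Prod.ext rfl (add_zero 0).symm)
      rw [this, map_add]; rfl
    | neg u hu h1 =>
      rw [map_neg, ← h1]
      have : (⟨LieN.mk h (-u) 0, neg_mem hu, zero_mem _⟩ : integralStructure hB h he₁) =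
          -⟨LieN.mk h u 0, hu, zero_mem _⟩ :=
        Subtype.ext (Prod.ext rfl neg_zero.symm)
      rw [this, map_neg]; rfl
  have hmulC : ∀ z (hz : z ∈ AddSubgroup.closure (Set.range B)),
      LieN.snd h (Φ ⟨LieN.mk h 0 z, zero_mem _, hz⟩) =
        B.constr ℝ (fun i => LieN.snd h
          (Φ ⟨LieN.mk h 0 (B i), zero_mem _, AddSubgroup.subset_closure ⟨i, rfl⟩⟩)) z := by
    intro z hz
    induction hz using AddSubgroup.closure_induction with
    | mem z hz => obtain ⟨i, rfl⟩ := hz; rw [Module.Basis.constr_basis]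
    | zero =>
      rw [map_zero]
      have : (⟨LieN.mk h 0 0, zero_mem _, zero_mem _⟩ : integralStructure hB h he₁) = 0 := rfl
      rw [this, map_zero]; rfl
    | add u v hu hv h1 h2 =>
      rw [map_add, ← h1, ← h2]
      have : (⟨LieN.mk h 0 (u + v), zero_mem _, add_mem hu hv⟩ : integralStructure hB h he₁) =
          ⟨LieN.mk h 0 u, zero_mem _, hu⟩ + ⟨LieN.mk h 0 v, zero_mem _, hv⟩ :=
        Subtype.ext (Prod.ext (add_zero 0).symm rfl)
      rw [this, map_add]; rfl
    | neg u hu h1 =>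
      rw [map_neg, ← h1]
      have : (⟨LieN.mk h 0 (-u), zero_mem _, neg_mem hu⟩ : integralStructure hB h he₁) =
          -⟨LieN.mk h 0 u, zero_mem _, hu⟩ :=
        Subtype.ext (Prod.ext neg_zero.symm rfl)
      rw [this, map_neg]; rfl
  refine ⟨e₁.constr ℝ fun i => LieN.fst h
      (Φ ⟨LieN.mk h (e₁ i) 0, AddSubgroup.subset_closure ⟨i, rfl⟩, zero_mem _⟩),
    B.constr ℝ fun i => LieN.snd h
      (Φ ⟨LieN.mk h 0 (B i), zero_mem _, AddSubgroup.subset_closure ⟨i, rfl⟩⟩),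
    fun x => ?_, fun x hx => ?_⟩
  · rw [← hmul _ x.2.1]
    have h1 : x = ⟨LieN.mk h (LieN.fst h x) 0, x.2.1, zero_mem _⟩ +
        ⟨LieN.mk h 0 (LieN.snd h x), zero_mem _, x.2.2⟩ :=
      Subtype.ext (Prod.ext (add_zero _).symm (zero_add _).symm)
    conv_lhs => rw [h1, map_add]
    exact (congrArg₂ (· + ·) rfl (hcen _ rfl)).trans (add_zero _)
  · rw [← hmulC _ x.2.2]
    congr 3
    exact Subtype.ext (Prod.ext hx rfl)

/-- The scalar product is positive definite if `s = 0`. -/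
theorem scal_self_eq_sum (hB : IsOrthonormalBasis B) (hs : s = 0) (z : RS r s) :
    scal z z = ∑ k, scal (B k) z ^ 2 := by
  subst hs
  conv_lhs => rw [eq_sum_scal hB z, scal_sum_left]
  refine Finset.sum_congr rfl fun k _ => ?_
  rw [← eq_sum_scal hB z]
  rcases k with k | k
  · simp [sgn]; ring
  · exact k.elim0

theorem scal_nonneg (hs : s = 0) (z : RS r s) : 0 ≤ scal z z := by
  subst hs
  refine Finset.sum_nonneg fun k _ => ?_
  rcases k with k | k
  · simp [sgn, mul_self_nonneg]
  · exact k.elim0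

theorem eq_of_scal_eq (hB : IsOrthonormalBasis B) {x y : RS r s}
    (h : ∀ k, scal (B k) x = scal (B k) y) : x = y := by
  rw [eq_sum_scal hB x, eq_sum_scal hB y]
  exact Finset.sum_congr rfl fun k _ => by rw [h]

/-- In the definite case, an integral vector of length one is a basis vector up to sign. -/
theorem eq_signed_basis_of_integral (hB : IsOrthonormalBasis B) (hs : s = 0) {z : RS r s}
    (hz : ∀ k, ∃ n : ℤ, scal (B k) z = n) (h1 : scal z z = 1) : ∃ j, z = B j ∨ z = -B j := by
  choose n hn using hz
  rw [scal_self_eq_sum hB hs] at h1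
  simp only [hn] at h1
  have h2 : ∑ k, n k ^ 2 = 1 := by exact_mod_cast h1
  obtain ⟨j, hj⟩ : ∃ j, n j ≠ 0 := by
    by_contra hc
    push Not at hc
    simp [hc] at h2
  have h3 : ∀ k, k ≠ j → n k = 0 := by
    intro k hk
    have h4 : n j ^ 2 + n k ^ 2 ≤ ∑ k, n k ^ 2 := by
      rw [← Finset.sum_pair (f := fun k => n k ^ 2) hk.symm]
      exact Finset.sum_le_sum_of_subset_of_nonneg (Finset.subset_univ _) fun _ _ _ => sq_nonneg _
    have h5 : 0 < n j ^ 2 := by positivity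
    have h6 : n k ^ 2 = 0 := by nlinarith [sq_nonneg (n k)]
    exact pow_eq_zero_iff (two_ne_zero) |>.mp h6
  have h4 : n j ^ 2 = 1 := by
    rw [← h2, Finset.sum_eq_single j (fun k _ hk => by rw [h3 k hk]; rfl) (by simp)]
  have hsg : sgn r s j = 1 := by
    subst hs
    rcases j with j | j
    · simp [sgn]
    · exact j.elim0
  refine ⟨j, ?_⟩
  have h5 : z = (n j : ℝ) • B j := by
    rw [eq_sum_scal hB z, Finset.sum_eq_single j]
    · rw [hsg, hn, one_mul]
    · intro k _ hk; rw [hn, h3 k hk]; simp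
    · simp
  rcases mul_self_eq_one_iff.mp ((sq (n j)).symm.trans h4) with h6 | h6
  · left; rw [h5, h6]; simp
  · right; rw [h5, h6]; simp

/-- The adjoint of a linear map for the scalar product. -/
theorem exists_scal_adjoint (hB : IsOrthonormalBasis B) (C : RS r s →ₗ[ℝ] RS r s) :
    ∃ D : RS r s →ₗ[ℝ] RS r s, ∀ z w, scal z (C w) = scal (D z) w := by
  let D : RS r s →ₗ[ℝ] RS r s :=
    ∑ k, ((sgn r s k) • ((scalForm r s).flip (C (B k)))).smulRight (B k)
  have hD : ∀ z, D z = ∑ k, (sgn r s k * scal z (C (B k))) • B k := fun z => by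
    simp [D]
  refine ⟨D, fun z w => ?_⟩
  have h1 : (scalForm r s z) ∘ₗ C = scalForm r s (D z) := by
    refine B.ext fun j => ?_
    rw [LinearMap.comp_apply, scalForm_apply, scalForm_apply, hD, scal_sum_left,
      Finset.sum_eq_single j]
    · rw [hB, if_pos rfl, mul_right_comm, sgn_mul_self, one_mul]
    · intro i _ hi; rw [hB, if_neg hi, mul_zero]
    · simp
  exact LinearMap.congr_fun h1 w

/-- In the definite case the map of the center induced by an isomorphism is conformal, as one sees
from the determinants of the operators `J_z`. -/
theorem exists_conformal_factor [FiniteDimensional ℝ V] (hB : IsOrthonormalBasis B) (hs : s = 0)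
    (h : IsAdmissible J b) (hpos : 0 < Module.finrank ℝ V) (k₀ : Fin r ⊕ Fin s)
    (A : V →ₗ[ℝ] V) (D : RS r s →ₗ[ℝ] RS r s)
    (hform : ∀ z u v, b (J (gen z) (A u)) (A v) = b (J (gen (D z)) u) v) (z : RS r s) :
    scal (D z) (D z) = scal (D (B k₀)) (D (B k₀)) * scal z z := by
  let A' : V →ₗ[ℝ] V := b.leftAdjointOfNondegenerate h.nondegenerate A
  have hA' : ∀ x y, b (A' x) y = b x (A y) :=
    LinearMap.BilinForm.isAdjointPairLeftAdjointOfNondegenerate b h.nondegenerate A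
  have h1 : ∀ z, J (gen (D z)) = A' * (J (gen z) * A) := fun z => by
    refine LinearMap.ext fun u => ?_
    rw [← sub_eq_zero]
    refine h.nondegenerate.1 _ fun v => ?_
    rw [map_sub, LinearMap.sub_apply, ← hform, Module.End.mul_apply, Module.End.mul_apply, hA',
      sub_self]
  have hdet : ∀ z, LinearMap.det (J (gen z)) ^ 2 = (-scal z z) ^ Module.finrank ℝ V := fun z => by
    rw [sq, ← map_mul, ← map_mul, ι_sq_scalar, negQ_apply, AlgHom.commutes,
      Algebra.algebraMap_eq_smul_one, LinearMap.det_smul, map_one, mul_one]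
  have h2 : ∀ z, scal (D z) (D z) ^ Module.finrank ℝ V =
      (LinearMap.det A' * LinearMap.det A) ^ 2 * scal z z ^ Module.finrank ℝ V := fun z => by
    have h3 := hdet (D z)
    rw [h1, map_mul, map_mul, mul_left_comm, mul_pow, hdet, neg_pow, neg_pow (scal (D z) (D z)),
      mul_assoc] at h3
    have h4 := mul_left_cancel₀ (pow_ne_zero _ (by norm_num)) h3
    rw [← h4]; ring
  have h3 := h2 (B k₀)
  have hk : scal (B k₀) (B k₀) = 1 := by
    subst hs
    rw [hB, if_pos rfl]
    rcases k₀ with k | k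
    · simp [sgn]
    · exact k.elim0
  rw [hk, one_pow, mul_one] at h3
  rw [← pow_left_inj₀ (scal_nonneg hs _) (mul_nonneg (scal_nonneg hs _) (scal_nonneg hs _))
    hpos.ne', mul_pow, h3, h2]

/-- An isomorphism of integral structures intertwines the forms `⟨J_z ·, ·⟩` through the adjoint
`D` of the map of the center, whose conformal factor is an integer. -/
theorem exists_adjoint_of_lieEquiv [FiniteDimensional ℝ V] (hB : IsOrthonormalBasis B) (hs : s = 0)
    (k₀ : Fin r ⊕ Fin s) (had : IsAdmissible J b) (hpos : 0 < Module.finrank ℝ V)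
    {κ κ' : Type*} {f : Module.Basis κ ℝ V} {f' : Module.Basis κ' ℝ V}
    (hf : IsInvariantBasis B J b f) (hf' : IsInvariantBasis B J b f')
    (Ψ : integralStructure hB had hf ≃ₗ⁅ℤ⁆ integralStructure hB had hf')
    (A : V →ₗ[ℝ] V) (C : RS r s →ₗ[ℝ] RS r s)
    (hA : ∀ x : integralStructure hB had hf, LieN.fst had (Ψ x) = A (LieN.fst had x))
    (hC : ∀ x : integralStructure hB had hf, LieN.fst had x = 0 →
        LieN.snd had (Ψ x) = C (LieN.snd had x)) :
    (∀ k, C (B k) ∈ AddSubgroup.closure (Set.range B)) ∧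
      ∃ D : RS r s →ₗ[ℝ] RS r s, (∀ z w, scal z (C w) = scal (D z) w) ∧
        (∀ z u v, b (J (gen z) (A u)) (A v) = b (J (gen (D z)) u) v) ∧
        ∃ m : ℤ, 0 ≤ m ∧ ∀ z, scal (D z) (D z) = m * scal z z := by
  have hint : ∀ k, C (B k) ∈ AddSubgroup.closure (Set.range B) := fun k => by
    have h1 := hC ⟨LieN.mk had 0 (B k), zero_mem _, AddSubgroup.subset_closure ⟨k, rfl⟩⟩ rfl
    have h2 := (Ψ ⟨LieN.mk had 0 (B k), zero_mem _, AddSubgroup.subset_closure ⟨k, rfl⟩⟩).2.2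
    rw [h1] at h2
    exact h2
  obtain ⟨D, hD⟩ := exists_scal_adjoint hB C
  have hform : ∀ z u v, b (J (gen z) (A u)) (A v) = b (J (gen (D z)) u) v := by
    refine form_eq_of_bracket_eq f A C D hD fun i j => ?_
    let x : ∀ i, integralStructure hB had hf := fun i =>
      ⟨LieN.mk _ (f i) 0, AddSubgroup.subset_closure ⟨i, rfl⟩, zero_mem _⟩
    have h2 := congrArg Subtype.val (Ψ.map_lie (x i) (x j))
    have h3 := congrArg (LieN.snd had) h2
    have h4 := hC ⁅x i, x j⁆ rfl
    rw [h4] at h3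
    refine h3.trans ?_
    show bracketV J b (LieN.fst had (Ψ (x i))) (LieN.fst had (Ψ (x j))) = _
    rw [hA, hA]; rfl
  refine ⟨hint, D, hD, hform, ?_⟩
  have hDint : ∀ k, ∃ n : ℤ, scal (B k) (D (B k₀)) = n := fun k => by
    obtain ⟨n, hn⟩ := isIntegral_scal hB (hint k) k₀
    exact ⟨n, by rw [scal_comm, ← hD, hn]⟩
  choose n hn using hDint
  refine ⟨∑ k, n k ^ 2, Finset.sum_nonneg fun _ _ => sq_nonneg _, fun z => ?_⟩
  rw [exists_conformal_factor hB hs had hpos k₀ A D hform z, scal_self_eq_sum hB hs (D (B k₀))]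
  simp only [hn]
  push_cast
  rfl

/-- In the definite case, integral structures that are isomorphic over the integers come from
equivalent groups. -/
theorem equivalent_of_isomorphic_definite [FiniteDimensional ℝ V] (hB : IsOrthonormalBasis B)
    (hs : s = 0) (k₀ : Fin r ⊕ Fin s)
    (hV : IsMinimalAdmissible J b)
    (hA : ∀ A ∈ groupA hV.admissible, ∀ u v, b (A u) (A v) = b u v)
    {S₁ S₂ : Subgroup (Cl r s)ˣ} (hS₁ : S₁ ≤ G B) (hS₂ : S₂ ≤ G B)
    {κ₁ κ₂ : Type*} {e₁ : Module.Basis κ₁ ℝ V} {e₂ : Module.Basis κ₂ ℝ V}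
    (he₁ : IsBasisOf B J b S₁ e₁) (he₂ : IsBasisOf B J b S₂ e₂)
    (h : Isomorphic (integralStructure hB hV.admissible he₁.toIsInvariantBasis)
        (integralStructure hB hV.admissible he₂.toIsInvariantBasis)) :
    Equivalent B S₁ S₂ := by
  obtain ⟨Φ⟩ := h
  have had := hV.admissible
  obtain ⟨A, C, hAΦ, hCΦ⟩ := exists_linear_of_lieEquiv hB had k₀ he₁.toIsInvariantBasis
    he₂.toIsInvariantBasis Φ
  obtain ⟨A', C', hAΦ', hCΦ'⟩ := exists_linear_of_lieEquiv hB had k₀ he₂.toIsInvariantBasis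
    he₁.toIsInvariantBasis Φ.symm
  obtain ⟨hint, D, hD, hform, m, hm, hconf⟩ := exists_adjoint_of_lieEquiv hB hs k₀ had
    hV.pos _ _ Φ A C hAΦ hCΦ
  obtain ⟨hint', D', hD', -, m', hm', hconf'⟩ := exists_adjoint_of_lieEquiv hB hs k₀ had
    hV.pos _ _ Φ.symm A' C' hAΦ' hCΦ'
  have hcen : ∀ x : integralStructure hB had he₁.toIsInvariantBasis, LieN.fst had x = 0 →
      LieN.fst had (Φ x) = 0 := fun x hx => by rw [hAΦ, hx, map_zero]
  have hA'A : ∀ x, A' (A x) = x := by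
    have : A' ∘ₗ A = LinearMap.id := e₁.ext fun i => by
      let x : integralStructure hB had he₁.toIsInvariantBasis :=
        ⟨LieN.mk _ (e₁ i) 0, AddSubgroup.subset_closure ⟨i, rfl⟩, zero_mem _⟩
      have h1 := hAΦ' (Φ x)
      rw [hAΦ, LieEquiv.symm_apply_apply] at h1
      exact h1.symm
    exact LinearMap.congr_fun this
  have hC'C : ∀ z, C' (C z) = z := by
    have : C' ∘ₗ C = LinearMap.id := B.ext fun i => by
      let x : integralStructure hB had he₁.toIsInvariantBasis :=
        ⟨LieN.mk _ 0 (B i), zero_mem _, AddSubgroup.subset_closure ⟨i, rfl⟩⟩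
      have h1 := hCΦ' (Φ x) (hcen x rfl)
      rw [hCΦ x rfl, LieEquiv.symm_apply_apply] at h1
      exact h1.symm
    exact LinearMap.congr_fun this
  have hDD' : ∀ z, D (D' z) = z := fun z => eq_of_scal_eq hB fun k => by
    rw [scal_comm, ← hD, ← hD', hC'C, scal_comm]
  -- the conformal factors are inverse integers
  have hm1 : m = 1 := by
    have h1 := hconf (D' (B k₀))
    rw [hDD', hconf'] at h1
    have hk : scal (B k₀) (B k₀) ≠ 0 := by
      rw [hB, if_pos rfl]; intro h0
      have := sgn_mul_self (r := r) (s := s) k₀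
      rw [h0] at this; norm_num at this
    have h2 : ((m * m' : ℤ) : ℝ) = 1 := by
      apply mul_right_cancel₀ hk
      push_cast
      linarith
    have h3 : m * m' = 1 := by exact_mod_cast h2
    exact Int.eq_one_of_mul_eq_one_right hm h3
  have hDiso : ∀ z w, scal (D z) (D w) = scal z w := by
    intro z w
    have h1 : ∀ z, scal (D z) (D z) = scal z z := fun z => by rw [hconf, hm1]; simp
    have h2 := h1 (z + w)
    rw [map_add, scal_add_self, scal_add_self, h1, h1] at h2
    linarith
  have hCD : ∀ z, C (D z) = z := fun z => eq_of_scal_eq hB fun k => by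
    rw [hD, hDiso]
  have hCiso : ∀ z w, scal (C z) (C w) = scal z w := by
    have hDC : ∀ z, D (C z) = z := fun z => by
      have h1 : ∀ z, D z = C' z := fun z => by rw [← hC'C (D z), hCD]
      rw [h1, hC'C]
    intro z w
    rw [← hDiso, hDC, hDC]
  have hDC : ∀ z, D (C z) = z := fun z => eq_of_scal_eq hB fun k => by
    rw [scal_comm, ← hD, hCiso, scal_comm]
  let Ce : RS r s ≃ₗ[ℝ] RS r s :=
    LinearEquiv.ofLinearMap C D (LinearMap.ext hCD) (LinearMap.ext hDC)
  let Ci := isometryOfScal Ce hCiso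
  have hCi : ∀ z, Ci z = C z := fun z => rfl
  have hreo : IsReordering B Ci := fun i => by
    rw [hCi]
    refine eq_signed_basis_of_integral hB hs (isIntegral_scal hB (hint i)) ?_
    rw [hCiso]
    subst hs
    rw [hB, if_pos rfl]
    rcases i with k | k
    · simp [sgn]
    · exact k.elim0
  have hlat₁ : ∀ x ∈ AddSubgroup.closure (Set.range e₁),
      A x ∈ AddSubgroup.closure (Set.range e₂) := fun x hx => by
    have h1 := (Φ ⟨LieN.mk had x 0, hx, zero_mem _⟩).2.1
    rw [hAΦ] at h1
    exact h1
  have hlat₂ : ∀ x ∈ AddSubgroup.closure (Set.range e₂),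
      A' x ∈ AddSubgroup.closure (Set.range e₁) := fun x hx => by
    have h1 := (Φ.symm ⟨LieN.mk had x 0, hx, zero_mem _⟩).2.1
    rw [hAΦ'] at h1
    exact h1
  have hinj : Function.Injective A := Function.LeftInverse.injective hA'A
  refine equivalent_of_intertwine hB hV hA hS₁ hS₂ he₁ he₂ (LinearEquiv.ofInjectiveEndo A hinj) Ci
    hreo (fun x => ⟨fun hx => ?_, hlat₁ x⟩) (fun z u v => ?_)
  · have h1 := hlat₂ _ hx
    rw [← hA'A x]
    exact h1
  · exact (hform (C z) u v).trans (by rw [hDC])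

end Definite

/-! ### Extension of weight preserving maps of binary codes -/

section Extension

variable {ι : Type*} [Fintype ι]

theorem signed_eq_one_sub (a : ZMod 2) : signed a (1 : ℤ) = 1 - 2 * (a.val : ℤ) := by
  revert a; decide

theorem sum_signed_eq_card_sub (w : ι → ZMod 2) :
    ∑ i, signed (w i) (1 : ℤ) = Fintype.card ι - 2 * wt w := by
  simp only [signed_eq_one_sub, Finset.sum_sub_distrib, wt, Nat.cast_sum, Finset.mul_sum]
  simp

open Classical in
/-- The number of coordinates of a parametrized code `f` equal to a given functional `χ` is
determined by the weights, by orthogonality of characters. -/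
theorem card_mul_card_coordinate {T : Type*} [AddCommGroup T] [Fintype T]
    (f : T →+ (ι → ZMod 2)) (χ : T →+ ZMod 2) :
    (Fintype.card {i // (Pi.evalAddMonoidHom _ i).comp f = χ} : ℤ) * Fintype.card T =
      ∑ t, signed (χ t) (Fintype.card ι - 2 * wt (f t) : ℤ) := by
  simp only [← sum_signed_eq_card_sub]
  have h1 : ∀ t, signed (χ t) (∑ i, signed (f t i) (1 : ℤ)) =
      ∑ i, signed (f t i + χ t) (1 : ℤ) := fun t => by
    simp only [add_comm (f t _), signed_add]
    rcases zmod_two_cases (χ t) with h | h <;> simp [h]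
  simp only [h1]
  rw [Finset.sum_comm]
  have h2 : ∀ i, ∑ t, signed (f t i + χ t) (1 : ℤ) =
      if (Pi.evalAddMonoidHom _ i).comp f = χ then (Fintype.card T : ℤ) else 0 := fun i => by
    have h3 := sum_signed_addHom (⊤ : AddSubgroup T) (fun t => f t i + χ t) (fun u v => by
      simp only [map_add, Pi.add_apply]; ring)
    simp only [AddSubgroup.mem_top, Finset.filter_true, forall_true_left] at h3
    rw [h3]
    have h4 : (∀ t, f t i + χ t = 0) ↔ (Pi.evalAddMonoidHom _ i).comp f = χ := by
      rw [DFunLike.ext_iff]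
      exact forall_congr' fun t => CharTwo.add_eq_zero
    simp [h4, Nat.card_eq_fintype_card]
  simp only [h2, ← Finset.sum_filter, Finset.sum_const, nsmul_eq_mul, Fintype.card_subtype]

/-- The extension theorem of MacWilliams for binary codes: two parametrized codes with the same
weights differ by a permutation of the coordinates. -/
theorem exists_perm_of_wt_eq {T : Type*} [AddCommGroup T] [Finite T]
    (f g : T →+ (ι → ZMod 2)) (h : ∀ t, wt (f t) = wt (g t)) :
    ∃ π : Equiv.Perm ι, ∀ t i, g t (π i) = f t i := by
  classical
  have := Fintype.ofFinite T
  have h1 : ∀ χ : T →+ ZMod 2, Nonempty ({i // (Pi.evalAddMonoidHom _ i).comp f = χ} ≃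
      {i // (Pi.evalAddMonoidHom (fun _ => ZMod 2) i).comp g = χ}) := fun χ => by
    rw [← Fintype.card_eq]
    have h2 := card_mul_card_coordinate f χ
    simp only [h] at h2
    rw [← card_mul_card_coordinate g χ] at h2
    have h3 : (Fintype.card T : ℤ) ≠ 0 := by exact_mod_cast Fintype.card_ne_zero
    exact_mod_cast mul_right_cancel₀ h3 h2
  refine ⟨Equiv.ofFiberEquiv fun χ => (h1 χ).some, fun t i => ?_⟩
  exact DFunLike.congr_fun (Equiv.ofFiberEquiv_map (fun χ => (h1 χ).some) i) t

end Extension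

/-! ### Matching of binary codes -/

section Matching

variable {W A : Type*} [AddCommGroup W] [AddCommGroup A]

/-- Two finite codes of the same order, on which a homomorphism `ℓ` takes the same values, are
matched by an isomorphism which preserves `ℓ` and fixes the common words; the isomorphism is
given by its graph. -/
theorem exists_matching (h2 : ∀ w : W, w + w = 0) (C₁ C₂ : AddSubgroup W) [Finite C₁] [Finite C₂]
    (hcard : Nat.card C₁ = Nat.card C₂) (l : W →+ A) (hl₁ : ∀ u ∈ C₁, ∃ v ∈ C₂, l u = l v)
    (hl₂ : ∀ v ∈ C₂, ∃ u ∈ C₁, l v = l u) :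
    ∃ T : AddSubgroup (W × W), (∀ t ∈ T, t.1 ∈ C₁ ∧ t.2 ∈ C₂) ∧ (∀ t ∈ T, l t.1 = l t.2) ∧
      (∀ t ∈ T, t.1 = 0 ↔ t.2 = 0) ∧ (∀ w ∈ C₁, w ∈ C₂ → (w, w) ∈ T) ∧
      (∀ u ∈ C₁, ∃ v, (u, v) ∈ T) ∧ ∀ v ∈ C₂, ∃ u, (u, v) ∈ T := by
  classical
  let P : AddSubgroup (W × W) → Prop := fun T => T ≤ C₁.prod C₂ ∧ (∀ t ∈ T, l t.1 = l t.2) ∧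
      (∀ t ∈ T, t.1 = 0 ↔ t.2 = 0) ∧ ∀ w ∈ C₁, w ∈ C₂ → (w, w) ∈ T
  have hfin : Set.Finite {T : AddSubgroup (W × W) | T ≤ C₁.prod C₂} := by
    have : Finite (C₁.prod C₂) := Finite.of_equiv _ (AddSubgroup.prodEquiv C₁ C₂).symm.toEquiv
    have h3 : Set.Finite ((C₁.prod C₂ : AddSubgroup (W × W)) : Set (W × W)) := Set.toFinite _
    exact Set.Finite.of_injOn (f := fun T : AddSubgroup (W × W) => (T : Set (W × W)))
      (fun T hT => Set.mem_powerset hT) SetLike.coe_injective.injOn h3.finite_subsets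
  have hdiag : P ((C₁ ⊓ C₂).map ((AddMonoidHom.id W).prod (AddMonoidHom.id W))) := by
    refine ⟨?_, ?_, ?_, fun w h1 h2 => ⟨w, ⟨h1, h2⟩, rfl⟩⟩
    · rintro _ ⟨w, ⟨h1, h2⟩, rfl⟩; exact ⟨h1, h2⟩
    · rintro _ ⟨w, -, rfl⟩; rfl
    · rintro _ ⟨w, -, rfl⟩; rfl
  have hfinP : Set.Finite {T | P T} := hfin.subset fun T hT => hT.1
  obtain ⟨T, hT, hmax⟩ := hfinP.exists_maximal ⟨_, hdiag⟩
  obtain ⟨hle, hTl, hT0, hTd⟩ := hT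
  -- a pair of new words can be added to `T` if this does not spoil injectivity
  have hadd : ∀ u ∈ C₁, ∀ v ∈ C₂, l u = l v → (∀ t ∈ T, t.1 ≠ u ∧ t.2 ≠ v) → False := by
    intro u hu v hv huv hne
    have hneg : ∀ w : W, -w = w := fun w => neg_eq_of_add_eq_zero_left (h2 w)
    let T' : AddSubgroup (W × W) :=
      { carrier := {t | t ∈ T ∨ t + (u, v) ∈ T}
        zero_mem' := Or.inl (zero_mem _)
        add_mem' := by
          have h3 : (u, v) + (u, v) = (0 : W × W) := Prod.ext (h2 u) (h2 v)
          rintro x y (hx | hx) (hy | hy)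
          · exact Or.inl (add_mem hx hy)
          · right; rw [add_assoc]; exact add_mem hx hy
          · right; rw [add_right_comm]; exact add_mem hx hy
          · left
            have := add_mem hx hy
            rwa [add_add_add_comm, h3, add_zero] at this
        neg_mem' := by
          intro x hx
          rwa [show -x = x from Prod.ext (hneg _) (hneg _)] }
    have hsub : ∀ a c d : W, a + c = d → a = d + c := fun a c d h => by
      rw [← h, add_assoc, h2, add_zero]
    have hT' : P T' := by
      refine ⟨?_, ?_, ?_, fun w h1 h2 => Or.inl (hTd w h1 h2)⟩
      · rintro t (ht | ht)
        · exact hle ht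
        · have h3 := hle ht
          exact ⟨(add_mem_cancel_right hu).mp h3.1, (add_mem_cancel_right hv).mp h3.2⟩
      · rintro t (ht | ht)
        · exact hTl t ht
        · have h3 := hTl _ ht
          simp only [Prod.fst_add, Prod.snd_add, map_add, huv] at h3
          exact add_right_cancel h3
      · rintro t (ht | ht)
        · exact hT0 t ht
        · obtain ⟨h3, h4⟩ := hne _ ht
          constructor
          · intro h5; exact absurd (by simp [h5]) h3
          · intro h5; exact absurd (by simp [h5]) h4
    have h3 : (u, v) ∈ T := hmax hT' (fun t ht => Or.inl ht) (Or.inr (by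
      rw [show (u, v) + (u, v) = (0 : W × W) from Prod.ext (h2 u) (h2 v)]; exact zero_mem _))
    exact (hne _ h3).1 rfl
  have hinj : ∀ t ∈ T, ∀ t' ∈ T, t.1 = t'.1 ↔ t.2 = t'.2 := by
    intro t ht t' ht'
    have := hT0 _ (sub_mem ht ht')
    rwa [Prod.fst_sub, Prod.snd_sub, sub_eq_zero, sub_eq_zero] at this
  -- `T` takes all values of `l`
  have hval : ∀ u ∈ C₁, ∃ t ∈ T, l t.1 = l u := by
    intro u hu
    by_contra hc
    push Not at hc
    obtain ⟨v, hv, huv⟩ := hl₁ u hu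
    refine hadd u hu v hv huv fun t ht => ⟨fun h => hc t ht (by rw [h]), fun h => hc t ht ?_⟩
    rw [hTl t ht, h, huv]
  have hle₁ : T.map (AddMonoidHom.fst W W) ≤ C₁ := by
    rintro _ ⟨t, ht, rfl⟩; exact (hle ht).1
  have hle₂ : T.map (AddMonoidHom.snd W W) ≤ C₂ := by
    rintro _ ⟨t, ht, rfl⟩; exact (hle ht).2
  have hc₁ : Nat.card (T.map (AddMonoidHom.fst W W)) = Nat.card T :=
    Nat.card_image_of_injOn (f := Prod.fst) (s := (T : Set (W × W)))
      fun t ht t' ht' h => Prod.ext h ((hinj t ht t' ht').mp h)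
  have hc₂ : Nat.card (T.map (AddMonoidHom.snd W W)) = Nat.card T :=
    Nat.card_image_of_injOn (f := Prod.snd) (s := (T : Set (W × W)))
      fun t ht t' ht' h => Prod.ext ((hinj t ht t' ht').mpr h) h
  have hfull : T.map (AddMonoidHom.fst W W) = C₁ ∨ T.map (AddMonoidHom.snd W W) = C₂ := by
    by_contra hc
    push Not at hc
    obtain ⟨u, hu, hu'⟩ := SetLike.exists_of_lt (lt_of_le_of_ne hle₁ hc.1)
    obtain ⟨v, hv, hv'⟩ := SetLike.exists_of_lt (lt_of_le_of_ne hle₂ hc.2)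
    obtain ⟨u', hu'C, hvu'⟩ := hl₂ v hv
    obtain ⟨t, ht, htl⟩ := hval u hu
    obtain ⟨t', ht', htl'⟩ := hval u' hu'C
    refine hadd u hu (v + (t.2 - t'.2)) (add_mem hv (sub_mem (hle ht).2 (hle ht').2)) ?_ ?_
    · rw [map_add, map_sub, ← hTl t ht, ← hTl t' ht', htl, htl', ← hvu', add_sub_cancel]
    · refine fun x hx => ⟨fun h => hu' ⟨x, hx, h⟩, fun h => hv' ⟨x - (t - t'),
        sub_mem hx (sub_mem ht ht'), ?_⟩⟩
      show x.2 - (t.2 - t'.2) = v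
      rw [h, add_sub_cancel_right]
  have hfin₁ : (C₁ : Set W).Finite := Set.toFinite _
  have hfin₂ : (C₂ : Set W).Finite := Set.toFinite _
  have hboth : T.map (AddMonoidHom.fst W W) = C₁ ∧ T.map (AddMonoidHom.snd W W) = C₂ := by
    rcases hfull with h | h
    · refine ⟨h, ?_⟩
      apply SetLike.coe_injective
      refine Set.eq_of_subset_of_ncard_le hle₂ ?_ hfin₂
      show Nat.card C₂ ≤ Nat.card (T.map (AddMonoidHom.snd W W))
      rw [hc₂, ← hc₁, h, hcard]
    · refine ⟨?_, h⟩
      apply SetLike.coe_injective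
      refine Set.eq_of_subset_of_ncard_le hle₁ ?_ hfin₁
      show Nat.card C₁ ≤ Nat.card (T.map (AddMonoidHom.fst W W))
      rw [hc₁, ← hc₂, h, hcard]
  refine ⟨T, fun t ht => hle ht, hTl, hT0, hTd, fun u hu => ?_, fun v hv => ?_⟩
  · rw [← hboth.1] at hu
    obtain ⟨⟨x, y⟩, ht, rfl⟩ := hu
    exact ⟨y, ht⟩
  · rw [← hboth.2] at hv
    obtain ⟨⟨x, y⟩, ht, rfl⟩ := hv
    exact ⟨x, ht⟩

end Matching

/-! ### Weights of binary codes of small length -/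

section Weights

variable {ι : Type*} [Fintype ι]

theorem val_le_one (a : ZMod 2) : a.val ≤ 1 := Nat.le_of_lt_succ (ZMod.val_lt a)

theorem word_add_self {ι : Type*} (w : ι → ZMod 2) : w + w = 0 :=
  funext fun _ => CharTwo.add_self_eq_zero _

theorem wt_le_card (w : ι → ZMod 2) : wt w ≤ Fintype.card ι := by
  refine (Finset.sum_le_sum fun i _ => val_le_one (w i)).trans ?_
  simp

theorem wt_eq_zero {w : ι → ZMod 2} : wt w = 0 ↔ w = 0 := by
  simp [wt, Finset.sum_eq_zero_iff, funext_iff, ZMod.val_eq_zero]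

@[simp] theorem wt_one : wt (1 : ι → ZMod 2) = Fintype.card ι := by
  simp [wt, ZMod.val_one]

theorem wt_add_one (w : ι → ZMod 2) : wt (w + 1) + wt w = Fintype.card ι := by
  have := wt_add w 1
  rw [mul_one, wt_one] at this
  omega

theorem wt_mod_two (w : ι → ZMod 2) : wt w % 2 = (∑ i, w i).val := by
  rw [← wt_cast, ZMod.val_natCast]

theorem wt_triple_le (u v : ι → ZMod 2) : wt u + wt v + wt (u + v) ≤ 2 * Fintype.card ι := by
  have h1 : wt u + wt v ≤ wt (u * v) + Fintype.card ι := by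
    have : Fintype.card ι = ∑ _i : ι, 1 := by simp
    rw [wt, wt, wt, this, ← Finset.sum_add_distrib, ← Finset.sum_add_distrib]
    refine Finset.sum_le_sum fun i _ => ?_
    have : ∀ a b : ZMod 2, a.val + b.val ≤ (a * b).val + 1 := by decide
    exact this _ _
  have := wt_add u v
  omega

theorem wt_triple_lt {u v : ι → ZMod 2} {i₀ : ι} (hu : u i₀ = 0) (hv : v i₀ = 0) :
    wt u + wt v + wt (u + v) + 2 ≤ 2 * Fintype.card ι := by
  have h1 : wt u + wt v < wt (u * v) + Fintype.card ι := by
    have : Fintype.card ι = ∑ _i : ι, 1 := by simp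
    rw [wt, wt, wt, this, ← Finset.sum_add_distrib, ← Finset.sum_add_distrib]
    refine Finset.sum_lt_sum (fun i _ => ?_) ⟨i₀, Finset.mem_univ _, by simp [hu, hv]⟩
    have : ∀ a b : ZMod 2, a.val + b.val ≤ (a * b).val + 1 := by decide
    exact this _ _
  have := wt_add u v
  omega

theorem wt_cases {w : ι → ZMod 2} (hn : Fintype.card ι ≤ 7) (h : ctwo w = ∑ i, w i) :
    wt w = 0 ∨ wt w = 3 ∨ wt w = 4 ∨ wt w = 7 := by
  have h1 := (wt_le_card w).trans hn
  rw [ctwo, ← wt_cast] at h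
  generalize wt w = n at *
  revert h
  interval_cases n <;> decide

theorem exists_pair_of_card {C : AddSubgroup (ι → ZMod 2)} (h : 2 < Nat.card C) :
    ∃ u ∈ C, ∃ v ∈ C, u ≠ 0 ∧ v ≠ 0 ∧ u + v ≠ 0 := by
  classical
  have h1 : 2 < (Finset.univ.filter (· ∈ C)).card := by
    rwa [Nat.card_eq_fintype_card, Fintype.card_subtype] at h
  obtain ⟨a, b, c, ha, hb, hc, hab, hac, hbc⟩ := Finset.two_lt_card_iff.mp h1
  simp only [Finset.mem_filter, Finset.mem_univ, true_and] at ha hb hc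
  refine ⟨a - b, sub_mem ha hb, a - c, sub_mem ha hc, sub_ne_zero.mpr hab, sub_ne_zero.mpr hac, ?_⟩
  intro h2
  apply hbc
  have h3 : a - b = a - c := by
    rw [eq_sub_of_add_eq h2, zero_sub]
    exact neg_eq_of_add_eq_zero_left (word_add_self _)
  exact sub_right_injective h3

theorem exists_pair_vanishing {C : AddSubgroup (ι → ZMod 2)} (h : 4 < Nat.card C) (i₀ : ι) :
    ∃ u ∈ C, ∃ v ∈ C, u ≠ 0 ∧ v ≠ 0 ∧ u + v ≠ 0 ∧ u i₀ = 0 ∧ v i₀ = 0 := by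
  let D : AddSubgroup (ι → ZMod 2) := C ⊓ (Pi.evalAddMonoidHom (fun _ : ι => ZMod 2) i₀).ker
  have h1 : 2 < Nat.card D := by
    classical
    obtain ⟨y, -, hy⟩ := Finset.exists_lt_card_fiber_of_mul_lt_card_of_maps_to
      (s := Finset.univ.filter (· ∈ C)) (t := (Finset.univ : Finset (ZMod 2)))
      (f := fun w => w i₀) (n := 2) (fun _ _ => Finset.mem_univ _) (by
        rw [Nat.card_eq_fintype_card, Fintype.card_subtype] at h
        simpa [ZMod.card] using h)
    obtain ⟨w₀, hw₀⟩ := Finset.card_pos.mp (lt_of_le_of_lt (Nat.zero_le _) hy)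
    refine hy.trans_le ?_
    rw [Nat.card_eq_fintype_card, Fintype.card_subtype]
    simp only [Finset.mem_filter, Finset.mem_univ, true_and] at hw₀
    refine Finset.card_le_card_of_injOn (fun w => w - w₀) (fun w hw => ?_)
      fun x _ y _ h => sub_left_injective h
    simp only [Finset.coe_filter, Finset.mem_filter, Finset.mem_univ, true_and,
      Set.mem_ofPred_eq] at hw ⊢
    exact ⟨C.sub_mem hw.1 hw₀.1, by simp [hw.2, hw₀.2]⟩
  obtain ⟨u, hu, v, hv, h2, h3, h4⟩ := exists_pair_of_card h1
  exact ⟨u, hu.1, v, hv.1, h2, h3, h4, hu.2, hv.2⟩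

end Weights

/-! ### Uniqueness of the maximal codes of small length -/

section Classification

variable {r s : ℕ}

/-- The weight of a word on the positive basis vectors. -/
def posWt (w : Fin r ⊕ Fin s → ZMod 2) : ℕ := wt (w ∘ Sum.inl)

/-- The weight of a word on the negative basis vectors. -/
def negWt (w : Fin r ⊕ Fin s → ZMod 2) : ℕ := wt (w ∘ Sum.inr)

theorem wt_eq_posWt_add_negWt (w : Fin r ⊕ Fin s → ZMod 2) : wt w = posWt w + negWt w := by
  simp [wt, posWt, negWt, Fintype.sum_sum_type]

theorem posWt_le (w : Fin r ⊕ Fin s → ZMod 2) : posWt w ≤ r := by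
  exact (wt_le_card (w ∘ Sum.inl)).trans (by simp)

theorem negWt_le (w : Fin r ⊕ Fin s → ZMod 2) : negWt w ≤ s := by
  exact (wt_le_card (w ∘ Sum.inr)).trans (by simp)

/-- The properties of the code of a group of positive involutions that is the isotropy group of a
vector of a minimal admissible module. -/
structure IsMaximalCode (C : AddSubgroup (Fin r ⊕ Fin s → ZMod 2)) : Prop where
  ctwo_eq : ∀ w ∈ C, ctwo w = ∑ i, w i
  negPar_eq : ∀ w ∈ C, negPar w = 0
  maximal : ∀ w, (∀ u ∈ C, beta u w = 0) → negPar w = 0 → ctwo w = ∑ i, w i → w ∈ C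

variable {C C₁ C₂ : AddSubgroup (Fin r ⊕ Fin s → ZMod 2)}

theorem IsMaximalCode.even_negWt (hC : IsMaximalCode C) {w : Fin r ⊕ Fin s → ZMod 2}
    (hw : w ∈ C) : negWt w % 2 = 0 := by
  rw [negWt, wt_mod_two]
  exact congrArg ZMod.val (hC.negPar_eq w hw)

/-- The word of the product of all positive basis vectors. -/
def posWord (r s : ℕ) : Fin r ⊕ Fin s → ZMod 2 := Sum.elim 1 0

/-- The word of the product of all negative basis vectors. -/
def negWord (r s : ℕ) : Fin r ⊕ Fin s → ZMod 2 := Sum.elim 0 1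

theorem wt_add_posWord (w : Fin r ⊕ Fin s → ZMod 2) :
    wt (w + posWord r s) + 2 * posWt w = wt w + r := by
  have := wt_add w (posWord r s)
  simpa [wt, posWt, posWord, Fintype.sum_sum_type, ZMod.val_one] using this

theorem wt_add_negWord (w : Fin r ⊕ Fin s → ZMod 2) :
    wt (w + negWord r s) + 2 * negWt w = wt w + s := by
  have := wt_add w (negWord r s)
  simpa [wt, negWt, negWord, Fintype.sum_sum_type, ZMod.val_one] using this

theorem IsMaximalCode.posWord_mem (hC : IsMaximalCode C) (hr : r = 3) : posWord r s ∈ C := by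
  have hwt : wt (posWord r s) = 3 := by
    simp [wt, posWord, Fintype.sum_sum_type, ZMod.val_one, hr]
  refine hC.maximal _ (fun u hu => ?_) (by simp [negPar, posWord]) ?_
  · have h1 : ∑ i, u i * posWord r s i = posPar u := by
      simp [posPar, posWord, Fintype.sum_sum_type]
    rw [beta, h1, ← wt_cast (posWord r s), hwt, sum_eq_posPar_add_negPar, hC.negPar_eq u hu]
    generalize posPar u = x
    revert x; decide
  · rw [ctwo, ← wt_cast, hwt]; decide

theorem IsMaximalCode.negWord_mem (hC : IsMaximalCode C) (hs : s = 4) : negWord r s ∈ C := by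
  have hwt : wt (negWord r s) = 4 := by
    simp [wt, negWord, Fintype.sum_sum_type, ZMod.val_one, hs]
  refine hC.maximal _ (fun u hu => ?_) (by subst hs; simp [negPar, negWord]; decide) ?_
  · have h1 : ∑ i, u i * negWord r s i = negPar u := by
      simp [negPar, negWord, Fintype.sum_sum_type]
    rw [beta, h1, ← wt_cast (negWord r s), hwt, hC.negPar_eq u hu, add_zero]
    generalize ∑ i, u i = x
    revert x; decide
  · rw [ctwo, ← wt_cast, hwt]; decide

/-- The restrictions on the length and the order of a code given by `code_restrictions`. -/
def IsRestricted (C : AddSubgroup (Fin r ⊕ Fin s → ZMod 2)) : Prop :=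
  (r + s = 3 ∧ 1 ∈ C) ∨ (r + s = 5 ∧ Nat.card C = 4) ∨ (r + s = 6 ∧ Nat.card C = 8) ∨
    (r + s = 7 ∧ 1 ∈ C)

theorem IsRestricted.le_seven (h : IsRestricted C) : Fintype.card (Fin r ⊕ Fin s) ≤ 7 := by
  simp only [Fintype.card_sum, Fintype.card_fin]
  rcases h with h | h | h | h <;> omega

theorem IsMaximalCode.wt_eq_four (hC : IsMaximalCode C) (h7 : Fintype.card (Fin r ⊕ Fin s) ≤ 7)
    {w : Fin r ⊕ Fin s → ZMod 2} (hw : w ∈ C) (h0 : w ≠ 0) (hs : ∑ i, w i = 0) : wt w = 4 := by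
  have h1 := wt_mod_two w
  rw [hs, ZMod.val_zero] at h1
  have h2 := wt_cases h7 (hC.ctwo_eq w hw)
  have h3 : wt w ≠ 0 := fun h => h0 (wt_eq_zero.mp h)
  omega

/-- A code with the restrictions above contains a word of odd weight: the words of weight four
are too long. -/
theorem IsMaximalCode.exists_odd (hC : IsMaximalCode C) (h : IsRestricted C) :
    ∃ o ∈ C, ∑ i, o i = 1 := by
  have hcard : Fintype.card (Fin r ⊕ Fin s) = r + s := by simp
  have hone : ∀ n : ℕ, r + s = n → (n : ZMod 2) = 1 → 1 ∈ C → ∃ o ∈ C, ∑ i, o i = 1 :=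
    fun n hn h1 h2 => ⟨1, h2, by rw [← wt_cast, wt_one, hcard, hn, h1]⟩
  have h7 := h.le_seven
  rcases h with ⟨hn, h1⟩ | ⟨hn, h1⟩ | ⟨hn, h1⟩ | ⟨hn, h1⟩
  · exact hone 3 hn rfl h1
  · by_contra hc
    push Not at hc
    have heven : ∀ w ∈ C, ∑ i, w i = 0 := fun w hw => (zmod_two_cases _).resolve_right (hc w hw)
    obtain ⟨u, hu, v, hv, hu0, hv0, huv⟩ := exists_pair_of_card (C := C) (by omega)
    have h2 := hC.wt_eq_four h7 hu hu0 (heven u hu)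
    have h3 := hC.wt_eq_four h7 hv hv0 (heven v hv)
    have h4 := hC.wt_eq_four h7 (add_mem hu hv) huv (heven _ (add_mem hu hv))
    have h5 := wt_triple_le u v
    omega
  · by_contra hc
    push Not at hc
    have heven : ∀ w ∈ C, ∑ i, w i = 0 := fun w hw => (zmod_two_cases _).resolve_right (hc w hw)
    obtain ⟨i₀⟩ : Nonempty (Fin r ⊕ Fin s) := by
      rw [← Fintype.card_pos_iff]; omega
    obtain ⟨u, hu, v, hv, hu0, hv0, huv, hu', hv'⟩ := exists_pair_vanishing (C := C) (by omega) i₀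
    have h2 := hC.wt_eq_four h7 hu hu0 (heven u hu)
    have h3 := hC.wt_eq_four h7 hv hv0 (heven v hv)
    have h4 := hC.wt_eq_four h7 (add_mem hu hv) huv (heven _ (add_mem hu hv))
    have h5 := wt_triple_lt hu' hv'
    omega
  · exact hone 7 hn rfl h1

/-- The matching of two codes preserves the total weights; if it also preserves the weights on the
negative basis vectors, then the codes differ by a permutation of the basis. -/
theorem exists_perm_of_hom {A : Type*} [AddCommGroup A] (hC₁ : IsMaximalCode C₁)
    (hC₂ : IsMaximalCode C₂) (hR₁ : IsRestricted C₁) (hR₂ : IsRestricted C₂)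
    (hcard : Nat.card C₁ = Nat.card C₂) (l : (Fin r ⊕ Fin s → ZMod 2) →+ A)
    (hl₁ : ∀ u ∈ C₁, ∃ v ∈ C₂, l u = l v) (hl₂ : ∀ v ∈ C₂, ∃ u ∈ C₁, l v = l u)
    (hl : ∀ u v, l u = l v → ∑ i, u i = ∑ i, v i)
    (hneg : ∀ u ∈ C₁, ∀ v ∈ C₂, l u = l v → wt u = wt v →
      (∀ w ∈ C₁, w ∈ C₂ → wt (u + w) = wt (v + w)) → negWt u = negWt v) :
    ∃ π : Equiv.Perm (Fin r ⊕ Fin s), (∀ i, sgn r s (π i) = sgn r s i) ∧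
      ∀ w, w ∈ C₁ ↔ w ∘ π.symm ∈ C₂ := by
  obtain ⟨T, hTC, hTl, hT0, hTd, hT₁, hT₂⟩ := exists_matching word_add_self C₁ C₂ hcard l hl₁ hl₂
  have hcardι : Fintype.card (Fin r ⊕ Fin s) = r + s := by simp
  have hone : ∀ u ∈ C₁, wt u = 7 → 1 ∈ C₁ ∧ 1 ∈ C₂ := by
    intro u _ h7
    have h1 := wt_le_card u
    rcases hR₁ with h | h | h | h <;> rcases hR₂ with h' | h' | h' | h' <;>
      first | exact ⟨h.2, h'.2⟩ | omega
  have hone' : ∀ u ∈ C₂, wt u = 7 → 1 ∈ C₁ ∧ 1 ∈ C₂ := by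
    intro u _ h7
    have h1 := wt_le_card u
    rcases hR₁ with h | h | h | h <;> rcases hR₂ with h' | h' | h' | h' <;>
      first | exact ⟨h.2, h'.2⟩ | omega
  have hwt1 : ∀ w : Fin r ⊕ Fin s → ZMod 2, wt w = 7 ↔ wt w = 7 ∧ r + s = 7 := fun w => by
    refine ⟨fun h => ⟨h, ?_⟩, fun h => h.1⟩
    have h1 := wt_le_card w
    have h2 := hR₁.le_seven
    omega
  have hwt : ∀ t ∈ T, wt t.1 = wt t.2 := by
    intro t ht
    obtain ⟨h1, h2⟩ := hTC t ht
    have h3 := wt_cases hR₁.le_seven (hC₁.ctwo_eq _ h1)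
    have h4 := wt_cases hR₁.le_seven (hC₂.ctwo_eq _ h2)
    have h5 : wt t.1 % 2 = wt t.2 % 2 := by
      rw [wt_mod_two, wt_mod_two, hl _ _ (hTl t ht)]
    have h6 : wt t.1 = 0 ↔ wt t.2 = 0 := by rw [wt_eq_zero, wt_eq_zero, hT0 t ht]
    have h7 : wt t.1 = 7 ∨ wt t.2 = 7 → (wt t.1 = 7 ↔ wt t.2 = 7) := by
      intro h
      obtain ⟨ho₁, ho₂⟩ := h.elim (hone _ h1) (hone' _ h2)
      have hs : r + s = 7 := h.elim (fun h => ((hwt1 _).mp h).2) fun h => ((hwt1 _).mp h).2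
      have h8 := hT0 _ (add_mem ht (hTd 1 ho₁ ho₂))
      rw [Prod.fst_add, Prod.snd_add, ← wt_eq_zero, ← wt_eq_zero] at h8
      have h9 := wt_add_one t.1
      have h10 := wt_add_one t.2
      simp only at h8
      omega
    omega
  have hnegT : ∀ t ∈ T, negWt t.1 = negWt t.2 := fun t ht =>
    hneg _ (hTC t ht).1 _ (hTC t ht).2 (hTl t ht) (hwt t ht) fun w h1 h2 =>
      hwt _ (add_mem ht (hTd w h1 h2))
  have hposT : ∀ t ∈ T, posWt t.1 = posWt t.2 := fun t ht => by
    have h1 := hwt t ht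
    have h2 := hnegT t ht
    rw [wt_eq_posWt_add_negWt, wt_eq_posWt_add_negWt] at h1
    omega
  let resl : (Fin r ⊕ Fin s → ZMod 2) →+ (Fin r → ZMod 2) :=
    { toFun := fun w => w ∘ Sum.inl, map_zero' := rfl, map_add' := fun _ _ => rfl }
  let resr : (Fin r ⊕ Fin s → ZMod 2) →+ (Fin s → ZMod 2) :=
    { toFun := fun w => w ∘ Sum.inr, map_zero' := rfl, map_add' := fun _ _ => rfl }
  obtain ⟨π₁, hπ₁⟩ := exists_perm_of_wt_eq
    ((resl.comp (AddMonoidHom.fst _ _)).comp T.subtype)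
    ((resl.comp (AddMonoidHom.snd _ _)).comp T.subtype) fun t => hposT t t.2
  obtain ⟨π₂, hπ₂⟩ := exists_perm_of_wt_eq
    ((resr.comp (AddMonoidHom.fst _ _)).comp T.subtype)
    ((resr.comp (AddMonoidHom.snd _ _)).comp T.subtype) fun t => hnegT t t.2
  let π : Equiv.Perm (Fin r ⊕ Fin s) := Equiv.sumCongr π₁ π₂
  have hπ : ∀ t ∈ T, t.1 ∘ π.symm = t.2 := by
    intro t ht
    rw [Equiv.comp_symm_eq]
    funext i
    rcases i with i | i
    · exact (hπ₁ ⟨t, ht⟩ i).symm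
    · exact (hπ₂ ⟨t, ht⟩ i).symm
  refine ⟨π, fun i => by rcases i with i | i <;> rfl, fun w => ⟨fun hw => ?_, fun hw => ?_⟩⟩
  · obtain ⟨v, hv⟩ := hT₁ w hw
    rw [hπ _ hv]
    exact (hTC _ hv).2
  · obtain ⟨u, hu⟩ := hT₂ _ hw
    have h1 := hπ _ hu
    have h2 : u = w := π.symm.surjective.injective_comp_right h1
    rw [← h2]
    exact (hTC _ hu).1

/-- If `(r,s) = (5,2)`, a maximal code contains a word of weight four with both negative basis
vectors, since otherwise such a word can be added. -/
theorem IsMaximalCode.exists_even_negative {C : AddSubgroup (Fin 5 ⊕ Fin 2 → ZMod 2)}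
    (hC : IsMaximalCode C) (h1 : 1 ∈ C) : ∃ w ∈ C, ∑ i, w i = 0 ∧ w (Sum.inr 0) = 1 := by
  by_contra hc
  push Not at hc
  have h7 : Fintype.card (Fin 5 ⊕ Fin 2) ≤ 7 := by simp
  have hpos : ∀ w ∈ C, ∑ i, w i = 0 → w ≠ 0 → posWt w = 4 := by
    intro w hw hs h0
    have h2 := hC.wt_eq_four h7 hw h0 hs
    have h3 := (zmod_two_cases _).resolve_right (hc w hw hs)
    have h4 := hC.even_negWt hw
    have h5 : negWt w = (w (Sum.inr 0)).val + (w (Sum.inr 1)).val := by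
      simp [negWt, wt, Fin.sum_univ_two]
    have h6 := val_le_one (w (Sum.inr 1))
    rw [h3, ZMod.val_zero] at h5
    rw [wt_eq_posWt_add_negWt] at h2
    omega
  have huniq : ∀ u ∈ C, ∀ v ∈ C, ∑ i, u i = 0 → ∑ i, v i = 0 → u ≠ 0 → v ≠ 0 → u = v := by
    intro u hu v hv hsu hsv hu0 hv0
    by_contra hne
    have h2 : u + v ≠ 0 := fun h => hne (by
      rw [eq_neg_of_add_eq_zero_left h]; exact neg_eq_of_add_eq_zero_left (word_add_self v))
    have h3 := hpos u hu hsu hu0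
    have h4 := hpos v hv hsv hv0
    have h5 := hpos _ (add_mem hu hv) (by simp [Finset.sum_add_distrib, hsu, hsv]) h2
    have h6 := wt_triple_le (u ∘ Sum.inl) (v ∘ Sum.inl)
    simp only [Fintype.card_fin] at h6
    have h7 : posWt (u + v) = wt (u ∘ Sum.inl + v ∘ Sum.inl) := rfl
    rw [← h7] at h6
    unfold posWt at h3 h4
    omega
  -- two positive basis vectors that no word of the code separates
  obtain ⟨p, q, hpq, hsep⟩ : ∃ p q : Fin 5, p ≠ q ∧
      ∀ u ∈ C, ∑ i, u i = 0 → u (Sum.inl p) = u (Sum.inl q) := by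
    by_cases h2 : ∃ a ∈ C, ∑ i, a i = 0 ∧ a ≠ 0
    · obtain ⟨a, ha, has, ha0⟩ := h2
      have h3 : ∀ x y z : ZMod 2, x = y ∨ x = z ∨ y = z := by decide
      have h4 : ∃ p q : Fin 5, p ≠ q ∧ a (Sum.inl p) = a (Sum.inl q) := by
        rcases h3 (a (Sum.inl 0)) (a (Sum.inl 1)) (a (Sum.inl 2)) with h | h | h
        exacts [⟨0, 1, by decide, h⟩, ⟨0, 2, by decide, h⟩, ⟨1, 2, by decide, h⟩]
      obtain ⟨p, q, hpq, h5⟩ := h4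
      refine ⟨p, q, hpq, fun u hu hus => ?_⟩
      by_cases hu0 : u = 0
      · rw [hu0]; rfl
      · rw [huniq u hu a ha hus has hu0 ha0, h5]
    · push Not at h2
      exact ⟨0, 1, by decide, fun u hu hus => by rw [h2 u hu hus]; rfl⟩
  have hsep' : ∀ u ∈ C, u (Sum.inl p) = u (Sum.inl q) := by
    intro u hu
    rcases zmod_two_cases (∑ i, u i) with h2 | h2
    · exact hsep u hu h2
    · have h3 := hsep (u + 1) (add_mem hu h1) (by
        rw [show ∑ i, (u + 1) i = ∑ i, u i + ∑ i : Fin 5 ⊕ Fin 2, (1 : ZMod 2) from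
          Finset.sum_add_distrib, h2]
        decide)
      exact add_right_cancel h3
  let x : Fin 5 ⊕ Fin 2 → ZMod 2 :=
    negWord 5 2 + (Pi.single (Sum.inl p) 1 + Pi.single (Sum.inl q) 1)
  have hx : negPar x = 0 ∧ ctwo x = ∑ i, x i ∧ ∑ i, x i = 0 ∧ x (Sum.inr 0) = 1 := by
    clear hsep hsep'
    revert p q
    decide
  refine hc x (hC.maximal x (fun u hu => ?_) hx.1 hx.2.1) hx.2.2.1 hx.2.2.2
  have h2 : beta u (negWord 5 2) = 0 := by
    have h3 : ∑ i, u i * negWord 5 2 i = negPar u := by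
      simp [negPar, negWord, Fintype.sum_sum_type]
    rw [beta, h3, hC.negPar_eq u hu, add_zero]
    have : ∑ i, negWord 5 2 i = 0 := by decide
    rw [this, mul_zero]
  rw [beta_add_right, beta_add_right, h2, beta_comm u, beta_comm u, beta_single_left,
    beta_single_left, hsep' u hu, zero_add, CharTwo.add_self_eq_zero]

/-- The maximal codes subject to the restrictions above are unique up to permutations of the
positive and of the negative basis vectors. -/
theorem exists_perm_of_isMaximalCode (hC₁ : IsMaximalCode C₁)
    (hC₂ : IsMaximalCode C₂) (hR₁ : IsRestricted C₁) (hR₂ : IsRestricted C₂)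
    (hcard : Nat.card C₁ = Nat.card C₂) :
    ∃ π : Equiv.Perm (Fin r ⊕ Fin s), (∀ i, sgn r s (π i) = sgn r s i) ∧
      ∀ w, w ∈ C₁ ↔ w ∘ π.symm ∈ C₂ := by
  let S : (Fin r ⊕ Fin s → ZMod 2) →+ ZMod 2 :=
    { toFun := fun w => ∑ i, w i, map_zero' := by simp,
      map_add' := fun u v => by simp [Finset.sum_add_distrib] }
  have hS : ∀ w, S w = ∑ i, w i := fun _ => rfl
  by_cases h52 : r = 5 ∧ s = 2
  · obtain ⟨rfl, rfl⟩ := h52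
    have ho₁ : 1 ∈ C₁ := by rcases hR₁ with h | h | h | h <;> first | omega | exact h.2
    have ho₂ : 1 ∈ C₂ := by rcases hR₂ with h | h | h | h <;> first | omega | exact h.2
    let l := S.prod (Pi.evalAddMonoidHom (fun _ : Fin 5 ⊕ Fin 2 => ZMod 2) (Sum.inr 0))
    have hl : ∀ w, l w = (∑ i, w i, w (Sum.inr 0)) := fun _ => rfl
    -- the unit word and a word with both negative basis vectors give all values
    have hval : ∀ {C : AddSubgroup (Fin 5 ⊕ Fin 2 → ZMod 2)}, IsMaximalCode C → 1 ∈ C →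
        ∀ u, ∃ v ∈ C, l u = l v := by
      intro C hC h1 u
      obtain ⟨x, hx, hx0, hx1⟩ := hC.exists_even_negative h1
      have hlx : l x = (0, 1) := by rw [hl, hx0, hx1]
      have hl1 : l 1 = (1, 1) := rfl
      obtain ⟨y, z⟩ := l u
      rcases zmod_two_cases y with rfl | rfl <;> rcases zmod_two_cases z with rfl | rfl
      · exact ⟨0, zero_mem _, (map_zero l).symm⟩
      · exact ⟨x, hx, hlx.symm⟩
      · exact ⟨1 + x, add_mem h1 hx, by rw [map_add, hl1, hlx]; rfl⟩
      · exact ⟨1, h1, rfl⟩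
    refine exists_perm_of_hom hC₁ hC₂ hR₁ hR₂ hcard l (fun u _ => hval hC₂ ho₂ u)
      (fun v _ => hval hC₁ ho₁ v) (fun u v h => congrArg Prod.fst h) fun u hu v hv h _ _ => ?_
    have h1 : u (Sum.inr 0) = v (Sum.inr 0) := congrArg Prod.snd h
    have h2 : ∀ {C : AddSubgroup (Fin 5 ⊕ Fin 2 → ZMod 2)}, IsMaximalCode C → ∀ w ∈ C,
        negWt w = 2 * (w (Sum.inr 0)).val := by
      intro C hC w hw
      have h4 := hC.even_negWt hw
      have h5 : negWt w = (w (Sum.inr 0)).val + (w (Sum.inr 1)).val := by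
        simp [negWt, wt, Fin.sum_univ_two]
      have h6 := val_le_one (w (Sum.inr 1))
      have h7 := val_le_one (w (Sum.inr 0))
      omega
    rw [h2 hC₁ u hu, h2 hC₂ v hv, h1]
  · have hval : ∀ {C : AddSubgroup (Fin r ⊕ Fin s → ZMod 2)}, IsMaximalCode C → IsRestricted C →
        ∀ u, ∃ v ∈ C, S u = S v := by
      intro C hC hR u
      obtain ⟨o, ho, ho1⟩ := hC.exists_odd hR
      rcases zmod_two_cases (S u) with h | h
      · exact ⟨0, zero_mem _, by rw [h, map_zero]⟩
      · exact ⟨o, ho, by rw [h, hS, ho1]⟩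
    refine exists_perm_of_hom hC₁ hC₂ hR₁ hR₂ hcard S (fun u _ => hval hC₂ hR₂ u)
      (fun v _ => hval hC₁ hR₁ v) (fun u v h => h) fun u hu v hv _ hwt hadd => ?_
    have hu2 := hC₁.even_negWt hu
    have hv2 := hC₂.even_negWt hv
    have hu3 := wt_eq_posWt_add_negWt u
    have hv3 := wt_eq_posWt_add_negWt v
    have hur := posWt_le u
    have hvr := posWt_le v
    have hus := negWt_le u
    have hvs := negWt_le v
    -- the case where the weights determine the negative weights by parity
    by_cases hr : r ≤ 1
    · omega
    by_cases hs : s ≤ 1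
    · omega
    by_cases hr3 : r = 3
    · have h1 := hadd _ (hC₁.posWord_mem hr3) (hC₂.posWord_mem hr3)
      have h2 := wt_add_posWord u
      have h3 := wt_add_posWord v
      omega
    by_cases hs4 : s = 4
    · have h1 := hadd _ (hC₁.negWord_mem hs4) (hC₂.negWord_mem hs4)
      have h2 := wt_add_negWord u
      have h3 := wt_add_negWord v
      omega
    have hwu := wt_cases hR₁.le_seven (hC₁.ctwo_eq u hu)
    rcases hR₁ with ⟨hn, h1⟩ | ⟨hn, h1⟩ | ⟨hn, h1⟩ | ⟨hn, h1⟩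
    · omega
    · have : r = 2 := by omega
      omega
    · -- there is no such code if `(r,s) = (4,2)`
      exfalso
      obtain ⟨rfl, rfl⟩ : r = 4 ∧ s = 2 := by omega
      obtain ⟨x, hx, y, hy, hx0, hy0, hxy, hx', hy'⟩ :=
        exists_pair_vanishing (C := C₁) (by omega) (Sum.inr 0)
      have h3 : ∀ w ∈ C₁, w ≠ 0 → w (Sum.inr 0) = 0 → 3 ≤ posWt w := by
        intro w hw h0 hw0
        have h4 := hC₁.even_negWt hw
        have h5 : negWt w = (w (Sum.inr 0)).val + (w (Sum.inr 1)).val := by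
          simp [negWt, wt, Fin.sum_univ_two]
        have h6 := val_le_one (w (Sum.inr 1))
        rw [hw0, ZMod.val_zero] at h5
        have h7 := wt_cases (by simp) (hC₁.ctwo_eq w hw)
        have h8 := wt_eq_posWt_add_negWt w
        have h9 : wt w ≠ 0 := fun h => h0 (wt_eq_zero.mp h)
        omega
      have h4 := h3 x hx hx0 hx'
      have h5 := h3 y hy hy0 hy'
      have h6 := h3 _ (add_mem hx hy) hxy (by rw [Pi.add_apply, hx', hy', add_zero])
      have h7 : posWt x + posWt y + posWt (x + y) ≤ 2 * Fintype.card (Fin 4) :=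
        wt_triple_le (x ∘ Sum.inl) (y ∘ Sum.inl)
      simp only [Fintype.card_fin] at h7
      omega
    · have h2 := hC₁.even_negWt h1
      have h3 : negWt (1 : Fin r ⊕ Fin s → ZMod 2) = s := by
        show wt (1 : Fin s → ZMod 2) = s
        simp
      omega

end Classification

/-! ### Codes and equivalence of groups of positive involutions -/

section CodeEquivalence

variable {r s : ℕ} {B : Module.Basis (Fin r ⊕ Fin s) ℝ (RS r s)}

theorem word_extend_signedPerm (hB : IsOrthonormalBasis B) (π : Equiv.Perm (Fin r ⊕ Fin s))
    (hπ : ∀ i, sgn r s (π i) = sgn r s i) :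
    ∀ σ ∈ G B, extend (signedPerm hB π hπ 0) σ ∈ G B ∧
      word hB (extend (signedPerm hB π hπ 0) σ) = word hB σ ∘ π.symm := by
  have hz : ∀ i, extend (signedPerm hB π hπ 0) (zU hB i) = zU hB (π i) := fun i => by
    have := extend_zU hB (a := 0) (signedPerm_apply hB π hπ 0 i)
    rwa [signed_zero] at this
  refine G_induction hB ?_ ?_ ?_
  · rw [map_one, word_one]
    exact ⟨one_mem _, rfl⟩
  · rintro σ hσ ⟨h1, h2⟩
    rw [extend_neg, word_neg hB h1, word_neg hB hσ, h2]
    exact ⟨neg_mem_G h1, rfl⟩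
  · rintro i σ hσ ⟨h1, h2⟩
    rw [map_mul, hz, word_mul hB (zU_mem_G hB _) h1, word_mul hB (zU_mem_G hB _) hσ, h2, word_zU,
      word_zU]
    refine ⟨mul_mem (zU_mem_G hB _) h1, ?_⟩
    funext j
    simp [Pi.single_apply, Equiv.symm_apply_eq]

/-- Groups whose codes differ by a permutation of the basis are equivalent. -/
theorem equivalent_of_perm (hB : IsOrthonormalBasis B) {S₁ S₂ : Subgroup (Cl r s)ˣ}
    (hS₁ : S₁ ≤ G B) (hS₂ : S₂ ≤ G B) (π : Equiv.Perm (Fin r ⊕ Fin s))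
    (hπ : ∀ i, sgn r s (π i) = sgn r s i)
    (h : ∀ w, w ∈ codeOf hB S₁ ↔ w ∘ π.symm ∈ codeOf hB S₂) : Equivalent B S₁ S₂ := by
  have hC := isReordering_signedPerm hB π hπ 0
  have hiff : ∀ σ ∈ G B, σ ∈ hat S₁ ↔ extend (signedPerm hB π hπ 0) σ ∈ hat S₂ := fun σ hσ => by
    obtain ⟨h1, h2⟩ := word_extend_signedPerm hB π hπ σ hσ
    rw [← word_mem_codeOf_iff hB hσ, ← word_mem_codeOf_iff hB h1, h2, h]
  refine ⟨signedPerm hB π hπ 0, hC, ?_⟩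
  ext τ
  constructor
  · rintro ⟨σ, hσ, rfl⟩
    exact (hiff σ (hat_subset_G hS₁ hσ)).mp hσ
  · intro hτ
    obtain ⟨σ, hσ, rfl⟩ := extend_surjOn_G hB hC τ (hat_subset_G hS₂ hτ)
    exact ⟨σ, (hiff σ hσ).mpr hτ, rfl⟩

variable {V : Type*} [AddCommGroup V] [Module ℝ V]
  {J : Cl r s →ₐ[ℝ] Module.End ℝ V} {b : LinearMap.BilinForm ℝ V}
  {κ : Type*} {e : Module.Basis κ ℝ V} {S S₁ S₂ : Subgroup (Cl r s)ˣ}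

theorem isMaximalCode_codeOf [FiniteDimensional ℝ V] (hB : IsOrthonormalBasis B)
    (hV : IsMinimalAdmissible J b) (hS : IsPositiveInvolutionGroup B S) (he : IsBasisOf B J b S e) :
    IsMaximalCode (codeOf hB S) := by
  obtain ⟨v, hv, hat⟩ := exists_orbitBasis he
  refine ⟨fun w => ctwo_of_mem_codeOf hB hS, fun w => even_negPar_of_mem_codeOf hB hS, ?_⟩
  rw [← codeOf_congr hB hat]
  exact fun w => hv.mem_codeOf_of_beta_eq_zero hB hV

/-- The words that would give self-adjoint operators anticommuting with the Clifford action do not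
exist if `𝔸` consists of orthogonal maps. -/
theorem ctwo_eq_one_of_beta_eq_sum (hB : IsOrthonormalBasis B) (h : IsAdmissible J b)
    (hA : ∀ A ∈ groupA h, ∀ u v, b (A u) (A v) = b u v) (he : IsBasisOf B J b S e) :
    ∀ w, (∀ u ∈ codeOf hB S, beta u w = ∑ i, u i) → ctwo w = 1 := by
  obtain ⟨v, hv, hat⟩ := exists_orbitBasis he
  rw [← codeOf_congr hB hat]
  exact fun w => hv.ctwo_eq_one hB h hA

theorem isRestricted_codeOf (hB : IsOrthonormalBasis B) (h : IsAdmissible J b) (hrs : r + s ≤ 10)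
    (hA : ∀ A ∈ groupA h, ∀ u v, b (A u) (A v) = b u v)
    (hS : IsPositiveInvolutionGroup B S) (he : IsBasisOf B J b S e) :
    IsRestricted (codeOf hB S) := by
  have h1 := code_restrictions (codeOf hB S) (by simpa using hrs)
    (fun w => ctwo_of_mem_codeOf hB hS) (ctwo_eq_one_of_beta_eq_sum hB h hA he)
  simp only [Fintype.card_sum, Fintype.card_fin] at h1
  exact h1

/-- In small dimensions all maximal groups of positive involutions are equivalent, if `𝔸` consists
of orthogonal maps. -/
theorem equivalent_of_add_le_ten [FiniteDimensional ℝ V] (hB : IsOrthonormalBasis B)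
    (hV : IsMinimalAdmissible J b) (hrs : r + s ≤ 10)
    (hA : ∀ A ∈ groupA hV.admissible, ∀ u v, b (A u) (A v) = b u v)
    (hS₁ : IsMaximalGroup B V S₁) (hS₂ : IsMaximalGroup B V S₂)
    {κ₁ κ₂ : Type*} {e₁ : Module.Basis κ₁ ℝ V} {e₂ : Module.Basis κ₂ ℝ V}
    (he₁ : IsBasisOf B J b S₁ e₁) (he₂ : IsBasisOf B J b S₂ e₂) : Equivalent B S₁ S₂ := by
  have hP₁ := hS₁.toIsPositiveInvolutionGroup
  have hP₂ := hS₂.toIsPositiveInvolutionGroup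
  obtain ⟨π, hπ, h⟩ := exists_perm_of_isMaximalCode
    (isMaximalCode_codeOf hB hV hP₁ he₁) (isMaximalCode_codeOf hB hV hP₂ he₂)
    (isRestricted_codeOf hB hV.admissible hrs hA hP₁ he₁)
    (isRestricted_codeOf hB hV.admissible hrs hA hP₂ he₂) (by
      rw [card_codeOf hB hP₁, card_codeOf hB hP₂]
      exact Nat.eq_of_mul_eq_mul_right (Nat.mul_pos two_pos hV.pos)
        (hS₁.card_eq.trans hS₂.card_eq.symm))
  exact equivalent_of_perm hB hS₁.le_G hS₂.le_G π hπ h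

/-- If `𝔸` consists of orthogonal maps, then `r + s > 0`. -/
theorem nonempty_of_orthogonal (hB : IsOrthonormalBasis B) (h : IsAdmissible J b)
    (hA : ∀ A ∈ groupA h, ∀ u v, b (A u) (A v) = b u v) (he : IsBasisOf B J b S e) :
    Nonempty (Fin r ⊕ Fin s) := by
  by_contra hne
  rw [not_nonempty_iff] at hne
  have h1 := ctwo_eq_one_of_beta_eq_sum hB h hA he 0 fun u _ => by simp
  rw [ctwo_zero] at h1
  exact zero_ne_one h1

end CodeEquivalence

end PseudoH

theorem mainTheorem4 {r s : ℕ}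
    (B : Module.Basis (Fin r ⊕ Fin s) ℝ (PseudoH.RS r s)) (hB : PseudoH.IsOrthonormalBasis B)
    {V : Type*} [AddCommGroup V] [Module ℝ V] [FiniteDimensional ℝ V]
    {J : PseudoH.Cl r s →ₐ[ℝ] Module.End ℝ V} {b : LinearMap.BilinForm ℝ V}
    (hV : PseudoH.IsMinimalAdmissible J b)
    (hA : ∀ A ∈ PseudoH.groupA hV.admissible, ∀ u v, b (A u) (A v) = b u v)
    (S₁ S₂ : Subgroup (PseudoH.Cl r s)ˣ)
    (hS₁ : PseudoH.IsMaximalGroup B V S₁) (hS₂ : PseudoH.IsMaximalGroup B V S₂)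
    {κ₁ κ₂ : Type*} (e₁ : Module.Basis κ₁ ℝ V) (e₂ : Module.Basis κ₂ ℝ V)
    (he₁ : PseudoH.IsBasisOf B J b S₁ e₁) (he₂ : PseudoH.IsBasisOf B J b S₂ e₂) :
    (PseudoH.Equivalent B S₁ S₂ ↔
      PseudoH.IsomorphicByReordering B
        (PseudoH.integralStructure hB hV.admissible he₁.toIsInvariantBasis)
        (PseudoH.integralStructure hB hV.admissible he₂.toIsInvariantBasis)) ∧
    (s = 0 ∨ PseudoH.InTable r s →
      (PseudoH.Equivalent B S₁ S₂ ↔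
        PseudoH.Isomorphic
          (PseudoH.integralStructure hB hV.admissible he₁.toIsInvariantBasis)
          (PseudoH.integralStructure hB hV.admissible he₂.toIsInvariantBasis))) := by
  have hiff := PseudoH.isomorphicByReordering_of_equivalent hB hV.admissible he₁ he₂
  refine ⟨⟨hiff, PseudoH.equivalent_of_isomorphicByReordering hB hV hA hS₁.le_G hS₂.le_G he₁ he₂⟩,
    fun hrs => ⟨fun h => ?_, fun h => ?_⟩⟩
  · obtain ⟨Φ, -⟩ := hiff h
    exact ⟨Φ⟩
  · by_cases hs : s = 0
    · obtain ⟨k₀⟩ := PseudoH.nonempty_of_orthogonal hB hV.admissible hA he₁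
      exact PseudoH.equivalent_of_isomorphic_definite hB hs k₀ hV hA hS₁.le_G hS₂.le_G he₁ he₂ h
    · refine PseudoH.equivalent_of_add_le_ten hB hV ?_ hA hS₁ hS₂ he₁ he₂
      have h1 := hrs.resolve_left hs
      unfold PseudoH.InTable at h1
      omega
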